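/- Let $G$ be a finite group, let $\mathsf X=[\bullet/G]$ be the orbifold given by a point with the trivial action of $G$, and let $BG$ be the classifying space of the groupoid $\bullet\rtimes G$ (the geometric realization of its nerve), with universal bundle $p\colon EG\to BG$, where $EG$ is the classifying space of the groupoid of $G$ acting on itself by right translations. Let $\mathcal L BG=\mathrm{Map}(S^1,BG)$ be the free loop space (continuous maps, compact-open topology). For $g\in G$ let $C(g)$ be its centralizer, and choose one representative $g$ in each conjugacy class $(g)$. Let $P_G(\bullet)=\{\star_g : g\in G\}$ be the discrete space of pairs of an element $g\in G$ and a (necessarily constant) path in the point, with $G$ acting by conjugation, and let $\mathsf L\mathsf X=P_G(\bullet)\rtimes G$ be the loop groupoid. 1. There are equivalences of categories $\mathsf L\mathsf X\simeq[G/G]\simeq\coprod_{(g)}[\bullet/C(g)]$, where $G$ acts on $G$ by conjugation. 2. There is a homotopy equivalence $\mathcal L BG\simeq\coprod_{(g)}BC(g)$. 3. $H_n(\mathcal L BG;\mathbb C)=0$ for $n\neq0$, and $H_*(\mathcal L BG;\mathbb C)$ is isomorphic, as a commutative Frobenius algebra over $\mathbb C$, to the Dijkgraaf–Witten algebra, that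 is, to the center $Z(\mathbb C[G])$ of the group algebra with trace $\sum_g a_g g\mapsto a_1/|G|$. The structure on $H_*(\mathcal L BG;\mathbb C)$ in 3 is the following. Let $W$ be the space of triples $(\sigma,\tilde\sigma,k)$ with $\sigma\in\mathcal L BG$, $\tilde\sigma\colon[0,1]\to EG$ a path with $p(\tilde\sigma(t))=\sigma(e^{2\pi i t})$, and $k\in G$ with $\tilde\sigma(0)k=\tilde\sigma(1)$. The projection $q\colon W\to\mathcal L BG$ is a covering with finite fibres, and the holonomy map $W\to P_G(\bullet)$, $(\sigma,\tilde\sigma,k)\mapsto\star_k$, induces an isomorphism in homology with complex coefficients. Let $\theta_*\colon H_*(\mathcal L BG;\mathbb C)\to H_*(P_G(\bullet);\mathbb C)$ be the transfer of $q$ followed by the map induced by the holonomy, and let $\sigma_*\colon H_*(P_G(\bullet);\mathbb C)\to H_*(\mathcal L BG;\mathbb C)$ be the inverse of the holonomy isomorphism followed by $q_*$. The orbifold string product is $x\circ y=\sigma_*(\theta_*x\cdot\theta_*y)$, where $\cdot$ is the product on $H_*(P_G(\bullet);\mathbb C)$ induced by concatenation $\star_g\cdot\star_h=\star_{gh}$,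 and the trace of $x$ is the coefficient of $\star_1$ in $\theta_*x$. -/

import Mathlib

open CategoryTheory Simplicial AlgebraicTopology Limits
universe u

instance simplex_contractible (n : SimplexCategory) :
    ContractibleSpace (SimplexCategory.toTop.{u}.obj n) :=
  haveI : ContractibleSpace (stdSimplex ℝ (Fin (n.len + 1))) :=
    (convex_stdSimplex ℝ (Fin (n.len + 1))).contractibleSpace
      ⟨_, single_mem_stdSimplex ℝ (0 : Fin (n.len + 1))⟩
  (Homeomorph.ulift.{u} (X := stdSimplex ℝ (Fin (n.len + 1)))).contractibleSpace

instance simplex_locallyPathConnected (n : SimplexCategory) :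
    LocallyPathConnectedSpace (SimplexCategory.toTop.{u}.obj n) :=
  haveI : LocallyPathConnectedSpace (stdSimplex ℝ (Fin (n.len + 1))) :=
    (convex_stdSimplex ℝ (Fin (n.len + 1))).locallyPathConnectedSpace
  (Homeomorph.ulift.{u} (X := stdSimplex ℝ (Fin (n.len + 1)))).symm.isQuotientMap.locallyPathConnectedSpace


/-- The continuous map underlying a singular simplex. -/
noncomputable abbrev simplexMap {X : TopCat.{u}} {n : ℕ} (x : (TopCat.toSSet.obj X) _⦋n⦌) :
    C(SimplexCategory.toTop.{u}.obj ⦋n⦌, X) :=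
  TopCat.Hom.hom (X := SimplexCategory.toTop.{u}.obj ⦋n⦌) (Y := X) x.down

/-- The singular simplex given by a continuous map. -/
noncomputable abbrev mkSimplex {X : TopCat.{u}} {n : ℕ} (f : C(SimplexCategory.toTop.{u}.obj ⦋n⦌, X)) :
    (TopCat.toSSet.obj X) _⦋n⦌ := ULift.up (TopCat.ofHom f)

lemma simplex_ext {X : TopCat.{u}} {n : ℕ} {x y : (TopCat.toSSet.obj X) _⦋n⦌}
    (h : ∀ t, simplexMap x t = simplexMap y t) : x = y := by
  apply ULift.ext
  exact TopCat.hom_ext (ContinuousMap.ext h)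

/-- The singular `n`-simplices of `E` lying over the singular `n`-simplex `x` of `B`. -/
abbrev Lifts {E B : TopCat.{u}} (p : E ⟶ B) {n : ℕ} (x : (TopCat.toSSet.obj B) _⦋n⦌) : Type u :=
  {y : (TopCat.toSSet.obj E) _⦋n⦌ // (TopCat.toSSet.map p).app _ y = x}

lemma simplexMap_lift {E B : TopCat.{u}} (p : E ⟶ B) {n : ℕ}
    {x : (TopCat.toSSet.obj B) _⦋n⦌} (y : Lifts p x) (t) : p (simplexMap y.1 t) = simplexMap x t :=
  congrArg (fun z => simplexMap z t) y.2

lemma simplexMap_δ {X : TopCat.{u}} {n : ℕ} (i : Fin (n + 2))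
    (x : (TopCat.toSSet.obj X) _⦋n + 1⦌) (t) :
    simplexMap ((TopCat.toSSet.obj X).δ i x) t =
      simplexMap x (SimplexCategory.toTop.{u}.map (SimplexCategory.δ i) t) := rfl

lemma lifts_eq {E B : TopCat.{u}} (p : E ⟶ B) (hp : IsCoveringMap p) {n : ℕ}
    {x : (TopCat.toSSet.obj B) _⦋n⦌} (y z : Lifts p x)
    (a : SimplexCategory.toTop.{u}.obj ⦋n⦌) (h : simplexMap y.1 a = simplexMap z.1 a) : y = z := by
  apply Subtype.ext
  apply simplex_ext
  refine congrFun (hp.eq_of_comp_eq (simplexMap y.1).continuous (simplexMap z.1).continuous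
    ?_ a h)
  funext t
  simp only [Function.comp, simplexMap_lift]

/-- Passing to the `i`-th face maps lifts of `x` to lifts of its `i`-th face. -/
noncomputable def faceLift {E B : TopCat.{u}} (p : E ⟶ B) {n : ℕ} (i : Fin (n + 2))
    (x : (TopCat.toSSet.obj B) _⦋n + 1⦌) (y : Lifts p x) :
    Lifts p ((TopCat.toSSet.obj B).δ i x) :=
  ⟨(TopCat.toSSet.obj E).δ i y.1, congrArg ((TopCat.toSSet.obj B).δ i) y.2⟩

lemma faceLift_bijective {E B : TopCat.{u}} (p : E ⟶ B) (hp : IsCoveringMap p) {n : ℕ}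
    (i : Fin (n + 2)) (x : (TopCat.toSSet.obj B) _⦋n + 1⦌) :
    Function.Bijective (faceLift p i x) := by
  let b : SimplexCategory.toTop.{u}.obj ⦋n⦌ := Classical.arbitrary _
  let a := SimplexCategory.toTop.{u}.map (SimplexCategory.δ i) b
  constructor
  · intro y z h
    refine lifts_eq p hp y z a ?_
    rw [← simplexMap_δ, ← simplexMap_δ]
    exact congrArg (fun w => simplexMap w.1 b) h
  · intro y
    obtain ⟨F, ⟨hF, hpF⟩, -⟩ := hp.existsUnique_continuousMap_lifts (simplexMap x) a
      (simplexMap y.1 b) (by rw [simplexMap_lift]; rfl)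
    refine ⟨⟨mkSimplex F, simplex_ext fun t => congrFun hpF t⟩, ?_⟩
    exact lifts_eq p hp _ _ b hF

lemma finite_lifts {E B : TopCat.{u}} (p : E ⟶ B) (hp : IsCoveringMap p)
    (hf : ∀ b, Finite (p ⁻¹' {b})) {n : ℕ} (x : (TopCat.toSSet.obj B) _⦋n⦌) :
    Finite (Lifts p x) := by
  let a : SimplexCategory.toTop.{u}.obj ⦋n⦌ := Classical.arbitrary _
  have := hf (simplexMap x a)
  exact Finite.of_injective (β := p ⁻¹' {simplexMap x a})
    (fun y => ⟨simplexMap y.1 a, simplexMap_lift p y a⟩)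
    fun y z h => lifts_eq p hp y z a (congrArg Subtype.val h)

/-- The coefficients of homology: the one-dimensional complex vector space. -/
abbrev coeffs : ModuleCat.{u} ℂ := ModuleCat.of ℂ (ULift.{u} ℂ)

/-- The singular chains of `X` with complex coefficients. -/
noncomputable abbrev chains (X : TopCat.{u}) : ChainComplex (ModuleCat.{u} ℂ) ℕ :=
  (TopCat.toSSet.obj X).chainComplex coeffs

/-- The `n`-th singular homology `H_n(X; ℂ)`. -/
noncomputable abbrev Hn (n : ℕ) (X : TopCat.{u}) : ModuleCat.{u} ℂ :=
  ((singularHomologyFunctor (ModuleCat.{u} ℂ) n).obj coeffs).obj X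



/-- The transfer of a finite covering on `n`-chains: a simplex goes to the sum of its lifts. -/
noncomputable def transferX {E B : TopCat.{u}} (p : E ⟶ B) (hp : IsCoveringMap p)
    (hf : ∀ b, Finite (p ⁻¹' {b})) (n : ℕ) : (chains B).X n ⟶ (chains E).X n :=
  Cofan.IsColimit.desc (SSet.isColimitChainComplexXCofan (TopCat.toSSet.obj B) coeffs n)
    fun x =>
      haveI := @Fintype.ofFinite _ (finite_lifts p hp hf x)
      ∑ y : Lifts p x, SSet.ιChainComplex (R := coeffs) (TopCat.toSSet.obj E) y.1

lemma ι_transferX {E B : TopCat.{u}} (p : E ⟶ B) (hp : IsCoveringMap p)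
    (hf : ∀ b, Finite (p ⁻¹' {b})) (n : ℕ) (x : (TopCat.toSSet.obj B) _⦋n⦌) [Fintype (Lifts p x)] :
    SSet.ιChainComplex (R := coeffs) (TopCat.toSSet.obj B) x ≫ transferX p hp hf n =
      ∑ y : Lifts p x, SSet.ιChainComplex (R := coeffs) (TopCat.toSSet.obj E) y.1 := by
  refine (Cofan.IsColimit.fac (SSet.isColimitChainComplexXCofan (TopCat.toSSet.obj B) coeffs n)
    _ x).trans ?_
  exact Finset.sum_congr (by ext; simp) fun _ _ => rfl

/-- The transfer as a chain map. -/
noncomputable def transferChain {E B : TopCat.{u}} (p : E ⟶ B) (hp : IsCoveringMap p)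
    (hf : ∀ b, Finite (p ⁻¹' {b})) : chains B ⟶ chains E where
  f n := transferX p hp hf n
  comm' i j hij := by
    obtain rfl : j + 1 = i := hij
    apply SSet.chainComplex_hom_ext
    intro x
    have hfin : ∀ (n : ℕ) (x : (TopCat.toSSet.obj B) _⦋n⦌), Fintype (Lifts p x) :=
      fun n x => @Fintype.ofFinite _ (finite_lifts p hp hf x)
    rw [← Category.assoc, ι_transferX, Preadditive.sum_comp]
    refine Eq.trans (Finset.sum_congr rfl fun y _ => SSet.ιChainComplex_d _ _ y.1) ?_
    refine Eq.trans ?_ (Category.assoc _ _ _)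
    refine Eq.trans ?_ (congrArg (fun k => k ≫ transferX p hp hf j)
      (SSet.ιChainComplex_d _ _ x)).symm
    rw [Finset.sum_comm, Preadditive.sum_comp]
    refine Finset.sum_congr rfl fun i _ => ?_
    rw [Preadditive.zsmul_comp, ι_transferX, ← Finset.smul_sum]
    congr 1
    exact Fintype.sum_bijective _ (faceLift_bijective p hp i x) _ _ fun y => rfl

/-- The transfer in degree `n` homology. -/
noncomputable def transferHn {E B : TopCat.{u}} (p : E ⟶ B) (hp : IsCoveringMap p)
    (hf : ∀ b, Finite (p ⁻¹' {b})) (n : ℕ) : Hn n B →ₗ[ℂ] Hn n E :=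
  (HomologicalComplex.homologyMap (transferChain p hp hf) n).hom

/-! ### Translation groupoids and classifying spaces -/

/-- The translation groupoid `M ⋊ G` of a right action (an action of `Gᵐᵒᵖ`): objects are the points
of `M`, and an arrow `x ⟶ y` is an element `g` with `x g = y`. -/
abbrev TranslationGroupoid (G : Type u) [Group G] (M : Type u) [MulAction Gᵐᵒᵖ M] : Type u :=
  ActionCategory Gᵐᵒᵖ M

/-- An equivariant map induces a functor of translation groupoids. -/
def TranslationGroupoid.map {G : Type u} [Group G] {M N : Type u} [MulAction Gᵐᵒᵖ M]
    [MulAction Gᵐᵒᵖ N] (f : M →[Gᵐᵒᵖ] N) : TranslationGroupoid G M ⥤ TranslationGroupoid G N where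
  obj x := ActionCategory.objEquiv Gᵐᵒᵖ N (f x.back)
  map {x _} a := ⟨a.val, (map_smul f a.val x.back).symm.trans (congrArg f a.property)⟩
  map_id _ := rfl
  map_comp _ _ := rfl

/-- The classifying space of a small category: the geometric realization of its nerve. -/
noncomputable abbrev classifyingSpace (C : Type u) [Category.{u} C] : TopCat.{u} :=
  SSet.toTop.obj (nerve C)

/-- The continuous map of classifying spaces induced by a functor. -/
noncomputable abbrev classifyingSpaceMap {C D : Type u} [Category.{u} C] [Category.{u} D]
    (F : C ⥤ D) : classifyingSpace C ⟶ classifyingSpace D :=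
  SSet.toTop.map (nerveMap F)

/-- The classifying space `BG` of the orbifold `[•/G]`. -/
noncomputable abbrev BSpace (G : Type u) [Group G] : TopCat.{u} :=
  classifyingSpace (TranslationGroupoid G PUnit.{u + 1})

/-- The total space `EG` of the universal `G`-bundle: the classifying space of the groupoid of `G`
acting on itself by right translations. -/
noncomputable abbrev ESpace (G : Type u) [Group G] : TopCat.{u} :=
  classifyingSpace (TranslationGroupoid G G)

/-- The universal bundle `EG ⟶ BG`, induced by the equivariant map from `G` to a point. -/
noncomputable def bundleMap (G : Type u) [Group G] : ESpace G ⟶ BSpace G :=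
  classifyingSpaceMap (TranslationGroupoid.map
    { toFun := fun _ : G => PUnit.unit, map_smul' := fun _ _ => rfl })

/-- The right action `ξ ↦ ξ k` of `G` on `EG`, induced by the maps `x ↦ k⁻¹ x` of `G`. -/
noncomputable def rightTranslate {G : Type u} [Group G] (k : G) : ESpace G ⟶ ESpace G :=
  classifyingSpaceMap (TranslationGroupoid.map
    { toFun := fun x : G => k⁻¹ * x, map_smul' := fun m x => (mul_assoc k⁻¹ x m.unop).symm })

/-! ### The loop groupoid -/

/-- The space `P_G(M)` of pairs `(γ, g)` of an element `g : G` and a path `γ` in `M` with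
`γ(0) g = γ(1)`. -/
def OrbifoldLoops (G : Type u) [Group G] (M : Type u) [TopologicalSpace M] [MulAction Gᵐᵒᵖ M] :
    Type u :=
  Σ g : G, {γ : C(unitInterval, M) // MulOpposite.op g • γ 0 = γ 1}

namespace OrbifoldLoops

variable {G : Type u} [Group G] {M : Type u} [TopologicalSpace M] [MulAction Gᵐᵒᵖ M]

instance : TopologicalSpace (OrbifoldLoops G M) :=
  inferInstanceAs (TopologicalSpace (Σ g : G, {γ : C(unitInterval, M) // MulOpposite.op g • γ 0 = γ 1}))

lemma ext {a b : OrbifoldLoops G M} (h₁ : a.1 = b.1) (h₂ : ∀ t, a.2.1 t = b.2.1 t) : a = b := by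
  obtain ⟨g, γ, hγ⟩ := a
  obtain ⟨h, δ, hδ⟩ := b
  obtain rfl : g = h := h₁
  obtain rfl : γ = δ := ContinuousMap.ext h₂
  rfl

/-- The right action `(γ, g) h = (γ h, h⁻¹ g h)` of `G` on `P_G(M)`. -/
instance [ContinuousConstSMul Gᵐᵒᵖ M] : MulAction Gᵐᵒᵖ (OrbifoldLoops G M) where
  smul h x := ⟨h.unop⁻¹ * x.1 * h.unop, h • x.2.1, by
    change _ • (h • x.2.1 0) = h • x.2.1 1
    rw [← x.2.2, smul_smul, smul_smul]
    simp [mul_assoc]⟩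
  one_smul x := ext (by change (1 : G)⁻¹ * x.1 * 1 = x.1; simp) fun t => one_smul _ (x.2.1 t)
  mul_smul h k x := ext
    (by
      change (k.unop * h.unop)⁻¹ * x.1 * (k.unop * h.unop) =
        h.unop⁻¹ * (k.unop⁻¹ * x.1 * k.unop) * h.unop
      group)
    fun t => mul_smul h k (x.2.1 t)

/-- Concatenation of paths `P_g(M) ×_M P_h(M) → P_{gh}(M)`. -/
noncomputable def concat (a b : OrbifoldLoops G M) (hab : a.2.1 1 = b.2.1 0) :
    OrbifoldLoops G M :=
  ⟨a.1 * b.1,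
    (Path.trans (⟨a.2.1, rfl, rfl⟩ : Path (a.2.1 0) (a.2.1 1))
      (⟨b.2.1, hab.symm, rfl⟩ : Path (a.2.1 1) (b.2.1 1))).toContinuousMap, by
    simp [mul_smul, a.2.2, b.2.2, hab]⟩

instance : DiscreteTopology (OrbifoldLoops G PUnit.{u + 1}) :=
  inferInstanceAs (DiscreteTopology (Σ g : G,
    {γ : C(unitInterval, PUnit.{u + 1}) // MulOpposite.op g • γ 0 = γ 1}))

/-- The only element `⋆_g` of `P_g(•)`. -/
def star (g : G) : OrbifoldLoops G PUnit.{u + 1} :=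
  ⟨g, ContinuousMap.const _ PUnit.unit, rfl⟩

end OrbifoldLoops

/-- The loop groupoid `P_G(M) ⋊ G` of the orbifold `[M/G]`. -/
abbrev LoopGroupoid (G : Type u) [Group G] (M : Type u) [TopologicalSpace M] [MulAction Gᵐᵒᵖ M]
    [ContinuousConstSMul Gᵐᵒᵖ M] : Type u :=
  TranslationGroupoid G (OrbifoldLoops G M)

/-! ### Free loops on `BG` and their lifts to `EG` -/

/-- The free loop space of `X`, with the compact-open topology. -/
noncomputable abbrev freeLoopSpace (X : TopCat.{u}) : TopCat.{u} := TopCat.of C(Circle, X)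

/-- Loops `σ` in `BG` together with a path `τ` in `EG` that lifts `t ↦ σ(exp(2πit))`, and the
element `k : G` with `τ(0) k = τ(1)`. This is the principal `G`-bundle on the free loop space
pulled back from `EG ⟶ BG` along the evaluation at `1`. -/
noncomputable def LiftedLoops (G : Type u) [Group G] : Type u :=
  Σ k : G, {w : C(Circle, BSpace G) × C(unitInterval, ESpace G) //
    (∀ t : unitInterval, bundleMap G (w.2 t) = w.1 (Circle.exp (2 * Real.pi * t))) ∧
      rightTranslate k (w.2 0) = w.2 1}

noncomputable instance (G : Type u) [Group G] : TopologicalSpace (LiftedLoops G) :=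
  inferInstanceAs (TopologicalSpace (Σ k : G,
    {w : C(Circle, BSpace G) × C(unitInterval, ESpace G) //
      (∀ t : unitInterval, bundleMap G (w.2 t) = w.1 (Circle.exp (2 * Real.pi * t))) ∧
        rightTranslate k (w.2 0) = w.2 1}))

/-- The projection that forgets the lift. -/
noncomputable def loopCover (G : Type u) [Group G] : TopCat.of (LiftedLoops G) ⟶ freeLoopSpace (BSpace G) :=
  TopCat.ofHom ⟨fun w => w.2.1.1, continuous_sigma fun _ =>
    continuous_fst.comp continuous_subtype_val⟩

/-- The space `P_G(•)` for `M = •`. -/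
abbrev pointLoops (G : Type u) [Group G] : TopCat.{u} :=
  TopCat.of (OrbifoldLoops G PUnit.{u + 1})

/-- The holonomy: it sends `(σ, τ, k)` to the orbifold loop `⋆_k` of the point. -/
noncomputable def holonomy (G : Type u) [Group G] : TopCat.of (LiftedLoops G) ⟶ pointLoops G :=
  TopCat.ofHom ⟨fun w => OrbifoldLoops.star w.1, 
    continuous_sigma fun k => continuous_const (y := OrbifoldLoops.star k)⟩

/-! ### The orbifold string product -/

/-- The total homology `H_*(X; ℂ)`. -/
abbrev TotalHomology (X : TopCat.{u}) : Type u := DirectSum ℕ fun n => Hn n X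

/-- The map `f_*` induced in total homology. -/
noncomputable def homologyMap {X Y : TopCat.{u}} (f : X ⟶ Y) :
    TotalHomology X →ₗ[ℂ] TotalHomology Y :=
  DirectSum.lmap fun n =>
    (((singularHomologyFunctor (ModuleCat.{u} ℂ) n).obj coeffs).map f).hom

/-- The transfer of a finite covering in total homology. -/
noncomputable def transfer {E B : TopCat.{u}} (p : E ⟶ B) (hp : IsCoveringMap p)
    (hf : ∀ b, Finite (p ⁻¹' {b})) : TotalHomology B →ₗ[ℂ] TotalHomology E :=
  DirectSum.lmap fun n => transferHn p hp hf n

open Classical in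
/-- For a discrete space `P`, the degree zero homology is the free vector space on `P`; this is the
coefficient of the point `a` in the degree zero part of a homology class. -/
noncomputable def pointCoeff {P : TopCat.{u}} [DiscreteTopology P] (a : P) :
    TotalHomology P →ₗ[ℂ] ℂ :=
  ULift.moduleEquiv.toLinearMap ∘ₗ
    ((singularHomologyFunctorZeroOfTotallyDisconnectedSpace (ModuleCat.{u} ℂ) coeffs P).hom ≫
      Sigma.desc fun b : P => if b = a then 𝟙 (coeffs.{u}) else 0).hom ∘ₗ
    DirectSum.component ℂ ℕ (fun n => Hn n P) 0

/-- Concatenation with `⋆_g` on `P_G(•)`. -/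
noncomputable def concatLeft {G : Type u} [Group G] (g : G) : pointLoops G ⟶ pointLoops G :=
  TopCat.ofHom ⟨fun b => OrbifoldLoops.concat (OrbifoldLoops.star g) b rfl,
    continuous_of_discreteTopology⟩

/-- The string product on `H_*(P_G(•); ℂ)`, that is, the cross product followed by concatenation (the
point has dimension zero, so the product has degree zero and no Thom collapse enters). Since
`P_G(•)` is discrete, its homology in positive degrees vanishes, so a class in the first factor is
the combination of the points `⋆_g` given by its coefficients in degree zero; the cross product with
`[⋆_g]` followed by concatenation is the map induced by concatenation with `⋆_g`. -/
noncomputable def pointProduct (G : Type u) [Group G] [Fintype G] :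
    TotalHomology (pointLoops G) →ₗ[ℂ] TotalHomology (pointLoops G) →ₗ[ℂ]
      TotalHomology (pointLoops G) :=
  ∑ g : G, (pointCoeff (P := pointLoops G) (OrbifoldLoops.star g)).smulRight
    (homologyMap (concatLeft g))

/-- The orbifold string product on `H_*(LBG; ℂ)`: both factors are transferred to the cover of lifted
loops and mapped to `H_*(P_G(•); ℂ)` by the holonomy, they are multiplied there, and the result is
mapped back to `H_*(LBG; ℂ)` by the inverse of the isomorphism induced by the holonomy followed by
the projection of the cover. -/
noncomputable def stringProduct (G : Type u) [Group G] [Fintype G]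
    (hcov : IsCoveringMap (loopCover G)) (hfin : ∀ σ, Finite (loopCover G ⁻¹' {σ}))
    (hhol : Function.Bijective (homologyMap (holonomy G))) :
    TotalHomology (freeLoopSpace (BSpace G)) →ₗ[ℂ] TotalHomology (freeLoopSpace (BSpace G)) →ₗ[ℂ]
      TotalHomology (freeLoopSpace (BSpace G)) :=
  let θ := homologyMap (holonomy G) ∘ₗ transfer (loopCover G) hcov hfin
  let s := homologyMap (loopCover G) ∘ₗ
    (LinearEquiv.ofBijective (homologyMap (holonomy G)) hhol).symm.toLinearMap
  ((pointProduct G).compl₁₂ θ θ).compr₂ s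

/-- The trace on `H_*(LBG; ℂ)`: transfer to the cover of lifted loops, followed by the coefficient
of the component of trivial holonomy. -/
noncomputable def stringTrace (G : Type u) [Group G]
    (hcov : IsCoveringMap (loopCover G)) (hfin : ∀ σ, Finite (loopCover G ⁻¹' {σ})) :
    TotalHomology (freeLoopSpace (BSpace G)) →ₗ[ℂ] ℂ :=
  pointCoeff (P := pointLoops G) (OrbifoldLoops.star 1) ∘ₗ homologyMap (holonomy G) ∘ₗ
    transfer (loopCover G) hcov hfin

/-- The Dijkgraaf-Witten trace `∑ a_g g ↦ a_1 / |G|` on the center of the group algebra. -/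
noncomputable def dwTrace (G : Type u) [Group G] [Fintype G] :
    Subalgebra.center ℂ (MonoidAlgebra ℂ G) →ₗ[ℂ] ℂ where
  toFun z := (z : MonoidAlgebra ℂ G).coeff 1 / (Fintype.card G : ℂ)
  map_add' x y := by simp [add_div]
  map_smul' c x := by simp [mul_div_assoc]

/-- A bilinear product and a linear functional make `A` a commutative Frobenius algebra over `ℂ`:
the product is associative, commutative and unital, `A` is finite-dimensional, and the pairing
`(x, y) ↦ tr (x y)` is nondegenerate. -/
structure IsCommFrobeniusAlgebra {A : Type*} [AddCommGroup A] [Module ℂ A]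
    (m : A →ₗ[ℂ] A →ₗ[ℂ] A) (tr : A →ₗ[ℂ] ℂ) : Prop where
  finiteDimensional : FiniteDimensional ℂ A
  assoc : ∀ x y z, m (m x y) z = m x (m y z)
  comm : ∀ x y, m x y = m y x
  exists_one : ∃ e, ∀ x, m e x = x
  nondegenerate : ∀ x, (∀ y, tr (m x y) = 0) → x = 0

/-! A point of $EG$ is a step function on $[0,1]$ with values in $G$: the barycentric coordinates
are the lengths of the steps and the vertices are the values. Refining the partition does not change
the function, and two functions always have a common refinement. The measure of the part of $[0,r]$
where the value is $h$ (`profile`) separates points (`profile_injective`), so $EG$ is Hausdorff. Two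
step functions $p,q$ can be spliced at $s$: take $q$ before $s$ and $p$ after it (`mix`). As $s$
goes from $0$ to $1$ this is a path from $p$ to $q$. Splicing commutes with every relabelling of the
values (`vertexMap_mix`), so it is an equivariant substitute for straight-line homotopies. Its joint
continuity (`continuous_mix`) is the main topological point; for finite $G$ it follows from an
exhaustion of $EG$ by compact skeleta, which is stable under products.

$G$ acts freely on $EG$ with quotient $BG$, so $EG\to BG$ is a covering. $G$ then acts freely on the
space $W$ of lifted loops, conjugating the holonomy, with quotient covering $W\to\mathcal L BG$
(`isQuotientCoveringMap_loopCover`). The part of $W$ with holonomy $g$ is $C(g)$-equivariantly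
homotopy equivalent to $EC(g)$: a point $e$ gives the spliced path from $e$ to $g^{-1}e$, and a
lifted loop gives its initial point, retracted to $EC(g)$. Dividing by the centralizers gives
$\mathcal L BG\simeq\coprod BC(g)$.

Splicing also contracts each part of $W$, so the holonomy identifies $H_*(W)$ with $\mathbb C[G]$ in
degree zero. On chains, transfer followed by $q_*$ is $|G|$, and $q_*$ followed by transfer is the
sum of the deck transformations. So $\sigma_*\theta_*=|G|$ and $\theta_*\sigma_*z=\sum_k kzk^{-1}$.
The first identity makes $\theta_*$ injective and, since $H_n(W)=0$ for $n\ne0$, forces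
$H_n(\mathcal L BG)=0$ there; together they show that the image of $\theta_*$ is the center. On the
center $\theta_*\sigma_*$ is multiplication by $|G|$, so $\theta_*(x\circ
y)=|G|\,\theta_*x\,\theta_*y$. Hence $|G|\theta_*$ is multiplicative and carries the string trace to
$a_1/|G|$. Nondegeneracy is checked in the center, by pairing $a$ with $\sum\overline{a_g}\,g^{-1}$.
-/

/-! ### Cells of a geometric realization -/

namespace Realization

variable {X Y : SSet.{u}}

/-- The characteristic map of a simplex in the geometric realization. -/
noncomputable def cell {n : ℕ} (x : X _⦋n⦌) :
    C(SimplexCategory.toTop.{u}.obj ⦋n⦌, SSet.toTop.obj X) :=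
  simplexMap ((sSetTopAdj.unit.app X).app _ x)

lemma map_cell (f : X ⟶ Y) {n : ℕ} (x : X _⦋n⦌) (t : SimplexCategory.toTop.{u}.obj ⦋n⦌) :
    SSet.toTop.map f (cell x t) = cell (f.app _ x) t := by
  have h := sSetTopAdj.unit.naturality f
  have h' := congrArg (fun k => simplexMap (k.app _ x) t) h
  exact h'.symm

lemma cell_map {m n : ℕ} (θ : ⦋m⦌ ⟶ ⦋n⦌) (x : X _⦋n⦌) (t : SimplexCategory.toTop.{u}.obj ⦋m⦌) :
    cell (X.map θ.op x) t = cell x (SimplexCategory.toTop.{u}.map θ t) := by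
  have h := (sSetTopAdj.unit.app X).naturality θ.op
  exact congrArg (fun k => simplexMap (k x) t) h

lemma hom_ext {Z : TopCat.{u}} {f g : SSet.toTop.obj X ⟶ Z}
    (h : ∀ (n : ℕ) (x : X _⦋n⦌) (t), f (cell x t) = g (cell x t)) : f = g := by
  apply (sSetTopAdj.homEquiv X Z).injective
  ext ⟨n⟩ x
  induction n using SimplexCategory.rec with | _ n
  rw [Adjunction.homEquiv_unit, Adjunction.homEquiv_unit]
  exact simplex_ext fun t => h n x t

lemma funext_cell {Z : Type u} [TopologicalSpace Z] {f g : SSet.toTop.obj X → Z}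
    (hf : Continuous f) (hg : Continuous g)
    (h : ∀ (n : ℕ) (x : X _⦋n⦌) (t), f (cell x t) = g (cell x t)) : f = g := by
  have := hom_ext (Z := TopCat.of Z) (f := TopCat.ofHom ⟨f, hf⟩) (g := TopCat.ofHom ⟨g, hg⟩) h
  exact congrArg (fun k => (TopCat.Hom.hom k : _ → Z)) this

/-- Into an indiscrete space every function is continuous, so `funext_cell` may compare the
predicate "lies in a cell" with the constant true predicate. -/
lemma exists_cell (p : SSet.toTop.obj X) :
    ∃ (n : ℕ) (x : X _⦋n⦌) (t : SimplexCategory.toTop.{u}.obj ⦋n⦌), cell x t = p := by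
  have h := @funext_cell X (ULift.{u} Prop) ⊤
    (fun p => ULift.up (∃ (n : ℕ) (x : X _⦋n⦌) (t : SimplexCategory.toTop.{u}.obj ⦋n⦌),
      cell x t = p)) (fun p => ULift.up True) continuous_top continuous_top
      fun n x t => congrArg ULift.up (eq_true ⟨n, x, t, rfl⟩)
  exact of_eq_true (congrArg ULift.down (congrFun h p))

lemma exists_desc {Z : Type u} [TopologicalSpace Z]
    (f : ∀ (n : ℕ) (_ : X _⦋n⦌), SimplexCategory.toTop.{u}.obj ⦋n⦌ → Z)
    (hf : ∀ n x, Continuous (f n x))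
    (h : ∀ (m n : ℕ) (θ : ⦋m⦌ ⟶ ⦋n⦌) (x : X _⦋n⦌) (t : SimplexCategory.toTop.{u}.obj ⦋m⦌),
      f m (X.map θ.op x) t = f n x (SimplexCategory.toTop.{u}.map θ t)) :
    ∃ g : C(SSet.toTop.obj X, Z), ∀ n x t, g (cell x t) = f n x t := by
  let F : X ⟶ TopCat.toSSet.obj (TopCat.of Z) :=
    { app := fun n => TypeCat.ofHom fun x => mkSimplex (n := n.unop.len) (X := TopCat.of Z)
        ⟨f n.unop.len x, hf _ x⟩
      naturality := by
        rintro ⟨m⟩ ⟨n⟩ ⟨θ⟩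
        induction m using SimplexCategory.rec with | _ m
        induction n using SimplexCategory.rec with | _ n
        ext x
        exact simplex_ext fun t => h n m θ x t }
  have hF := Equiv.apply_symm_apply (sSetTopAdj.homEquiv X (TopCat.of Z)) F
  refine ⟨((sSetTopAdj.homEquiv X (TopCat.of Z)).symm F).hom, fun n x t => ?_⟩
  have h' := congrArg (fun k => simplexMap (k.app _ x) t) hF
  exact h'

/-- The cells are compatible maps into the same set with the final topology of the cells. They
induce a continuous map from the realization, which is the identity on points, so the two topologies
agree. -/
lemma isOpen_iff (U : Set (SSet.toTop.obj X)) :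
    IsOpen U ↔ ∀ (n : ℕ) (x : X _⦋n⦌), IsOpen (cell x ⁻¹' U) := by
  refine ⟨fun h n x => h.preimage (cell x).continuous, fun h => ?_⟩
  let τ : TopologicalSpace (SSet.toTop.obj X) := ⨆ (n : ℕ) (x : X _⦋n⦌),
    TopologicalSpace.coinduced (cell x) inferInstance
  have hτ : ∀ (n : ℕ) (x : X _⦋n⦌), @Continuous _ _ _ τ (cell x) := fun n x =>
    continuous_iff_coinduced_le.2 (le_iSup₂_of_le n x le_rfl)
  obtain ⟨⟨g, hgc⟩, hg⟩ := @exists_desc X (SSet.toTop.obj X) τ (fun n x t => cell x t) hτ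
    fun m n θ x t => cell_map θ x t
  have hid : ∀ p, g p = p := by
    intro p
    obtain ⟨n, x, t, rfl⟩ := exists_cell p
    exact hg n x t
  have hU : @IsOpen _ τ U := by
    simp only [τ, isOpen_iSup_iff, isOpen_coinduced]
    exact h
  have hg' : g = id := funext hid
  subst hg'
  exact @Continuous.isOpen_preimage _ _ (SSet.toTop.obj X).str τ _ hgc U hU

lemma continuous_iff {Z : Type*} [TopologicalSpace Z] {f : SSet.toTop.obj X → Z} :
    Continuous f ↔ ∀ (n : ℕ) (x : X _⦋n⦌), Continuous fun t => f (cell x t) := by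
  refine ⟨fun h n x => h.comp (cell x).continuous, fun h => ⟨fun U hU => ?_⟩⟩
  rw [isOpen_iff]
  exact fun n x => hU.preimage (h n x)

end Realization

/-! ### Coordinates on the topological simplices -/

namespace TopSimplex

/-- The topological `n`-simplex. -/
abbrev Simp (n : ℕ) : Type u := SimplexCategory.toTop.{u}.obj ⦋n⦌

variable {m n : ℕ}

instance : CompactSpace (Simp.{u} n) :=
  haveI : CompactSpace (stdSimplex ℝ (Fin (n + 1))) := inferInstance
  inferInstanceAs (CompactSpace (ULift.{u} (stdSimplex ℝ (Fin (n + 1)))))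

/-- The barycentric coordinates. -/
def coord (t : Simp.{u} n) (i : Fin (n + 1)) : ℝ := (t.down : stdSimplex ℝ (Fin (n + 1))).1 i

lemma coord_nonneg (t : Simp.{u} n) (i : Fin (n + 1)) : 0 ≤ coord t i := t.down.2.1 i

lemma sum_coord (t : Simp.{u} n) : ∑ i, coord t i = 1 := t.down.2.2

lemma continuous_coord (i : Fin (n + 1)) : Continuous fun t : Simp.{u} n => coord t i :=
  (continuous_apply i).comp (continuous_subtype_val.comp continuous_uliftDown)

lemma ext_coord {s t : Simp.{u} n} (h : ∀ i, coord s i = coord t i) : s = t :=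
  ULift.ext _ _ (Subtype.ext (funext h))

/-- The point with the given barycentric coordinates. -/
def ofCoord (w : Fin (n + 1) → ℝ) (h₀ : ∀ i, 0 ≤ w i) (h₁ : ∑ i, w i = 1) : Simp.{u} n :=
  ULift.up (⟨w, h₀, h₁⟩ : stdSimplex ℝ (Fin (n + 1)))

@[simp]
lemma coord_ofCoord (w : Fin (n + 1) → ℝ) (h₀ : ∀ i, 0 ≤ w i) (h₁ : ∑ i, w i = 1) (i) :
    coord (ofCoord.{u} w h₀ h₁) i = w i := rfl

lemma continuous_of_coord {Z : Type*} [TopologicalSpace Z] {f : Z → Simp.{u} n}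
    (h : ∀ i, Continuous fun z => coord (f z) i) : Continuous f := by
  have h₁ : Continuous fun z => (f z).down := Continuous.subtype_mk (continuous_pi h) _
  exact continuous_uliftUp.comp h₁

lemma coord_map (θ : ⦋m⦌ ⟶ ⦋n⦌) (t : Simp.{u} m) (i : Fin (n + 1)) :
    coord (SimplexCategory.toTop.{u}.map θ t) i = ∑ j, if θ j = i then coord t j else 0 := by
  have h : coord (SimplexCategory.toTop.{u}.map θ t) i =
      stdSimplex.map θ (t.down : stdSimplex ℝ (Fin (m + 1))) i := rfl
  rw [h, ← Finset.sum_filter]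
  change (stdSimplex.map θ t.down).1 i = _
  have h' := congrFun (stdSimplex.map_coe (S := ℝ) θ t.down) i
  refine h'.trans ?_
  rw [FunOnFinite.linearMap_apply_apply]
  rfl

/-- The partial sums of the barycentric coordinates. -/
def cum (t : Simp.{u} n) (k : ℕ) : ℝ := ∑ j : Fin (n + 1), if j.1 < k then coord t j else 0

@[simp]
lemma cum_zero (t : Simp.{u} n) : cum t 0 = 0 := by simp [cum]

@[simp]
lemma cum_last (t : Simp.{u} n) : cum t (n + 1) = 1 := by
  rw [← sum_coord t]
  exact Finset.sum_congr rfl fun j _ => if_pos j.2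

lemma cum_mono (t : Simp.{u} n) : Monotone (cum t) := by
  intro k l h
  refine Finset.sum_le_sum fun j _ => ?_
  have := coord_nonneg t j
  split_ifs <;> linarith

lemma cum_succ (t : Simp.{u} n) (j : Fin (n + 1)) : cum t (j.1 + 1) - cum t j.1 = coord t j := by
  rw [cum, cum, ← Finset.sum_sub_distrib, Finset.sum_eq_single j]
  · simp
  · intro b _ hb
    have : b.1 ≠ j.1 := fun h => hb (Fin.ext h)
    split_ifs <;> first | (exfalso; omega) | simp
  · simp

lemma cum_nonneg (t : Simp.{u} n) (k : ℕ) : 0 ≤ cum t k := by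
  simpa using cum_mono t (Nat.zero_le k)

lemma cum_le_one (t : Simp.{u} n) (k : ℕ) : cum t k ≤ 1 := by
  rw [← sum_coord t]
  refine Finset.sum_le_sum fun j _ => ?_
  have := coord_nonneg t j
  split_ifs <;> linarith

lemma continuous_cum (k : ℕ) : Continuous fun t : Simp.{u} n => cum t k :=
  continuous_finsetSum _ fun j _ => by
    split_ifs
    · exact continuous_coord j
    · exact continuous_const

lemma sum_telescope (c : ℕ → ℝ) {k : ℕ} (hk : k ≤ n) :
    (∑ j : Fin n, if j.1 < k then c (j.1 + 1) - c j.1 else 0) = c k - c 0 := by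
  rw [Fin.sum_univ_eq_sum_range fun i => if i < k then c (i + 1) - c i else 0,
    ← Finset.sum_filter, ← Finset.sum_range_sub]
  congr 1
  ext i
  simp
  omega

lemma exists_lowerSet (θ : ⦋m⦌ ⟶ ⦋n⦌) (i : ℕ) :
    ∃ k ≤ m + 1, ∀ j : Fin (m + 1), (θ j).1 < i ↔ j.1 < k := by
  classical
  -- The condition is vacuous at `m + 1`, so the search also succeeds when every index is mapped
  -- below `i`.
  have hex : ∃ k, ∀ h : k < m + 1, ¬ (θ ⟨k, h⟩).1 < i := ⟨m + 1, fun h => absurd h (lt_irrefl _)⟩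
  refine ⟨Nat.find hex, Nat.find_min' hex fun h => absurd h (lt_irrefl _), fun j => ?_⟩
  constructor
  · intro hj
    by_contra hlt
    replace hlt := not_lt.1 hlt
    have h1 : Nat.find hex < m + 1 := lt_of_le_of_lt hlt j.2
    have h2 := Nat.find_spec hex h1
    have h3 : θ ⟨Nat.find hex, h1⟩ ≤ θ j := θ.toOrderHom.monotone hlt
    exact h2 (lt_of_le_of_lt h3 hj)
  · intro hj
    have := Nat.find_min hex hj
    push Not at this
    exact this.2

/-- The increment of `g` over the `i`-th interval of the partition of `[0, 1]` given by `t`. -/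
def seg (g : ℝ → ℝ) (t : Simp.{u} n) (i : Fin (n + 1)) : ℝ :=
  g (cum t (i.1 + 1)) - g (cum t i.1)

/-- A monotone `θ` pulls an initial segment back to an initial segment. So every cut point of the
image partition is a cut point of `t`, and the sum telescopes. -/
lemma sum_seg_map_lt (g : ℝ → ℝ) (θ : ⦋m⦌ ⟶ ⦋n⦌) (t : Simp.{u} m) (i : ℕ) :
    (∑ j, if (θ j).1 < i then seg g t j else 0) =
      g (cum (SimplexCategory.toTop.{u}.map θ t) i) - g 0 := by
  obtain ⟨k, hk, h⟩ := exists_lowerSet θ i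
  have h₁ : cum (SimplexCategory.toTop.{u}.map θ t) i = cum t k := by
    simp only [cum, coord_map]
    have h₂ : ∀ l : Fin (n + 1), (if l.1 < i then ∑ j, if θ j = l then coord t j else 0 else 0) =
        ∑ j, if θ j = l then (if (θ j).1 < i then coord t j else 0) else 0 := by
      intro l
      split_ifs with hl
      · refine Finset.sum_congr rfl fun j _ => ?_
        split_ifs with h3 h4
        · rfl
        · exact absurd (h3 ▸ hl) h4
        · rfl
      · refine (Finset.sum_eq_zero fun j _ => ?_).symm
        split_ifs with h3 h4
        · exact absurd (h3 ▸ h4) hl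
        · rfl
        · rfl
    rw [Finset.sum_congr rfl fun l _ => h₂ l, Finset.sum_comm]
    refine Finset.sum_congr rfl fun j _ => ?_
    simp only [← h]
    exact Fintype.sum_ite_eq (θ j) fun _ => _
  rw [h₁]
  simp only [h, seg]
  rw [sum_telescope (fun k => g (cum t k)) hk, cum_zero]

/-- Subtract consecutive partial sums. This is the compatibility with the simplicial identifications
that lets functions built from `seg` descend to the realization. -/
lemma seg_map (g : ℝ → ℝ) (θ : ⦋m⦌ ⟶ ⦋n⦌) (t : Simp.{u} m) (i : Fin (n + 1)) :
    seg g (SimplexCategory.toTop.{u}.map θ t) i = ∑ j, if θ j = i then seg g t j else 0 := by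
  have h₁ := sum_seg_map_lt g θ t i.1
  have h₂ := sum_seg_map_lt g θ t (i.1 + 1)
  have h₃ : seg g (SimplexCategory.toTop.{u}.map θ t) i =
      (g (cum (SimplexCategory.toTop.{u}.map θ t) (i.1 + 1)) - g 0) -
        (g (cum (SimplexCategory.toTop.{u}.map θ t) i.1) - g 0) := by
    rw [seg]; ring
  rw [h₃, ← h₁, ← h₂, ← Finset.sum_sub_distrib]
  refine Finset.sum_congr rfl fun j _ => ?_
  rcases lt_trichotomy (θ j).1 i.1 with hi | hi | hi
  · rw [if_pos (hi.trans (Nat.lt_succ_self _)), if_pos hi, if_neg fun h => hi.ne (congrArg _ h),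
      sub_self]
  · rw [if_pos (hi.trans_lt (Nat.lt_succ_self _)), if_neg hi.not_lt, if_pos (Fin.ext hi), sub_zero]
  · rw [if_neg (Nat.not_lt.2 hi), if_neg hi.not_gt, if_neg fun h => hi.ne' (congrArg _ h),
      sub_self]

lemma exists_interval (t : Simp.{u} n) {r : ℝ} (h₀ : 0 ≤ r) (h₁ : r < 1) :
    ∃ i : Fin (n + 1), cum t i.1 ≤ r ∧ r < cum t (i.1 + 1) := by
  classical
  have hex : ∃ k, r < cum t k := ⟨n + 1, by simpa using h₁⟩
  have hpos : Nat.find hex ≠ 0 := by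
    intro h
    have := Nat.find_spec hex
    rw [h, cum_zero] at this
    linarith
  obtain ⟨k, hk⟩ := Nat.exists_eq_succ_of_ne_zero hpos
  have hle : Nat.find hex ≤ n + 1 := Nat.find_min' hex (by simpa using h₁)
  refine ⟨⟨k, by omega⟩, ?_, ?_⟩
  · exact not_lt.1 (Nat.find_min hex (m := k) (by omega))
  · have := Nat.find_spec hex
    rwa [hk] at this

/-- A partition finer than the one given by `t` maps to it. -/
lemma exists_refinement (t : Simp.{u} n) (u : Simp.{u} m) (hu : ∀ j, 0 < coord u j)
    (h : ∀ i ≤ n + 1, ∃ j ≤ m + 1, cum u j = cum t i) :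
    ∃ θ : ⦋m⦌ ⟶ ⦋n⦌, SimplexCategory.toTop.{u}.map θ u = t := by
  have hlt : ∀ j : Fin (m + 1), cum u j.1 < cum u (j.1 + 1) := fun j => by
    have := cum_succ u j
    have := hu j
    linarith
  have hlt1 : ∀ j : Fin (m + 1), cum u j.1 < 1 := fun j => (hlt j).trans_le (cum_le_one _ _)
  -- `θ j` is the interval of `t` that contains the left end of the `j`-th interval of `u`. Since
  -- its right end is also a cut point of `u`, it contains the whole interval.
  choose θ hθ₁ hθ₂ using fun j : Fin (m + 1) => exists_interval t (cum_nonneg u j.1) (hlt1 j)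
  have hθ₃ : ∀ j, cum u (j.1 + 1) ≤ cum t ((θ j).1 + 1) := by
    intro j
    obtain ⟨l, hl, hl'⟩ := h ((θ j).1 + 1) (by omega)
    rw [← hl']
    apply cum_mono
    have := hθ₂ j
    rw [← hl'] at this
    exact Nat.succ_le_of_lt ((cum_mono u).reflect_lt this)
  have hmono : Monotone θ := by
    intro j j' hj
    have h1 : cum t (θ j).1 < cum t ((θ j').1 + 1) :=
      ((hθ₁ j).trans (cum_mono u hj)).trans_lt (hθ₂ j')
    exact Nat.lt_succ_iff.1 ((cum_mono t).reflect_lt h1)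
  refine ⟨SimplexCategory.Hom.mk ⟨θ, hmono⟩, ext_coord fun i => ?_⟩
  rw [coord_map]
  -- For `r ≥ 0`, `ψ r` is the length of the part of `[0, r]` in the `i`-th interval of `t`; its
  -- increments over the intervals of `u` are the summands.
  let ψ : ℝ → ℝ := fun r => min (cum t (i.1 + 1)) r - min (cum t i.1) r
  have hle := cum_mono t (Nat.le_succ i.1)
  have hψ : ∀ j : Fin (m + 1), (if θ j = i then coord u j else 0) =
      if j.1 < m + 1 then ψ (cum u (j.1 + 1)) - ψ (cum u j.1) else 0 := by
    intro j
    rw [if_pos j.2]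
    have h1 := hθ₁ j
    have h2 := hθ₃ j
    have h3 := (hlt j).le
    rcases lt_trichotomy (θ j) i with hi | hi | hi
    · rw [if_neg hi.ne]
      have h4 : cum t ((θ j).1 + 1) ≤ cum t i.1 := cum_mono t hi
      simp only [ψ]
      rw [min_eq_right (by linarith), min_eq_right (by linarith), min_eq_right (by linarith),
        min_eq_right (by linarith)]
      ring
    · rw [if_pos hi, ← cum_succ]
      subst hi
      simp only [ψ]
      rw [min_eq_right (by linarith), min_eq_left (by linarith), min_eq_right (by linarith),
        min_eq_left (by linarith)]
      ring
    · rw [if_neg hi.ne']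
      have h4 : cum t (i.1 + 1) ≤ cum t (θ j).1 := cum_mono t hi
      simp only [ψ]
      rw [min_eq_left (by linarith), min_eq_left (by linarith), min_eq_left (by linarith),
        min_eq_left (by linarith)]
      ring
  have hgoal : (∑ j, if θ j = i then coord u j else 0) = coord t i := by
    rw [Finset.sum_congr rfl fun j _ => hψ j, sum_telescope (fun k => ψ (cum u k)) le_rfl,
      cum_zero, cum_last]
    simp only [ψ]
    rw [min_eq_left (cum_le_one _ _), min_eq_left (cum_le_one _ _), min_eq_right (cum_nonneg _ _),
      min_eq_right (cum_nonneg _ _), ← cum_succ]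
    ring
  exact hgoal

/-- The point of the simplex that corresponds to the partition given by `S`. -/
lemma exists_partition (S : Finset ℝ) (h₀ : 0 ∈ S) (h₁ : 1 ∈ S) (hS : ∀ r ∈ S, 0 ≤ r ∧ r ≤ 1) :
    ∃ (m : ℕ) (u : Simp.{u} m), (∀ j, 0 < coord u j) ∧ ∀ r ∈ S, ∃ j ≤ m + 1, cum u j = r := by
  have hcard : 1 < S.card := Finset.one_lt_card.2 ⟨0, h₀, 1, h₁, zero_ne_one⟩
  obtain ⟨m, hm⟩ : ∃ m, S.card = m + 2 := ⟨S.card - 2, by omega⟩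
  let e := S.orderEmbOfFin hm
  -- Clamping the index extends the increasing enumeration of `S` to all of `ℕ`, as `sum_telescope`
  -- requires.
  let s : ℕ → ℝ := fun j => e ⟨min j (m + 1), by omega⟩
  have hrange : ∀ r ∈ S, ∃ j ≤ m + 1, s j = r := by
    intro r hr
    have : r ∈ Set.range e := by rw [Finset.range_orderEmbOfFin]; exact hr
    obtain ⟨j, hj⟩ := this
    refine ⟨j.1, by omega, ?_⟩
    rw [← hj]
    simp only [s]
    congr 1
    exact Fin.ext (min_eq_left (by omega))
  have hmono : Monotone s := fun i j hij => e.monotone (Fin.mk_le_mk.2 (by omega))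
  have hmem : ∀ j, s j ∈ S := fun j => Finset.orderEmbOfFin_mem _ _ _
  have hs0 : s 0 = 0 := by
    obtain ⟨j, _, hj'⟩ := hrange 0 h₀
    have := hmono (Nat.zero_le j)
    have := (hS _ (hmem 0)).1
    linarith
  have hs1 : s (m + 1) = 1 := by
    obtain ⟨j, hj, hj'⟩ := hrange 1 h₁
    have := hmono hj
    have := (hS _ (hmem (m + 1))).2
    linarith
  have hpos : ∀ j : Fin (m + 1), 0 < s (j.1 + 1) - s j.1 := fun j =>
    sub_pos.2 (e.strictMono (Fin.mk_lt_mk.2 (by omega)))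
  have hsum : ∀ k ≤ m + 1, (∑ j : Fin (m + 1), if j.1 < k then s (j.1 + 1) - s j.1 else 0) = s k :=
    fun k hk => by rw [sum_telescope s hk, hs0, sub_zero]
  refine ⟨m, ofCoord (fun j => s (j.1 + 1) - s j.1) (fun j => (hpos j).le) ?_, hpos, fun r hr => ?_⟩
  · rw [← hs1, ← hsum (m + 1) le_rfl]
    exact Finset.sum_congr rfl fun j _ => (if_pos j.2).symm
  · obtain ⟨j, hj, rfl⟩ := hrange r hr
    exact ⟨j, hj, hsum j hj⟩

/-- Two partitions have a common refinement. -/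
lemma exists_common_refinement {n' : ℕ} (t : Simp.{u} n) (t' : Simp.{u} n') :
    ∃ (m : ℕ) (u : Simp.{u} m) (θ : ⦋m⦌ ⟶ ⦋n⦌) (θ' : ⦋m⦌ ⟶ ⦋n'⦌), (∀ j, 0 < coord u j) ∧
      SimplexCategory.toTop.{u}.map θ u = t ∧ SimplexCategory.toTop.{u}.map θ' u = t' := by
  classical
  let S : Finset ℝ := (Finset.range (n + 2)).image (cum t) ∪ (Finset.range (n' + 2)).image (cum t')
  have hS₁ : ∀ i ≤ n + 1, cum t i ∈ S := fun i hi =>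
    Finset.mem_union_left _ (Finset.mem_image_of_mem _ (Finset.mem_range.2 (by omega)))
  have hS₂ : ∀ i ≤ n' + 1, cum t' i ∈ S := fun i hi =>
    Finset.mem_union_right _ (Finset.mem_image_of_mem _ (Finset.mem_range.2 (by omega)))
  obtain ⟨m, u, hu, h⟩ := exists_partition.{u} S (by simpa using hS₁ 0 (Nat.zero_le _))
    (by simpa using hS₁ (n + 1) le_rfl) (by
      intro r hr
      rcases Finset.mem_union.1 hr with hr | hr
      all_goals
        obtain ⟨i, _, rfl⟩ := Finset.mem_image.1 hr
        exact ⟨cum_nonneg _ _, cum_le_one _ _⟩)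
  obtain ⟨θ, hθ⟩ := exists_refinement t u hu fun i hi => h _ (hS₁ i hi)
  obtain ⟨θ', hθ'⟩ := exists_refinement t' u hu fun i hi => h _ (hS₂ i hi)
  exact ⟨m, u, θ, θ', hu, hθ, hθ'⟩

end TopSimplex

/-! ### The points of `EG` as step functions -/

namespace ESpace

open Realization TopSimplex

variable {G : Type u} [Group G] {H : Type u} [Group H]

/-- The only arrow from `x` to `y` is `x⁻¹ y`, so a simplex of the nerve is just its list of
vertices. -/
instance : Quiver.IsThin (TranslationGroupoid G G) := fun x y => ⟨fun a b => by
  apply Subtype.ext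
  apply MulOpposite.unop_injective
  have h : x.back * MulOpposite.unop a.1 = x.back * MulOpposite.unop b.1 := a.2.trans b.2.symm
  exact mul_left_cancel h⟩

/-- The simplex of the nerve of `G ⋊ G` with the given vertices. -/
def tuple {n : ℕ} (x : Fin (n + 1) → G) : (nerve (TranslationGroupoid G G)) _⦋n⦌ :=
  { obj := fun i => ActionCategory.objEquiv Gᵐᵒᵖ G (x i)
    map := fun {i j} _ => ⟨MulOpposite.op ((x i)⁻¹ * x j), mul_inv_cancel_left (x i) (x j)⟩
    map_id := fun _ => Subsingleton.elim _ _
    map_comp := fun _ _ => Subsingleton.elim _ _ : Fin (n + 1) ⥤ TranslationGroupoid G G }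

/-- The vertices of a simplex of the nerve of `G ⋊ G`. -/
def vertices {n : ℕ} (D : (nerve (TranslationGroupoid G G)) _⦋n⦌) (i : Fin (n + 1)) : G :=
  ((show Fin (n + 1) ⥤ TranslationGroupoid G G from D).obj i).back

lemma tuple_vertices {n : ℕ} (D : (nerve (TranslationGroupoid G G)) _⦋n⦌) :
    tuple (vertices D) = D := by
  apply nerve.ext_of_isThin
  rfl

lemma map_tuple {m n : ℕ} (θ : ⦋m⦌ ⟶ ⦋n⦌) (x : Fin (n + 1) → G) :
    (nerve (TranslationGroupoid G G)).map θ.op (tuple x) = tuple fun j => x (θ j) := by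
  apply nerve.ext_of_isThin
  rfl

/-- The point of `EG` given by barycentric coordinates in the simplex with given vertices. -/
noncomputable def point {n : ℕ} (x : Fin (n + 1) → G) (t : Simp.{u} n) : ESpace G :=
  cell (tuple x) t

lemma continuous_point {n : ℕ} (x : Fin (n + 1) → G) : Continuous (point x) :=
  (cell (tuple x)).continuous

lemma exists_point (p : ESpace G) :
    ∃ (n : ℕ) (x : Fin (n + 1) → G) (t : Simp.{u} n), point x t = p := by
  obtain ⟨n, D, t, rfl⟩ := exists_cell p
  exact ⟨n, vertices D, t, by rw [point, tuple_vertices]⟩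

lemma point_map {m n : ℕ} (θ : ⦋m⦌ ⟶ ⦋n⦌) (x : Fin (n + 1) → G) (t : Simp.{u} m) :
    point x (SimplexCategory.toTop.{u}.map θ t) = point (fun j => x (θ j)) t := by
  rw [point, ← cell_map, map_tuple, point]

lemma continuous_iff_point {Z : Type*} [TopologicalSpace Z] {f : ESpace G → Z} :
    Continuous f ↔ ∀ (n : ℕ) (x : Fin (n + 1) → G), Continuous fun t => f (point x t) := by
  rw [Realization.continuous_iff]
  refine ⟨fun h n x => h n (tuple x), fun h n D => ?_⟩
  have := h n (vertices D)
  simpa only [point, tuple_vertices] using this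

lemma exists_desc_point {Z : Type u} [TopologicalSpace Z]
    (f : ∀ (n : ℕ) (_ : Fin (n + 1) → G), Simp.{u} n → Z) (hf : ∀ n x, Continuous (f n x))
    (h : ∀ (m n : ℕ) (θ : ⦋m⦌ ⟶ ⦋n⦌) (x : Fin (n + 1) → G) (t : Simp.{u} m),
      f m (fun j => x (θ j)) t = f n x (SimplexCategory.toTop.{u}.map θ t)) :
    ∃ g : C(ESpace G, Z), ∀ n x t, g (point x t) = f n x t := by
  obtain ⟨g, hg⟩ := exists_desc (X := nerve (TranslationGroupoid G G))
    (fun n D => f n (vertices D)) (fun n D => hf n _) fun m n θ D t => h m n θ (vertices D) t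
  exact ⟨g, fun n x t => hg n (tuple x) t⟩

/-- Pass to a common refinement of the two partitions. Positive lengths make the vertices
recoverable from the point. -/
lemma exists_common_point (p : ESpace G) (q : ESpace H) :
    ∃ (n : ℕ) (x : Fin (n + 1) → G) (y : Fin (n + 1) → H) (t : Simp.{u} n),
      (∀ j, 0 < coord t j) ∧ point x t = p ∧ point y t = q := by
  obtain ⟨n, x, t, rfl⟩ := exists_point p
  obtain ⟨n', y, t', rfl⟩ := exists_point q
  obtain ⟨m, u, θ, θ', hu, rfl, rfl⟩ := exists_common_refinement t t'
  exact ⟨m, _, _, u, hu, (point_map θ x u).symm, (point_map θ' y u).symm⟩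

-- The formula is additive over the steps, so refining the partition does not change it, by
-- `seg_map`.
open Classical in
lemma exists_profile (G : Type u) [Group G] : ∃ g : C(ESpace G, G → unitInterval → ℝ),
    ∀ (n : ℕ) (x : Fin (n + 1) → G) t, g (point x t) =
      fun h (r : unitInterval) => ∑ i, if x i = h then seg (fun s => min s r) t i else 0 := by
  refine exists_desc_point (G := G) (fun n x t => fun h (r : unitInterval) => ∑ i, if x i = h then
    seg (fun s => min s r) t i else 0) (fun n x => ?_) fun m n θ x t => ?_
  · refine continuous_pi fun h => continuous_pi fun r => continuous_finsetSum _ fun i _ => ?_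
    split_ifs
    · exact ((continuous_cum _).min continuous_const).sub ((continuous_cum _).min continuous_const)
    · exact continuous_const
  · funext h r
    simp only [seg_map, Finset.ite_sum_zero]
    rw [Finset.sum_comm]
    refine Finset.sum_congr rfl fun j _ => ?_
    rw [Finset.sum_eq_single (θ j)]
    · simp
    · intro b _ hb
      simp [hb.symm]
    · simp

/-- A point of `EG` is a step function on the unit interval with values in `G`; its profile at `h`
and `r` is the measure of the part of `[0, r]` where this function takes the value `h`. -/
noncomputable def profile : C(ESpace G, G → unitInterval → ℝ) := (exists_profile G).choose

open Classical in
lemma profile_point {n : ℕ} (x : Fin (n + 1) → G) (t : Simp.{u} n) (h : G) (r : unitInterval) :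
    profile (point x t) h r = ∑ i, if x i = h then seg (fun s => min s r) t i else 0 :=
  congrFun (congrFun ((exists_profile G).choose_spec n x t) h) r

/-- Over the `j`-th interval the profile at the value `x j` grows by the full length for `x`. For
`y` it grows by this positive length only if `y j = x j`, and otherwise not at all. -/
lemma eq_of_profile_point_eq {n : ℕ} {x y : Fin (n + 1) → G} {t : Simp.{u} n}
    (ht : ∀ j, 0 < coord t j) (h : profile (point x t) = profile (point y t)) : x = y := by
  classical
  funext j
  have key : ∀ z : Fin (n + 1) → G,
      profile (point z t) (x j) ⟨cum t (j.1 + 1), cum_nonneg _ _, cum_le_one _ _⟩ -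
      profile (point z t) (x j) ⟨cum t j.1, cum_nonneg _ _, cum_le_one _ _⟩ =
        if z j = x j then coord t j else 0 := by
    intro z
    rw [profile_point, profile_point, ← Finset.sum_sub_distrib, Finset.sum_eq_single j]
    · split_ifs
      · simp only [seg]
        have := cum_mono t (Nat.le_succ j.1)
        rw [min_self, min_eq_left this, min_eq_right this, min_self, ← cum_succ]
        ring
      · simp
    · intro i _ hi
      have h1 := cum_mono t (Nat.le_succ i.1)
      have h2 := cum_mono t (Nat.le_succ j.1)
      split_ifs
      · simp only [seg]
        rcases lt_or_gt_of_ne hi with hi | hi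
        · have h3 := cum_mono t (show i.1 + 1 ≤ j.1 from hi)
          rw [min_eq_left (by linarith), min_eq_left (by linarith), min_eq_left (by linarith),
            min_eq_left (by linarith)]
          ring
        · have h3 := cum_mono t (show j.1 + 1 ≤ i.1 from hi)
          rw [min_eq_right (by linarith), min_eq_right (by linarith), min_eq_right (by linarith),
            min_eq_right (by linarith)]
          ring
      · simp
    · simp
  have h₁ := key x
  have h₂ := key y
  rw [← h, h₁, if_pos rfl] at h₂
  by_contra hne
  rw [if_neg (Ne.symm hne)] at h₂
  exact (ht j).ne' h₂

lemma profile_injective : Function.Injective (profile (G := G)) := by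
  intro p q h
  obtain ⟨n, x, y, t, ht, rfl, rfl⟩ := exists_common_point p q
  rw [eq_of_profile_point_eq ht h]

instance : T2Space (ESpace G) := T2Space.of_injective_continuous profile_injective profile.continuous

/-- No homomorphism is needed: simplices are arbitrary lists of vertices. The coset retraction from
$G$ to a centralizer will be such a map. -/
lemma exists_vertexMap (f : G → H) : ∃ g : C(ESpace G, ESpace H),
    ∀ (n : ℕ) (x : Fin (n + 1) → G) t, g (point x t) = point (f ∘ x) t :=
  exists_desc_point (fun _ x t => point (f ∘ x) t) (fun _ _ => continuous_point _)
    fun _ _ θ x t => (point_map θ (f ∘ x) t).symm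

/-- The map `EG → EH` induced by any map `G → H` of the vertices. -/
noncomputable def vertexMap (f : G → H) : C(ESpace G, ESpace H) := (exists_vertexMap f).choose

@[simp]
lemma vertexMap_point (f : G → H) {n : ℕ} (x : Fin (n + 1) → G) (t : Simp.{u} n) :
    vertexMap f (point x t) = point (f ∘ x) t := (exists_vertexMap f).choose_spec n x t

lemma rightTranslate_point (k : G) {n : ℕ} (x : Fin (n + 1) → G) (t : Simp.{u} n) :
    rightTranslate k (point x t) = point (fun i => k⁻¹ * x i) t := by
  rw [point, rightTranslate, map_cell, point]
  congr 1
  congr 1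
  apply nerve.ext_of_isThin
  rfl

lemma rightTranslate_eq (k : G) (p : ESpace G) :
    rightTranslate k p = vertexMap (fun x => k⁻¹ * x) p := by
  obtain ⟨n, x, t, rfl⟩ := exists_point p
  rw [rightTranslate_point, vertexMap_point]
  rfl

/-! #### Mixing two points of `EG` -/

/-- The barycentric coordinates of the step function that is the second given one before `s` and the
first given one after `s`. -/
noncomputable def mixCoord {n m : ℕ} (t : Simp.{u} n) (t' : Simp.{u} m) (s : ℝ) :
    Fin (m + 1) ⊕ Fin (n + 1) → ℝ :=
  Sum.elim (seg (fun a => min a s) t') (seg (fun a => max a s) t)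

lemma seg_nonneg {n : ℕ} {g : ℝ → ℝ} (hg : Monotone g) (t : Simp.{u} n) (i : Fin (n + 1)) :
    0 ≤ seg g t i := sub_nonneg.2 (hg (cum_mono t (Nat.le_succ _)))

lemma sum_seg {n : ℕ} (g : ℝ → ℝ) (t : Simp.{u} n) : ∑ i, seg g t i = g 1 - g 0 := by
  have := sum_telescope (n := n + 1) (fun k => g (cum t k)) le_rfl
  rw [cum_zero, cum_last] at this
  rw [← this]
  exact Finset.sum_congr rfl fun j _ => (if_pos j.2).symm

/-- The vertices of the simplex that contains the mixed point. -/
def mixEquiv (m n : ℕ) : Fin (m + 1) ⊕ Fin (n + 1) ≃ Fin (m + 1 + n + 1) := finSumFinEquiv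

/-- The vertices of the simplex that contains the mixed point. -/
def mixTuple {n m : ℕ} (x : Fin (n + 1) → G) (y : Fin (m + 1) → G) : Fin (m + 1 + n + 1) → G :=
  fun i => Sum.elim y x ((mixEquiv m n).symm i)

/-- The point of the simplex with coordinates `mixCoord`. -/
noncomputable def mixSimp {n m : ℕ} (t : Simp.{u} n) (t' : Simp.{u} m) (s : unitInterval) :
    Simp.{u} (m + 1 + n) :=
  ofCoord (fun i => mixCoord t t' s ((mixEquiv m n).symm i))
    (fun i => by
      rcases (mixEquiv m n).symm i with j | j
      · exact seg_nonneg (g := fun a => min a s.1) (fun a b h => min_le_min_right _ h) _ _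
      · exact seg_nonneg (g := fun a => max a s.1) (fun a b h => max_le_max_right _ h) _ _)
    (by
      rw [Equiv.sum_comp (mixEquiv m n).symm (mixCoord t t' s), Fintype.sum_sum_type]
      simp only [mixCoord, Sum.elim_inl, Sum.elim_inr]
      rw [sum_seg, sum_seg]
      have h0 := s.2.1
      have h1 := s.2.2
      rw [min_eq_right h1, min_eq_left h0, max_eq_left h1, max_eq_right h0]
      ring)

lemma continuous_mixSimp {n m : ℕ} :
    Continuous fun z : Simp.{u} n × Simp.{u} m × unitInterval => mixSimp z.1 z.2.1 z.2.2 := by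
  have hs : Continuous fun z : Simp.{u} n × Simp.{u} m × unitInterval => (z.2.2 : ℝ) := by
    fun_prop
  refine continuous_of_coord fun i => ?_
  simp only [mixSimp, coord_ofCoord]
  rcases (mixEquiv m n).symm i with j | j
  · have h := fun k => (continuous_cum.{u} (n := m) k).comp
      (continuous_fst.comp (continuous_snd (X := Simp.{u} n) (Y := Simp.{u} m × unitInterval)))
    exact ((h _).min hs).sub ((h _).min hs)
  · have h := fun k => (continuous_cum.{u} (n := n) k).comp
      (continuous_fst (X := Simp.{u} n) (Y := Simp.{u} m × unitInterval))
    exact ((h _).max hs).sub ((h _).max hs)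

lemma cum_mixSimp {n m : ℕ} (t : Simp.{u} n) (t' : Simp.{u} m) (s : unitInterval) (k : ℕ) :
    cum (mixSimp t t' s) k =
      (∑ j : Fin (m + 1), if j.1 < k then seg (fun a => min a s.1) t' j else 0) +
      ∑ i : Fin (n + 1), if m + 1 + i.1 < k then seg (fun a => max a s.1) t i else 0 := by
  rw [cum, ← Equiv.sum_comp (mixEquiv m n), Fintype.sum_sum_type]
  simp [mixSimp, mixCoord, mixEquiv]

/-- The cut points of the spliced partition are those of `t'` clipped above at `s`, followed by
those of `t` clipped below at `s`. Zero lengths are harmless. -/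
lemma cum_mixSimp_left {n m : ℕ} (t : Simp.{u} n) (t' : Simp.{u} m) (s : unitInterval) {k : ℕ}
    (hk : k ≤ m + 1) : cum (mixSimp t t' s) k = min (cum t' k) s := by
  have h := sum_telescope (fun k => min (cum t' k) s.1) hk
  have h' : (∑ i : Fin (n + 1), if m + 1 + i.1 < k then seg (fun a => max a s.1) t i else 0) = 0 :=
    Finset.sum_eq_zero fun i _ => if_neg (by omega)
  rw [cum_mixSimp, h', add_zero]
  refine h.trans ?_
  simp only [cum_zero]
  rw [min_eq_left s.2.1, sub_zero]

lemma cum_mixSimp_right {n m : ℕ} (t : Simp.{u} n) (t' : Simp.{u} m) (s : unitInterval) {k : ℕ}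
    (hk : k ≤ n + 1) : cum (mixSimp t t' s) (m + 1 + k) = max (cum t k) s := by
  have h := sum_telescope (fun k => max (cum t k) s.1) hk
  have h' := sum_seg (fun a => min a s.1) t'
  rw [min_eq_right s.2.2, min_eq_left s.2.1] at h'
  rw [cum_mixSimp, Finset.sum_congr rfl fun j _ => if_pos (by omega), h']
  simp only [add_lt_add_iff_left]
  simp only [cum_zero, max_eq_right s.2.1] at h
  simp only [seg, h]
  ring

lemma seg_mixSimp_inl {n m : ℕ} (g : ℝ → ℝ) (t : Simp.{u} n) (t' : Simp.{u} m) (s : unitInterval)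
    (j : Fin (m + 1)) :
    seg g (mixSimp t t' s) (mixEquiv m n (Sum.inl j)) = seg (fun a => g (min a s)) t' j := by
  have h : ((mixEquiv m n (Sum.inl j) : Fin (m + 1 + n + 1)) : ℕ) = j.1 := by simp [mixEquiv]
  rw [seg, h, cum_mixSimp_left t t' s (by omega), cum_mixSimp_left t t' s (by omega), seg]

lemma seg_mixSimp_inr {n m : ℕ} (g : ℝ → ℝ) (t : Simp.{u} n) (t' : Simp.{u} m) (s : unitInterval)
    (i : Fin (n + 1)) :
    seg g (mixSimp t t' s) (mixEquiv m n (Sum.inr i)) = seg (fun a => g (max a s)) t i := by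
  have h : ((mixEquiv m n (Sum.inr i) : Fin (m + 1 + n + 1)) : ℕ) = m + 1 + i.1 := by
    simp [mixEquiv]
  rw [seg, h, add_assoc (m + 1), cum_mixSimp_right t t' s (by omega),
    cum_mixSimp_right t t' s (by omega), seg]

lemma profile_mix {n m : ℕ} (x : Fin (n + 1) → G) (y : Fin (m + 1) → G) (t : Simp.{u} n)
    (t' : Simp.{u} m) (s : unitInterval) (h : G) (r : unitInterval) :
    profile (point (mixTuple x y) (mixSimp t t' s)) h r =
      profile (point y t') h (min r s) + (profile (point x t) h (max r s) -
        profile (point x t) h s) := by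
  classical
  simp only [profile_point]
  rw [← Equiv.sum_comp (mixEquiv m n), Fintype.sum_sum_type, ← Finset.sum_sub_distrib]
  simp only [seg_mixSimp_inl, seg_mixSimp_inr, mixTuple, Equiv.symm_apply_apply, Sum.elim_inl,
    Sum.elim_inr]
  congr 1
  · refine Finset.sum_congr rfl fun j _ => ?_
    have : ((min r s : unitInterval) : ℝ) = min r.1 s.1 := rfl
    simp only [this, min_assoc, min_comm r.1]
  · refine Finset.sum_congr rfl fun i _ => ?_
    split_ifs
    · have : ((max r s : unitInterval) : ℝ) = max r.1 s.1 := rfl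
      simp only [seg, this]
      -- The last term does not depend on `a`, so it cancels in the increment over an interval.
      have key : ∀ a : ℝ, min (max a s.1) r.1 = min a (max r.1 s.1) - min a s.1 + min r.1 s.1 := by
        intro a
        rcases le_total a s.1 with h1 | h1 <;> rcases le_total r.1 s.1 with h2 | h2 <;>
        rcases le_total a r.1 with h3 | h3 <;> simp [h1, h2, h3] <;> linarith
      rw [key, key]
      ring
    · simp

/-- Prescribing the profile makes the spliced point independent of the simplices that represent `p`
and `q`, because profiles separate points. -/
lemma exists_mix (p q : ESpace G) (s : unitInterval) : ∃ e : ESpace G, ∀ h r,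
    profile e h r = profile q h (min r s) + (profile p h (max r s) - profile p h s) := by
  obtain ⟨n, x, t, rfl⟩ := exists_point p
  obtain ⟨m, y, t', rfl⟩ := exists_point q
  exact ⟨_, profile_mix x y t t' s⟩

/-- The step function that agrees with `q` before `s` and with `p` after `s`. -/
noncomputable def mix (p q : ESpace G) (s : unitInterval) : ESpace G := (exists_mix p q s).choose

lemma profile_mix_apply (p q : ESpace G) (s : unitInterval) (h r) :
    profile (mix p q s) h r = profile q h (min r s) + (profile p h (max r s) - profile p h s) :=
  (exists_mix p q s).choose_spec h r

lemma mix_point {n m : ℕ} (x : Fin (n + 1) → G) (y : Fin (m + 1) → G) (t : Simp.{u} n)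
    (t' : Simp.{u} m) (s : unitInterval) :
    mix (point x t) (point y t') s = point (mixTuple x y) (mixSimp t t' s) :=
  profile_injective (funext fun h => funext fun r => by rw [profile_mix_apply, profile_mix])

lemma profile_zero (p : ESpace G) (h : G) : profile p h 0 = 0 := by
  classical
  obtain ⟨n, x, t, rfl⟩ := exists_point p
  rw [profile_point]
  refine Finset.sum_eq_zero fun i _ => ?_
  simp [seg, cum_nonneg]

@[simp]
lemma mix_zero (p q : ESpace G) : mix p q 0 = p := by
  refine profile_injective (funext fun h => funext fun r => ?_)
  rw [profile_mix_apply, min_eq_right unitInterval.nonneg', max_eq_left unitInterval.nonneg',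
    profile_zero, profile_zero]
  ring

@[simp]
lemma mix_one (p q : ESpace G) : mix p q 1 = q := by
  refine profile_injective (funext fun h => funext fun r => ?_)
  rw [profile_mix_apply, min_eq_left unitInterval.le_one', max_eq_right unitInterval.le_one']
  ring

/-- Splicing concatenates lists of vertices and chooses lengths without looking at the values. All
equivariance of the later homotopies comes from this. -/
lemma vertexMap_mix (f : G → H) (p q : ESpace G) (s : unitInterval) :
    vertexMap f (mix p q s) = mix (vertexMap f p) (vertexMap f q) s := by
  obtain ⟨n, x, t, rfl⟩ := exists_point p
  obtain ⟨m, y, t', rfl⟩ := exists_point q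
  rw [mix_point, vertexMap_point, vertexMap_point, vertexMap_point, mix_point]
  congr 1
  funext i
  simp only [mixTuple, Function.comp]
  rcases (mixEquiv m n).symm i with j | j <;> rfl

lemma vertexMap_comp {K : Type u} [Group K] (f : G → H) (g : H → K) (p : ESpace G) :
    vertexMap g (vertexMap f p) = vertexMap (g ∘ f) p := by
  obtain ⟨n, x, t, rfl⟩ := exists_point p
  simp only [vertexMap_point]
  rfl

lemma vertexMap_id (p : ESpace G) : vertexMap id p = p := by
  obtain ⟨n, x, t, rfl⟩ := exists_point p
  simp only [vertexMap_point]
  rfl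

end ESpace

/-! ### Exhaustions by compact sets that determine the topology -/

/-- An increasing sequence of compact sets whose union is the whole space and which determine the
topology. -/
structure IsCompactExhaustion {X : Type*} [TopologicalSpace X] (K : ℕ → Set X) : Prop where
  mono : Monotone K
  isCompact : ∀ n, IsCompact (K n)
  exists_mem : ∀ x, ∃ n, x ∈ K n
  isOpen : ∀ U : Set X, (∀ n, ∃ V, IsOpen V ∧ U ∩ K n = V ∩ K n) → IsOpen U

namespace IsCompactExhaustion

open Topology

variable {X Y Z : Type*} [TopologicalSpace X] [TopologicalSpace Y] [TopologicalSpace Z]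
  {K : ℕ → Set X} {L : ℕ → Set Y}

lemma of_compactSpace [CompactSpace X] : IsCompactExhaustion fun _ : ℕ => (Set.univ : Set X) where
  mono := monotone_const
  isCompact _ := isCompact_univ
  exists_mem _ := ⟨0, trivial⟩
  isOpen U h := by
    obtain ⟨V, hV, h⟩ := h 0
    simp only [Set.inter_univ] at h
    rwa [h]

lemma shift (hK : IsCompactExhaustion K) (N : ℕ) : IsCompactExhaustion fun n => K (n + N) where
  mono _ _ h := hK.mono (Nat.add_le_add_right h N)
  isCompact n := hK.isCompact _
  exists_mem x := by
    obtain ⟨n, hn⟩ := hK.exists_mem x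
    exact ⟨n, hK.mono (Nat.le_add_right _ _) hn⟩
  isOpen U h := hK.isOpen U fun n => by
    obtain ⟨V, hV, h⟩ := h n
    refine ⟨V, hV, ?_⟩
    have hs : K n ⊆ K (n + N) := hK.mono (Nat.le_add_right _ _)
    rw [← Set.inter_eq_right.2 hs, ← Set.inter_assoc, h, Set.inter_assoc]

/-- Each `A n` lies in the interior of `A (n + 1)` relative to `K (n + 1)`, so the union is open
relative to every `K m`. -/
lemma isOpen_iUnion (hK : IsCompactExhaustion K) {A : ℕ → Set X} (hA : ∀ n, A n ⊆ K n)
    (h : ∀ n, ∃ U, IsOpen U ∧ A n ⊆ U ∧ U ∩ K (n + 1) ⊆ A (n + 1)) : IsOpen (⋃ n, A n) := by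
  choose U hU hAU hUA using h
  have hmono : Monotone A := monotone_nat_of_le_succ fun n a ha =>
    hUA n ⟨hAU n ha, hK.mono (Nat.le_succ n) (hA n ha)⟩
  -- The index starts at `m` because `K m` must lie in `K (n + m + 1)` for the trace of `U (n + m)`
  -- on it to stay in the union.
  refine hK.isOpen _ fun m => ⟨⋃ n : ℕ, U (n + m), _root_.isOpen_iUnion fun n => hU _, ?_⟩
  ext a
  simp only [Set.mem_inter_iff, Set.mem_iUnion, and_congr_left_iff]
  intro ha
  constructor
  · rintro ⟨j, hj⟩
    exact ⟨j, hAU _ (hmono (Nat.le_add_right _ _) hj)⟩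
  · rintro ⟨n, hn⟩
    exact ⟨n + m + 1, hUA _ ⟨hn, hK.mono (by omega) ha⟩⟩

/-- Separate `A` from the compact set `C \ U` by disjoint open sets, and remove the second one from
`C`. -/
lemma exists_compact_between [T2Space X] {A C U : Set X} (hA : IsCompact A) (hC : IsCompact C)
    (hU : IsOpen U) (hAU : A ⊆ U) :
    ∃ B V, IsCompact B ∧ IsOpen V ∧ B ⊆ C ∧ B ⊆ U ∧ A ⊆ V ∧ V ∩ C ⊆ B := by
  obtain ⟨V, O, hV, hO, hAV, hCO, hVO⟩ := SeparatedNhds.of_isCompact_isCompact hA (hC.diff hU)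
    (Set.disjoint_left.2 fun a ha h => h.2 (hAU ha))
  refine ⟨C \ O, V, hC.diff hO, hV, Set.sdiff_subset, fun b hb => ?_, hAV, fun v hv => ⟨hv.2, fun h =>
    Set.disjoint_left.1 hVO hv.1 h⟩⟩
  by_contra h
  exact hb.2 (hCO ⟨hb.1, h⟩)

/-- The product of two Hausdorff spaces with such exhaustions has such an exhaustion. -/
theorem prod [T2Space X] [T2Space Y] (hK : IsCompactExhaustion K) (hL : IsCompactExhaustion L) :
    IsCompactExhaustion fun n => K n ×ˢ L n where
  mono _ _ h := Set.prod_mono (hK.mono h) (hL.mono h)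
  isCompact n := (hK.isCompact n).prod (hL.isCompact n)
  exists_mem := by
    rintro ⟨x, y⟩
    obtain ⟨n, hn⟩ := hK.exists_mem x
    obtain ⟨m, hm⟩ := hL.exists_mem y
    exact ⟨max n m, hK.mono (le_max_left _ _) hn, hL.mono (le_max_right _ _) hm⟩
  isOpen := by
    intro W hW
    rw [isOpen_iff_mem_nhds]
    rintro ⟨x, y⟩ hxy
    obtain ⟨N₁, hN₁⟩ := hK.exists_mem x
    obtain ⟨N₂, hN₂⟩ := hL.exists_mem y
    let N := max N₁ N₂
    have hK' := hK.shift N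
    have hL' := hL.shift N
    -- Starting from the point itself, compact rectangles inside `W` are enlarged stage by stage
    -- with the tube lemma. Their unions in the two factors are open by `isOpen_iUnion`. The shift
    -- by `N` places the point in stage zero.
    let P : ℕ → Set X × Set Y → Prop := fun n p => IsCompact p.1 ∧ IsCompact p.2 ∧
      p.1 ⊆ K (n + N) ∧ p.2 ⊆ L (n + N) ∧ p.1 ×ˢ p.2 ⊆ W
    have hstep : ∀ n p, P n p → ∃ p', P (n + 1) p' ∧
        (∃ U, IsOpen U ∧ p.1 ⊆ U ∧ U ∩ K (n + 1 + N) ⊆ p'.1) ∧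
        ∃ U, IsOpen U ∧ p.2 ⊆ U ∧ U ∩ L (n + 1 + N) ⊆ p'.2 := by
      rintro n ⟨A, B⟩ ⟨hA, hB, hAK, hBL, hAB⟩
      obtain ⟨V, hV, hWV⟩ := hW (n + 1 + N)
      have hsub : A ×ˢ B ⊆ V := fun z hz => by
        have : z ∈ W ∩ K (n + 1 + N) ×ˢ L (n + 1 + N) :=
          ⟨hAB hz, hK.mono (by omega) (hAK hz.1), hL.mono (by omega) (hBL hz.2)⟩
        rw [hWV] at this
        exact this.1
      obtain ⟨U₁, U₂, hU₁, hU₂, hAU, hBU, hUV⟩ := generalized_tube_lemma hA hB hV hsub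
      obtain ⟨A', V₁, hA', hV₁, hA'K, hA'U, hAV, hVA⟩ :=
        exists_compact_between hA (hK.isCompact (n + 1 + N)) hU₁ hAU
      obtain ⟨B', V₂, hB', hV₂, hB'L, hB'U, hBV, hVB⟩ :=
        exists_compact_between hB (hL.isCompact (n + 1 + N)) hU₂ hBU
      refine ⟨(A', B'), ⟨hA', hB', hA'K, hB'L, fun z hz => ?_⟩, ⟨V₁, hV₁, hAV, hVA⟩,
        ⟨V₂, hV₂, hBV, hVB⟩⟩
      have : z ∈ V ∩ K (n + 1 + N) ×ˢ L (n + 1 + N) :=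
        ⟨hUV ⟨hA'U hz.1, hB'U hz.2⟩, hA'K hz.1, hB'L hz.2⟩
      rw [← hWV] at this
      exact this.1
    choose f hf using hstep
    let S : ∀ n, {p // P n p} := fun n => Nat.rec (motive := fun n => {p // P n p})
      ⟨({x}, {y}), isCompact_singleton, isCompact_singleton,
        Set.singleton_subset_iff.2 (hK.mono (by omega) hN₁),
        Set.singleton_subset_iff.2 (hL.mono (by omega) hN₂), by simpa using hxy⟩
      (fun n p => ⟨f n p.1 p.2, (hf n p.1 p.2).1⟩) n
    have hA : IsOpen (⋃ n, (S n).1.1) := hK'.isOpen_iUnion (fun n => (S n).2.2.2.1)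
      fun n => (hf n (S n).1 (S n).2).2.1
    have hB : IsOpen (⋃ n, (S n).1.2) := hL'.isOpen_iUnion (fun n => (S n).2.2.2.2.1)
      fun n => (hf n (S n).1 (S n).2).2.2
    have hmono : Monotone fun n => (S n).1 := monotone_nat_of_le_succ fun n => by
      obtain ⟨⟨U, _, hU, hU'⟩, ⟨V, _, hV, hV'⟩⟩ := (hf n (S n).1 (S n).2).2
      exact ⟨fun a ha => hU' ⟨hU ha, hK.mono (by omega) ((S n).2.2.2.1 ha)⟩,
        fun a ha => hV' ⟨hV ha, hL.mono (by omega) ((S n).2.2.2.2.1 ha)⟩⟩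
    refine Filter.mem_of_superset (prod_mem_nhds
      (hA.mem_nhds (Set.mem_iUnion.2 ⟨0, rfl⟩)) (hB.mem_nhds (Set.mem_iUnion.2 ⟨0, rfl⟩))) ?_
    rintro ⟨a, b⟩ ⟨ha, hb⟩
    obtain ⟨i, hi⟩ := Set.mem_iUnion.1 ha
    obtain ⟨j, hj⟩ := Set.mem_iUnion.1 hb
    exact (S (max i j)).2.2.2.2.2
      ⟨(hmono (le_max_left i j)).1 hi, (hmono (le_max_right i j)).2 hj⟩

/-- A map is continuous if its restrictions to the members of the exhaustion are continuous after
composition with finitely many jointly surjective maps from compact spaces. -/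
lemma continuous [T2Space X] (hK : IsCompactExhaustion K) {f : X → Z} {ι : ℕ → Type*}
    [∀ n, Finite (ι n)] {Q : ∀ n, ι n → Type*} [∀ n i, TopologicalSpace (Q n i)]
    [∀ n i, CompactSpace (Q n i)] (q : ∀ n i, Q n i → X) (hq : ∀ n i, Continuous (q n i))
    (hK' : ∀ n, ∀ x ∈ K n, ∃ i a, q n i a = x) (hf : ∀ n i, Continuous (f ∘ q n i)) :
    Continuous f := by
  refine ⟨fun O hO => hK.isOpen _ fun n => ?_⟩
  -- These are the points of the covered set that `f` sends outside `O`: a finite union of compact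
  -- images in a Hausdorff space, hence closed.
  let D : Set X := ⋃ i, q n i '' ((f ∘ q n i) ⁻¹' Oᶜ)
  have hD : IsClosed D := isClosed_iUnion_of_finite fun i =>
    (((hO.isClosed_compl.preimage (hf n i)).isCompact).image (hq n i)).isClosed
  refine ⟨Dᶜ, hD.isOpen_compl, ?_⟩
  ext x
  simp only [Set.mem_inter_iff, and_congr_left_iff]
  intro hx
  obtain ⟨i, a, rfl⟩ := hK' n x hx
  constructor
  · intro h h'
    obtain ⟨j, b, hb, hb'⟩ := Set.mem_iUnion.1 h'
    apply hb
    rw [Function.comp, hb']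
    exact h
  · intro h
    by_contra h'
    exact h (Set.mem_iUnion.2 ⟨i, a, h', rfl⟩)

end IsCompactExhaustion

/-! ### Skeleta of $EG$ and the joint continuity of splicing -/

namespace ESpace

open TopSimplex

variable {G : Type u} [Group G]

/-- The points of `EG` in the simplices of dimension at most `N`. -/
def skeleton (G : Type u) [Group G] (N : ℕ) : Set (ESpace G) :=
  ⋃ a : Σ n : Fin (N + 1), (Fin (n + 1) → G), Set.range (point a.2)

/-- For finite `G` only finitely many vertex lists occur in each dimension, so the skeleta are
compact; openness is tested on single simplices. -/
lemma isCompactExhaustion_skeleton [Finite G] : IsCompactExhaustion (skeleton G) where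
  mono m n h := by
    rintro _ ⟨_, ⟨⟨i, x⟩, rfl⟩, hp⟩
    exact ⟨_, ⟨⟨⟨i, by omega⟩, x⟩, rfl⟩, hp⟩
  isCompact N := isCompact_iUnion fun a => isCompact_range (continuous_point a.2)
  exists_mem p := by
    obtain ⟨n, x, t, rfl⟩ := exists_point p
    exact ⟨n, Set.mem_iUnion.2 ⟨⟨Fin.last n, x⟩, t, rfl⟩⟩
  isOpen U h := by
    have : Continuous fun p => (p ∈ U) := continuous_iff_point.2 fun n x => by
      obtain ⟨V, hV, hUV⟩ := h n
      have hx : ∀ t, point x t ∈ U ↔ point x t ∈ V := fun t => by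
        have ht : point x t ∈ skeleton G n := Set.mem_iUnion.2 ⟨⟨Fin.last n, x⟩, t, rfl⟩
        have := Set.ext_iff.1 hUV (point x t)
        simpa [ht] using this
      simp only [hx]
      exact continuous_Prop.2 (hV.preimage (continuous_point x))
    exact continuous_Prop.1 this

/-- On a product of two simplices and the interval, splicing lands in one simplex with continuous
coordinates. These products determine the topology of $EG\times EG\times[0,1]$ because products of
compact exhaustions are again such exhaustions. -/
theorem continuous_mix [Finite G] :
    Continuous fun z : ESpace G × ESpace G × unitInterval => mix z.1 z.2.1 z.2.2 := by
  have hK := isCompactExhaustion_skeleton (G := G)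
  refine (hK.prod (hK.prod (IsCompactExhaustion.of_compactSpace (X := unitInterval)))).continuous
    (ι := fun N => (Σ n : Fin (N + 1), (Fin (n + 1) → G)) × Σ n : Fin (N + 1), (Fin (n + 1) → G))
    (Q := fun N a => Simp.{u} a.1.1 × Simp.{u} a.2.1 × unitInterval)
    (fun N a z => (point a.1.2 z.1, point a.2.2 z.2.1, z.2.2)) (fun N a => ?_) (fun N z hz => ?_)
    fun N a => ?_
  · exact ((continuous_point _).comp continuous_fst).prodMk
      (((continuous_point _).comp (continuous_fst.comp continuous_snd)).prodMk
        (continuous_snd.comp continuous_snd))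
  · obtain ⟨p, q, s⟩ := z
    obtain ⟨hp, hq, -⟩ := hz
    obtain ⟨a, t, rfl⟩ := Set.mem_iUnion.1 hp
    obtain ⟨b, t', rfl⟩ := Set.mem_iUnion.1 hq
    exact ⟨(a, b), (t, t', s), rfl⟩
  · have := (continuous_point (mixTuple a.1.2 a.2.2)).comp continuous_mixSimp
    refine this.congr fun z => ?_
    exact (mix_point _ _ _ _ _).symm

end ESpace

/-! ### The universal bundle -/

namespace ESpace

open Realization TopSimplex

variable {G : Type u} [Group G]

/-- The left action of `G` on `EG`, for which `k⁻¹` acts as the right translation by `k`. -/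
noncomputable instance : MulAction G (ESpace G) where
  smul k p := vertexMap (k * ·) p
  one_smul p := by
    change vertexMap _ p = p
    simp only [one_mul]
    exact vertexMap_id p
  mul_smul k l p := by
    change vertexMap _ p = vertexMap _ (vertexMap _ p)
    rw [vertexMap_comp]
    congr 2
    funext x
    exact mul_assoc k l x

instance : ContinuousConstSMul G (ESpace G) := ⟨fun k => (vertexMap (k * ·)).continuous⟩

lemma smul_point (k : G) {n : ℕ} (x : Fin (n + 1) → G) (t : Simp.{u} n) :
    k • point x t = point (fun i => k * x i) t := vertexMap_point _ _ _

lemma rightTranslate_eq_smul (k : G) (p : ESpace G) : rightTranslate k p = k⁻¹ • p :=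
  rightTranslate_eq k p

lemma smul_mix (k : G) (p q : ESpace G) (s : unitInterval) :
    k • mix p q s = mix (k • p) (k • q) s := vertexMap_mix _ p q s

/-- Write `p` with positive lengths; then the vertices `k * x i` and `x i` must agree. -/
lemma eq_one_of_smul_eq {k : G} {p : ESpace G} (h : k • p = p) : k = 1 := by
  obtain ⟨n, x, _, t, ht, rfl, -⟩ := exists_common_point p p
  rw [smul_point] at h
  have := congrFun (eq_of_profile_point_eq ht (congrArg profile h)) 0
  simpa using this

/-- The equivariant map from `G` to a point. -/
abbrev toPoint (G : Type u) [Group G] : G →[Gᵐᵒᵖ] PUnit.{u + 1} :=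
  { toFun := fun _ : G => PUnit.unit, map_smul' := fun _ _ => rfl }

/-- The image in the nerve of `• ⋊ G` of the simplex with the given vertices. -/
def baseSimplex {n : ℕ} (x : Fin (n + 1) → G) :
    (nerve (TranslationGroupoid G PUnit.{u + 1})) _⦋n⦌ :=
  (nerveMap (TranslationGroupoid.map (toPoint G))).app _ (tuple x)

lemma bundleMap_point {n : ℕ} (x : Fin (n + 1) → G) (t : Simp.{u} n) :
    bundleMap G (point x t) = cell (baseSimplex x) t := map_cell _ _ _

/-- The group element attached to an edge of a simplex of the nerve of `• ⋊ G`. -/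
def label {n : ℕ} (D : (nerve (TranslationGroupoid G PUnit.{u + 1})) _⦋n⦌) {i j : Fin (n + 1)}
    (h : i ≤ j) : G :=
  MulOpposite.unop
    ((show Fin (n + 1) ⥤ TranslationGroupoid G PUnit.{u + 1} from D).map (homOfLE h)).val

lemma ext_label {n : ℕ} {D D' : (nerve (TranslationGroupoid G PUnit.{u + 1})) _⦋n⦌}
    (h : ∀ (i j : Fin (n + 1)) (hij : i ≤ j), label D hij = label D' hij) : D = D' := by
  have key : ∀ F F' : Fin (n + 1) ⥤ TranslationGroupoid G PUnit.{u + 1},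
      (∀ (i j : Fin (n + 1)) (f : i ⟶ j), (F.map f).val = (F'.map f).val) → F = F' := by
    intro F F' hF
    have hobj : ∀ a b : TranslationGroupoid G PUnit.{u + 1}, a = b := fun a b =>
      (ActionCategory.objEquiv Gᵐᵒᵖ PUnit.{u + 1}).symm.injective rfl
    -- All objects are equal, but only propositionally, so arrows with the same group element are
    -- compared heterogeneously.
    have hmap : ∀ (a b a' b' : TranslationGroupoid G PUnit.{u + 1}) (f : a ⟶ b) (f' : a' ⟶ b'),
        f.val = f'.val → HEq f f' := by
      intro a b a' b' f f' h
      obtain rfl := hobj a a'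
      obtain rfl := hobj b b'
      exact heq_of_eq (Subtype.ext h)
    exact CategoryTheory.Functor.hext (fun i => hobj _ _) fun i j f => hmap _ _ _ _ _ _ (hF i j f)
  exact key D D' fun i j f => MulOpposite.unop_injective (h i j (leOfHom f))

lemma label_trans {n : ℕ} (D : (nerve (TranslationGroupoid G PUnit.{u + 1})) _⦋n⦌)
    {i j k : Fin (n + 1)} (hij : i ≤ j) (hjk : j ≤ k) :
    label D (hij.trans hjk) = label D hij * label D hjk := by
  have := (show Fin (n + 1) ⥤ TranslationGroupoid G PUnit.{u + 1} from D).map_comp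
    (homOfLE hij) (homOfLE hjk)
  exact congrArg (fun a => MulOpposite.unop a.val) this

lemma label_baseSimplex {n : ℕ} (x : Fin (n + 1) → G) {i j : Fin (n + 1)} (h : i ≤ j) :
    label (baseSimplex x) h = (x i)⁻¹ * x j := rfl

/-- Lift with initial vertex `1`: each vertex is the label of the edge that leads to it from the
first one. -/
lemma exists_baseSimplex {n : ℕ} (D : (nerve (TranslationGroupoid G PUnit.{u + 1})) _⦋n⦌) :
    ∃ x : Fin (n + 1) → G, baseSimplex x = D := by
  refine ⟨fun i => label D (Fin.zero_le i), ext_label fun i j h => ?_⟩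
  rw [label_baseSimplex, inv_mul_eq_iff_eq_mul, ← label_trans]

lemma baseSimplex_eq_iff {n : ℕ} {x y : Fin (n + 1) → G} :
    baseSimplex x = baseSimplex y ↔ ∃ k : G, y = fun i => k * x i := by
  constructor
  · intro h
    refine ⟨y 0 * (x 0)⁻¹, funext fun i => ?_⟩
    have := congrArg (fun D => label D (Fin.zero_le i)) h
    simp only [label_baseSimplex] at this
    rw [mul_assoc, this, mul_inv_cancel_left]
  · rintro ⟨k, rfl⟩
    refine ext_label fun i j h => ?_
    simp only [label_baseSimplex]
    group

lemma map_baseSimplex {m n : ℕ} (θ : ⦋m⦌ ⟶ ⦋n⦌) (x : Fin (n + 1) → G) :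
    (nerve (TranslationGroupoid G PUnit.{u + 1})).map θ.op (baseSimplex x) =
      baseSimplex fun j => x (θ j) := rfl

lemma bundleMap_smul (k : G) (p : ESpace G) : bundleMap G (k • p) = bundleMap G p := by
  obtain ⟨n, x, t, rfl⟩ := exists_point p
  rw [smul_point, bundleMap_point, bundleMap_point]
  exact congrArg (fun D => cell D t) (baseSimplex_eq_iff.2 ⟨k, rfl⟩).symm

lemma bundleMap_surjective : Function.Surjective (bundleMap G) := by
  intro b
  obtain ⟨n, D, t, rfl⟩ := exists_cell b
  obtain ⟨x, rfl⟩ := exists_baseSimplex D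
  exact ⟨point x t, bundleMap_point x t⟩

/-- The chosen lifts of simplices need not be compatible with faces, but two lifts of one simplex
differ by an element of `G`, which `f` does not see. -/
lemma exists_desc_bundleMap {Z : Type u} [TopologicalSpace Z] (f : C(ESpace G, Z))
    (hf : ∀ (k : G) p, f (k • p) = f p) : ∃ g : C(BSpace G, Z), ∀ p, g (bundleMap G p) = f p := by
  choose ℓ hℓ using fun (n : ℕ) (D : (nerve (TranslationGroupoid G PUnit.{u + 1})) _⦋n⦌) =>
    exists_baseSimplex D
  have key : ∀ {n : ℕ} (x y : Fin (n + 1) → G) (t : Simp.{u} n), baseSimplex x = baseSimplex y →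
      f (point x t) = f (point y t) := by
    intro n x y t h
    obtain ⟨k, rfl⟩ := baseSimplex_eq_iff.1 h
    rw [← smul_point, hf]
  obtain ⟨g, hg⟩ := exists_desc (X := nerve (TranslationGroupoid G PUnit.{u + 1}))
    (fun n D t => f (point (ℓ n D) t)) (fun n D => f.continuous.comp (continuous_point _))
    fun m n θ D t => by
      rw [point_map]
      apply key
      rw [hℓ, ← map_baseSimplex, hℓ]
  refine ⟨g, fun p => ?_⟩
  obtain ⟨n, x, t, rfl⟩ := exists_point p
  rw [bundleMap_point, hg]
  exact key _ _ _ (hℓ _ _)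

/-- The orbit map is invariant, hence factors through $BG$, so points with the same image lie in one
orbit. -/
lemma bundleMap_eq_iff {p q : ESpace G} :
    bundleMap G p = bundleMap G q ↔ p ∈ MulAction.orbit G q := by
  constructor
  · intro h
    let f : C(ESpace G, Quotient (MulAction.orbitRel G (ESpace G))) :=
      ⟨fun p => Quotient.mk _ p, continuous_quot_mk⟩
    obtain ⟨g, hg⟩ := exists_desc_bundleMap f
      fun k p => Quotient.sound (MulAction.orbitRel_apply.2 ⟨k, rfl⟩)
    have h' : f p = f q := by rw [← hg p, ← hg q, h]
    exact MulAction.orbitRel_apply.1 (Quotient.exact h')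
  · rintro ⟨k, rfl⟩
    exact bundleMap_smul k q

/-- Openness in $BG$ is tested on cells, and every cell lifts to $EG$. -/
lemma isQuotientMap_bundleMap : Topology.IsQuotientMap (bundleMap G) := by
  refine ⟨Topology.isCoinducing_iff.2 fun U => ⟨fun h => (isOpen_iff U).2 fun n D => ?_,
    fun h => h.preimage (bundleMap G).hom.continuous⟩, bundleMap_surjective⟩
  obtain ⟨x, rfl⟩ := exists_baseSimplex D
  have := h.preimage (continuous_point x)
  convert this using 1
  ext t
  simp only [Set.mem_preimage, bundleMap_point]

/-- A free action of a finite group by homeomorphisms of a Hausdorff space gives a covering. -/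
lemma _root_.isQuotientCoveringMap_of_finite {E B : Type*} [TopologicalSpace E]
    [TopologicalSpace B] [T2Space E] {K : Type*} [Group K] [Finite K] [MulAction K E]
    [hK : ContinuousConstSMul K E] {f : E → B} (hf : Topology.IsQuotientMap f)
    (hfib : ∀ {a b}, f a = f b ↔ a ∈ MulAction.orbit K b)
    (hfree : ∀ (k : K) (a : E), k • a = a → k = 1) : IsQuotientCoveringMap f K where
  __ := hf
  __ := hK
  apply_eq_iff_mem_orbit := hfib
  disjoint e := by
    -- Each nontrivial `k` moves `e`, so the Hausdorff property gives a neighbourhood for that `k`;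
    -- finiteness allows intersecting them.
    have h : ∀ k : K, ∃ U ∈ nhds e, k ≠ 1 → Disjoint ((k • ·) '' U) U := by
      intro k
      by_cases hk : k = 1
      · exact ⟨Set.univ, Filter.univ_mem, fun h => absurd hk h⟩
      · obtain ⟨V, V', hV, hV', heV, heV', hd⟩ := t2_separation fun h => hk (hfree k e h)
        refine ⟨(k • ·) ⁻¹' V ∩ V', Filter.inter_mem
          ((hV.preimage (continuous_const_smul k)).mem_nhds heV) (hV'.mem_nhds heV'), fun _ => ?_⟩
        refine hd.mono ?_ Set.inter_subset_right
        rintro _ ⟨a, ha, rfl⟩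
        exact ha.1
    choose U hU hd using h
    refine ⟨⋂ k, U k, Filter.iInter_mem.2 hU, fun k hk => ?_⟩
    by_contra hne
    obtain ⟨a, ⟨b, hb, hba⟩, ha⟩ := hk
    exact Set.disjoint_left.1 (hd k hne) ⟨b, Set.mem_iInter.1 hb k, hba⟩ (Set.mem_iInter.1 ha k)

theorem isQuotientCoveringMap_bundleMap [Finite G] : IsQuotientCoveringMap (bundleMap G) G :=
  isQuotientCoveringMap_of_finite isQuotientMap_bundleMap bundleMap_eq_iff
    fun _ _ => eq_one_of_smul_eq

end ESpace

/-! ### The circle as a quotient of the interval -/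

/-- The parametrization of the circle by the unit interval. -/
noncomputable def loopParam : C(unitInterval, Circle) :=
  ⟨fun t => Circle.exp (2 * Real.pi * t), by fun_prop⟩

lemma loopParam_apply (t : unitInterval) : loopParam t = Circle.exp (2 * Real.pi * t) := rfl

@[simp]
lemma loopParam_zero : loopParam 0 = 1 := by simp [loopParam_apply]

@[simp]
lemma loopParam_one : loopParam 1 = 1 := by simp [loopParam_apply]

lemma loopParam_surjective : Function.Surjective loopParam := by
  intro z
  have hpi := Real.two_pi_pos.ne'
  let r := Complex.arg z / (2 * Real.pi)
  refine ⟨⟨Int.fract r, Int.fract_nonneg _, (Int.fract_lt_one _).le⟩, ?_⟩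
  rw [loopParam_apply, ← Circle.exp_arg z, Circle.exp_eq_exp]
  refine ⟨-⌊r⌋, ?_⟩
  have h : (2 * Real.pi) * r = Complex.arg z := mul_div_cancel₀ _ hpi
  have h' : Int.fract r = r - ⌊r⌋ := rfl
  simp only [h']
  push_cast
  rw [mul_sub, h]
  ring

lemma loopParam_eq_iff {s t : unitInterval} (h : loopParam s = loopParam t) :
    s = t ∨ (s = 0 ∧ t = 1) ∨ (s = 1 ∧ t = 0) := by
  rw [loopParam_apply, loopParam_apply, Circle.exp_eq_exp] at h
  obtain ⟨m, hm⟩ := h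
  have hpi := Real.two_pi_pos
  have h1 : (s : ℝ) = t + m := by
    have : 2 * Real.pi * s = 2 * Real.pi * (t + m) := by rw [hm]; ring
    exact mul_left_cancel₀ hpi.ne' this
  have hs := s.2
  have ht := t.2
  have h2 : -1 ≤ m := by
    have : (-1 : ℝ) ≤ m := by linarith [hs.1, ht.2]
    exact_mod_cast this
  have h3 : m ≤ 1 := by
    have : (m : ℝ) ≤ 1 := by linarith [hs.2, ht.1]
    exact_mod_cast this
  obtain rfl | rfl | rfl : m = -1 ∨ m = 0 ∨ m = 1 := by omega
  · right; left
    push_cast at h1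
    exact ⟨Subtype.ext (show (s : ℝ) = 0 by linarith [hs.1, ht.2]),
      Subtype.ext (show (t : ℝ) = 1 by linarith [hs.1, ht.2])⟩
  · left
    exact Subtype.ext (by simpa using h1)
  · right; right
    push_cast at h1
    exact ⟨Subtype.ext (show (s : ℝ) = 1 by linarith [hs.2, ht.1]),
      Subtype.ext (show (t : ℝ) = 0 by linarith [hs.2, ht.1])⟩

/-- A map from a compact space to a Hausdorff space is proper, and proper maps are closed after a
product with any `Z`. So families of loops can be glued over an arbitrary parameter space. -/
lemma isQuotientMap_prod_loopParam (Z : Type*) [TopologicalSpace Z] :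
    Topology.IsQuotientMap (Prod.map (id : Z → Z) loopParam) := by
  have h : IsProperMap (Prod.map (id : Z → Z) loopParam) :=
    (Homeomorph.refl Z).isProperMap.prodMap loopParam.continuous.isProperMap
  exact h.isClosedMap.isQuotientMap h.continuous
    (Function.surjective_id.prodMap loopParam_surjective)

lemma exists_circle_desc {Z B : Type*} [TopologicalSpace Z] [TopologicalSpace B]
    (f : C(Z × unitInterval, B)) (hf : ∀ z, f (z, 0) = f (z, 1)) :
    ∃ g : C(Z × Circle, B), ∀ z t, g (z, loopParam t) = f (z, t) := by
  have h : ∀ a b : Z × unitInterval, Prod.map (id : Z → Z) loopParam a =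
      Prod.map (id : Z → Z) loopParam b → f a = f b := by
    rintro ⟨z, s⟩ ⟨z', t⟩ h
    obtain rfl : z = z' := congrArg Prod.fst h
    rcases loopParam_eq_iff (congrArg Prod.snd h) with rfl | ⟨rfl, rfl⟩ | ⟨rfl, rfl⟩
    · rfl
    · exact hf z
    · exact (hf z).symm
  have hq := isQuotientMap_prod_loopParam Z
  let q : C(Z × unitInterval, Z × Circle) := ⟨_, hq.continuous⟩
  exact ⟨Topology.IsQuotientMap.lift (f := q) hq f h, fun z t =>
    DFunLike.congr_fun (Topology.IsQuotientMap.lift_comp (f := q) hq f h) (z, t)⟩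

/-! ### The cover of lifted loops -/

namespace LiftedLoops

open ESpace

variable {G : Type u} [Group G]

/-- The lifted path in `EG`. -/
def path (w : LiftedLoops G) : C(unitInterval, ESpace G) := w.2.1.2

/-- The underlying loop in `BG`. -/
def loop (w : LiftedLoops G) : C(Circle, BSpace G) := w.2.1.1

/-- The holonomy of a lifted loop. -/
def hol (w : LiftedLoops G) : G := w.1

lemma bundleMap_path (w : LiftedLoops G) (t : unitInterval) :
    bundleMap G (w.path t) = w.loop (loopParam t) := w.2.2.1 t

lemma path_one (w : LiftedLoops G) : w.path 1 = w.hol⁻¹ • w.path 0 := by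
  rw [← rightTranslate_eq_smul]
  exact w.2.2.2.symm

/-- By freeness the end points determine the holonomy; it thereby becomes a closed condition on the
path. -/
lemma hol_eq_iff (w : LiftedLoops G) {k : G} : w.hol = k ↔ w.path 1 = k⁻¹ • w.path 0 := by
  constructor
  · rintro rfl
    exact w.path_one
  · intro h
    rw [path_one] at h
    have h' : (k * w.hol⁻¹) • w.path 0 = w.path 0 := by rw [mul_smul, h, smul_inv_smul]
    have := eq_one_of_smul_eq h'
    rw [mul_inv_eq_one] at this
    exact this.symm

lemma ext_path {w w' : LiftedLoops G} (h : w.path = w'.path) : w = w' := by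
  have hk : w.hol = w'.hol := by rw [hol_eq_iff, h, path_one]
  have hl : w.loop = w'.loop := by
    ext z
    obtain ⟨t, rfl⟩ := loopParam_surjective z
    rw [← bundleMap_path, ← bundleMap_path, h]
  obtain ⟨k, ⟨σ, τ⟩, h₁, h₂⟩ := w
  obtain ⟨k', ⟨σ', τ'⟩, h₁', h₂'⟩ := w'
  change k = k' at hk
  change σ = σ' at hl
  change τ = τ' at h
  subst hk hl h
  rfl

lemma exists_of_path (k : G) (τ : C(unitInterval, ESpace G)) (h : τ 1 = k⁻¹ • τ 0) :
    ∃ w : LiftedLoops G, w.hol = k ∧ w.path = τ := by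
  obtain ⟨g, hg⟩ := exists_circle_desc (Z := Unit)
    (⟨fun z => bundleMap G (τ z.2), (bundleMap G).hom.continuous.comp
      (τ.continuous.comp continuous_snd)⟩ : C(Unit × unitInterval, BSpace G)) fun _ => by
        simp [h, bundleMap_smul]
  refine ⟨⟨k, ⟨(g.curry (), τ), fun t => (hg () t).symm, ?_⟩⟩, rfl, rfl⟩
  rw [rightTranslate_eq_smul]
  exact h.symm

/-- The lifted loop with given holonomy and path. -/
noncomputable def ofPath (k : G) (τ : C(unitInterval, ESpace G)) (h : τ 1 = k⁻¹ • τ 0) :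
    LiftedLoops G := (exists_of_path k τ h).choose

@[simp]
lemma hol_ofPath (k : G) (τ : C(unitInterval, ESpace G)) (h) : (ofPath k τ h).hol = k :=
  (exists_of_path k τ h).choose_spec.1

@[simp]
lemma path_ofPath (k : G) (τ : C(unitInterval, ESpace G)) (h) : (ofPath k τ h).path = τ :=
  (exists_of_path k τ h).choose_spec.2

lemma continuous_path : Continuous (path (G := G)) := continuous_sigma fun _ =>
  continuous_snd.comp continuous_subtype_val

lemma continuous_loop : Continuous (loop (G := G)) := continuous_sigma fun _ =>
  continuous_fst.comp continuous_subtype_val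

/-- The loop depends continuously on the path through the quotient interval-to-circle map. The
holonomy is then locally constant, since its finitely many level sets are closed. -/
lemma continuous_iff_path [Finite G] {Z : Type*} [TopologicalSpace Z] {F : Z → LiftedLoops G} :
    Continuous F ↔ Continuous fun z => (F z).path := by
  refine ⟨fun h => continuous_path.comp h, fun h => ?_⟩
  have hloop : Continuous fun z => (F z).loop := by
    obtain ⟨g, hg⟩ := exists_circle_desc
      (⟨fun z => bundleMap G ((F z.1).path z.2), (bundleMap G).hom.continuous.comp
        ((h.comp continuous_fst).eval continuous_snd)⟩ : C(Z × unitInterval, BSpace G)) fun z => by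
          simp [bundleMap_path]
    refine g.curry.continuous.congr fun z => ContinuousMap.ext fun c => ?_
    obtain ⟨t, rfl⟩ := loopParam_surjective c
    exact (hg z t).trans (bundleMap_path _ _)
  have hev : ∀ t : unitInterval, Continuous fun z => (F z).path t := fun t =>
    h.eval continuous_const
  have hclosed : ∀ k : G, IsClosed {z | (F z).hol = k} := by
    intro k
    simp only [hol_eq_iff]
    exact isClosed_eq (hev 1) ((continuous_const_smul k⁻¹).comp (hev 0))
  have hopen : ∀ k : G, IsOpen {z | (F z).hol = k} := by
    intro k
    have : {z | (F z).hol = k} = (⋃ l : {l : G // l ≠ k}, {z | (F z).hol = l.1})ᶜ := by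
      ext z
      simp only [ne_eq, Set.mem_ofPred_eq, Set.mem_compl_iff, Set.mem_iUnion, Subtype.exists,
        exists_prop, not_exists, not_and]
      exact ⟨fun h a ha h' => ha (h'.symm.trans h), fun h => by_contra fun h' => h _ h' rfl⟩
    rw [this]
    exact (isClosed_iUnion_of_finite fun l => hclosed _).isOpen_compl
  refine ⟨fun O hO => ?_⟩
  have hO' := fun k => isOpen_sigma_iff.1 hO k
  choose V hV hVO using fun k => isOpen_induced_iff.1 (hO' k)
  have : F ⁻¹' O = ⋃ k, {z | (F z).hol = k} ∩ (fun z => ((F z).loop, (F z).path)) ⁻¹' V k := by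
    ext z
    have key : F z ∈ O ↔ ((F z).loop, (F z).path) ∈ V (F z).hol :=
      (Set.ext_iff.1 (hVO (F z).hol) (F z).2).symm
    simp only [Set.mem_preimage, Set.mem_iUnion, Set.mem_inter_iff, Set.mem_ofPred_eq, key]
    exact ⟨fun h => ⟨_, rfl, h⟩, by rintro ⟨k, rfl, h⟩; exact h⟩
  rw [this]
  exact isOpen_iUnion fun k => (hopen k).inter ((hV k).preimage (hloop.prodMk h))

instance : T2Space (LiftedLoops G) :=
  T2Space.of_injective_continuous (fun _ _ h => ext_path h) continuous_path

/-- The left action of `G` on `EG` as continuous maps. -/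
noncomputable def smulMap (k : G) : C(ESpace G, ESpace G) := ⟨(k • ·), continuous_const_smul k⟩

@[simp]
lemma smulMap_apply (k : G) (p : ESpace G) : smulMap k p = k • p := rfl

/-- Translating both end points by `k` forces the conjugated holonomy. -/
noncomputable instance : SMul G (LiftedLoops G) where
  smul k w := ofPath (k * w.hol * k⁻¹) ((smulMap k).comp w.path) (by
    simp [path_one, ← mul_smul, mul_assoc])

@[simp]
lemma path_smul (k : G) (w : LiftedLoops G) (t) : (k • w).path t = k • w.path t :=
  congrArg (fun τ : C(unitInterval, ESpace G) => τ t) (path_ofPath _ _ _)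

lemma hol_smul (k : G) (w : LiftedLoops G) : (k • w).hol = k * w.hol * k⁻¹ := hol_ofPath _ _ _

lemma ext_path_apply {w w' : LiftedLoops G} (h : ∀ t, w.path t = w'.path t) : w = w' :=
  ext_path (ContinuousMap.ext h)

noncomputable instance : MulAction G (LiftedLoops G) where
  one_smul w := ext_path_apply fun t => by simp
  mul_smul k l w := ext_path_apply fun t => by simp [mul_smul]

lemma continuous_iff_path_apply [Finite G] {Z : Type*} [TopologicalSpace Z]
    {F : Z → LiftedLoops G} :
    Continuous F ↔ Continuous fun z : Z × unitInterval => (F z.1).path z.2 := by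
  rw [continuous_iff_path]
  refine ⟨fun h => (h.comp continuous_fst).eval continuous_snd, fun h => ?_⟩
  exact (ContinuousMap.curry ⟨_, h⟩).continuous

instance [Finite G] : ContinuousConstSMul G (LiftedLoops G) := ⟨fun k => by
  rw [continuous_iff_path_apply]
  simp only [path_smul]
  exact ((continuous_path.comp continuous_fst).eval continuous_snd).const_smul k⟩

lemma eq_one_of_smul_eq {k : G} {w : LiftedLoops G} (h : k • w = w) : k = 1 := by
  have := path_smul k w 0
  rw [h] at this
  exact ESpace.eq_one_of_smul_eq this.symm

lemma loop_smul (k : G) (w : LiftedLoops G) : (k • w).loop = w.loop := by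
  ext z
  obtain ⟨t, rfl⟩ := loopParam_surjective z
  rw [← bundleMap_path, ← bundleMap_path, path_smul, bundleMap_smul]

lemma eq_of_loop_eq [Finite G] {w w' : LiftedLoops G} (h : w.loop = w'.loop)
    (h₀ : w.path 0 = w'.path 0) : w = w' := by
  refine ext_path (DFunLike.coe_injective ?_)
  refine isQuotientCoveringMap_bundleMap.isCoveringMap.eq_of_comp_eq w.path.continuous
    w'.path.continuous ?_ 0 h₀
  funext t
  simp only [Function.comp, bundleMap_path, h]

/-- The initial points lie in one fibre, so a translate of `w'` starts where `w` does; unique path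
lifting gives equality. -/
lemma loop_eq_iff [Finite G] {w w' : LiftedLoops G} :
    w.loop = w'.loop ↔ w ∈ MulAction.orbit G w' := by
  constructor
  · intro h
    have h₀ : bundleMap G (w.path 0) = bundleMap G (w'.path 0) := by
      rw [bundleMap_path, bundleMap_path, h]
    obtain ⟨k, hk⟩ := bundleMap_eq_iff.1 h₀
    refine ⟨k, eq_of_loop_eq ?_ ?_⟩
    · exact (loop_smul k w').trans h.symm
    · rw [← hk]
      exact path_smul k w' 0
  · rintro ⟨k, rfl⟩
    exact loop_smul k w'

/-- Pairs of a loop in `BG` and a point of `EG` over its base point. -/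
abbrev PointedLoops (G : Type u) [Group G] : Type u :=
  {a : C(Circle, BSpace G) × ESpace G // bundleMap G a.2 = a.1 1}

/-- Homotopy lifting, with the pointed loops as parameter space, lifts all loops at once and
continuously in the loop and the initial point. -/
lemma exists_lift [Finite G] : ∃ Φ : PointedLoops G → LiftedLoops G, Continuous Φ ∧
    ∀ a, (Φ a).loop = a.1.1 ∧ (Φ a).path 0 = a.1.2 := by
  have hcov := (isQuotientCoveringMap_bundleMap (G := G)).isCoveringMap
  let H : C(unitInterval × PointedLoops G, BSpace G) :=
    ⟨fun z => z.2.1.1 (loopParam z.1), by fun_prop⟩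
  let f : C(PointedLoops G, ESpace G) := ⟨fun a => a.1.2, by fun_prop⟩
  have H0 : ∀ a, H (0, a) = bundleMap G (f a) := fun a => by
    change a.1.1 (loopParam 0) = _
    rw [loopParam_zero]
    exact a.2.symm
  let F := hcov.liftHomotopy H f H0
  have hF : ∀ t a, bundleMap G (F (t, a)) = a.1.1 (loopParam t) := fun t a =>
    congrFun (hcov.liftHomotopy_lifts H f H0) (t, a)
  have hF0 : ∀ a, F (0, a) = a.1.2 := hcov.liftHomotopy_zero H f H0
  have hk : ∀ a, ∃ k : G, F (1, a) = k⁻¹ • F (0, a) := by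
    intro a
    have : bundleMap G (F (1, a)) = bundleMap G (F (0, a)) := by
      rw [hF, hF, loopParam_zero, loopParam_one]
    obtain ⟨k, hk⟩ := bundleMap_eq_iff.1 this
    -- The inverse appears because the right translation by `k` is the left action of `k⁻¹`.
    exact ⟨k⁻¹, by rw [inv_inv]; exact hk.symm⟩
  choose k hk using hk
  let F' : C(PointedLoops G, C(unitInterval, ESpace G)) :=
    (F.comp ContinuousMap.prodSwap).curry
  have hpath : ∀ a, (ofPath (k a) (F' a) (hk a)).path = F' a := fun a => path_ofPath _ _ _
  refine ⟨fun a => ofPath (k a) (F' a) (hk a), ?_, fun a => ⟨?_, ?_⟩⟩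
  · rw [continuous_iff_path]
    simp only [hpath]
    exact F'.continuous
  · ext z
    obtain ⟨t, rfl⟩ := loopParam_surjective z
    rw [← bundleMap_path, hpath]
    exact hF t a
  · rw [hpath]
    exact hF0 a

lemma loop_surjective [Finite G] : Function.Surjective (loop (G := G)) := by
  intro σ
  obtain ⟨Φ, -, hΦ⟩ := exists_lift (G := G)
  obtain ⟨e, he⟩ := bundleMap_surjective (σ 1)
  exact ⟨_, (hΦ ⟨(σ, e), he⟩).1⟩

/-- For a loop near that of `w`, the base point still lies in the open image of a small
neighbourhood of `w.path 0`. Lifting from a point of that neighbourhood gives an element of `O`. -/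
lemma isOpenMap_loop [Finite G] : IsOpenMap (loop (G := G)) := by
  obtain ⟨Φ, hc, hΦ⟩ := exists_lift (G := G)
  intro O hO
  obtain ⟨V, hV, hVO⟩ := isOpen_induced_iff.1 (hO.preimage hc)
  rw [isOpen_iff_mem_nhds]
  rintro _ ⟨w, hw, rfl⟩
  have hb : bundleMap G (w.path 0) = w.loop 1 := by rw [bundleMap_path, loopParam_zero]
  have hΦw : Φ ⟨(w.loop, w.path 0), hb⟩ = w := eq_of_loop_eq (hΦ _).1 (hΦ _).2
  have hmem : (w.loop, w.path 0) ∈ V := by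
    have : (⟨(w.loop, w.path 0), hb⟩ : PointedLoops G) ∈ Φ ⁻¹' O := by
      rw [Set.mem_preimage, hΦw]
      exact hw
    rwa [← hVO] at this
  obtain ⟨U₁, U₂, hU₁, hU₂, h₁, h₂, hU⟩ := isOpen_prod_iff.1 hV _ _ hmem
  have hp : IsOpen (bundleMap G '' U₂) :=
    (isQuotientCoveringMap_bundleMap (G := G)).isCoveringMap.isOpenMap _ hU₂
  have hev : Continuous fun σ : C(Circle, BSpace G) => σ 1 := continuous_eval_const 1
  refine Filter.mem_of_superset ((hU₁.inter (hp.preimage hev)).mem_nhds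
    ⟨h₁, w.path 0, h₂, hb⟩) ?_
  rintro σ ⟨hσ, e, he, hσe⟩
  refine ⟨Φ ⟨(σ, e), hσe⟩, ?_, (hΦ _).1⟩
  have : (⟨(σ, e), hσe⟩ : PointedLoops G) ∈ Subtype.val ⁻¹' V := hU ⟨hσ, he⟩
  rw [hVO] at this
  exact this

theorem isQuotientCoveringMap_loopCover [Finite G] : IsQuotientCoveringMap (loopCover G) G :=
  isQuotientCoveringMap_of_finite (E := LiftedLoops G)
    ((isOpenMap_loop (G := G)).isQuotientMap continuous_loop loop_surjective)
    loop_eq_iff fun _ _ => eq_one_of_smul_eq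

end LiftedLoops

/-! ### Homotopies of lifted loops -/

lemma IsOpenQuotientMap.exists_desc {P Q Z : Type*} [TopologicalSpace P] [TopologicalSpace Q]
    [TopologicalSpace Z] {q : C(P, Q)} (hq : IsOpenQuotientMap q) (f : C(P, Z))
    (h : ∀ a b, q a = q b → f a = f b) : ∃ g : C(Q, Z), ∀ a, g (q a) = f a :=
  ⟨hq.isQuotientMap.lift f fun a b => h a b,
    DFunLike.congr_fun (hq.isQuotientMap.lift_comp f fun a b => h a b)⟩

/-- Open quotient maps remain quotient maps after a product with the interval, so a fibre-preserving
homotopy descends. -/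
lemma IsOpenQuotientMap.homotopic_id {P Q : Type*} [TopologicalSpace P] [TopologicalSpace Q]
    {q : C(P, Q)} (hq : IsOpenQuotientMap q) (K : C(P × unitInterval, P))
    (hK : ∀ x x' t, q x = q x' → q (K (x, t)) = q (K (x', t))) (hK₁ : ∀ x, K (x, 1) = x)
    {k : C(Q, Q)} (hk : ∀ x, k (q x) = q (K (x, 0))) : k.Homotopic (ContinuousMap.id Q) := by
  have hq' : IsOpenQuotientMap (Prod.map q (id : unitInterval → unitInterval)) := hq.prodMap .id
  obtain ⟨g, hg⟩ := IsOpenQuotientMap.exists_desc (q := ⟨_, hq'.continuous⟩) hq' (q.comp K) (by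
    rintro ⟨a, s⟩ ⟨b, t⟩ h
    obtain rfl : s = t := congrArg Prod.snd h
    exact hK a b s (congrArg Prod.fst h))
  refine ⟨⟨g.comp ContinuousMap.prodSwap, fun x => ?_, fun x => ?_⟩⟩
  · obtain ⟨a, rfl⟩ := hq.surjective x
    exact (hg (a, 0)).trans (hk a).symm
  · obtain ⟨a, rfl⟩ := hq.surjective x
    exact (hg (a, 1)).trans (congrArg q (hK₁ a))

/-- Homotopy equivalences descend along open quotient maps. -/
theorem nonempty_homotopyEquiv_of_isOpenQuotientMap {X Y A B : Type*} [TopologicalSpace X]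
    [TopologicalSpace Y] [TopologicalSpace A] [TopologicalSpace B] {π : C(X, A)} {π' : C(Y, B)}
    (hπ : IsOpenQuotientMap π) (hπ' : IsOpenQuotientMap π') (Φ : C(Y, X)) (Ψ : C(X, Y))
    (hΦ : ∀ y y', π' y = π' y' → π (Φ y) = π (Φ y'))
    (hΨ : ∀ x x', π x = π x' → π' (Ψ x) = π' (Ψ x'))
    (H : C(X × unitInterval, X)) (hH₀ : ∀ x, H (x, 0) = Φ (Ψ x)) (hH₁ : ∀ x, H (x, 1) = x)
    (hH : ∀ x x' t, π x = π x' → π (H (x, t)) = π (H (x', t)))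
    (H' : C(Y × unitInterval, Y)) (hH₀' : ∀ y, H' (y, 0) = Ψ (Φ y)) (hH₁' : ∀ y, H' (y, 1) = y)
    (hH' : ∀ y y' t, π' y = π' y' → π' (H' (y, t)) = π' (H' (y', t))) :
    Nonempty (ContinuousMap.HomotopyEquiv A B) := by
  obtain ⟨φ, hφ⟩ := hπ'.exists_desc (π.comp Φ) hΦ
  obtain ⟨ψ, hψ⟩ := hπ.exists_desc (π'.comp Ψ) hΨ
  refine ⟨⟨ψ, φ, hπ.homotopic_id H hH hH₁ fun x => ?_, hπ'.homotopic_id H' hH' hH₁' fun y => ?_⟩⟩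
  · rw [hH₀, ContinuousMap.comp_apply, hψ, ContinuousMap.comp_apply, hφ]
    rfl
  · rw [hH₀', ContinuousMap.comp_apply, hφ, ContinuousMap.comp_apply, hψ]
    rfl

/-- Curry into `C(T, Z)`, where continuity is checked on each summand, and uncurry by local
compactness of `T`. -/
lemma continuous_sigma_prod {ι Z : Type*} {A : ι → Type*} [∀ i, TopologicalSpace (A i)]
    [TopologicalSpace Z] {T : Type*} [TopologicalSpace T] [LocallyCompactSpace T]
    {f : (Σ i, A i) × T → Z} (h : ∀ i, Continuous fun a : A i × T => f (⟨i, a.1⟩, a.2)) :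
    Continuous f := by
  let g : C(Σ i, A i, C(T, Z)) := ⟨fun a => ContinuousMap.curry ⟨_, h a.1⟩ a.2,
    continuous_sigma fun i => (ContinuousMap.curry ⟨_, h i⟩).continuous⟩
  exact g.uncurry.continuous

namespace LiftedLoops

open ESpace

variable {G : Type u} [Group G] [Finite G]

/-- The pointwise mixture of two lifted loops with the same holonomy. -/
noncomputable def mixLoop (w w' : LiftedLoops G) (h : w.hol = w'.hol) (s : unitInterval) :
    LiftedLoops G :=
  ofPath w.hol ⟨fun t => mix (w.path t) (w'.path t) s, continuous_mix.comp
    (w.path.continuous.prodMk (w'.path.continuous.prodMk continuous_const))⟩ (by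
      simp only [ContinuousMap.coe_mk, smul_mix]
      rw [path_one, path_one, h])

@[simp]
lemma path_mixLoop (w w' : LiftedLoops G) (h) (s t) :
    (mixLoop w w' h s).path t = mix (w.path t) (w'.path t) s := by
  rw [mixLoop, path_ofPath]
  rfl

@[simp]
lemma hol_mixLoop (w w' : LiftedLoops G) (h) (s) : (mixLoop w w' h s).hol = w.hol := hol_ofPath _ _ _

lemma continuous_mixLoop {Z : Type*} [TopologicalSpace Z] {F F' : Z → LiftedLoops G}
    {s : Z → unitInterval} (hF : Continuous F) (hF' : Continuous F') (hs : Continuous s)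
    (h : ∀ z, (F z).hol = (F' z).hol) : Continuous fun z => mixLoop (F z) (F' z) (h z) (s z) := by
  rw [continuous_iff_path_apply] at hF hF' ⊢
  simp only [path_mixLoop]
  exact continuous_mix.comp (hF.prodMk (hF'.prodMk (hs.comp continuous_fst)))

/-- The lifted loop with holonomy `k` that joins `e` to its right translate. -/
noncomputable def ofPoint (k : G) (e : ESpace G) : LiftedLoops G :=
  ofPath k ⟨fun t => mix e (k⁻¹ • e) t, continuous_mix.comp
    (continuous_const.prodMk (continuous_const.prodMk continuous_id))⟩ (by simp)

@[simp]
lemma path_ofPoint (k : G) (e : ESpace G) (t) : (ofPoint k e).path t = mix e (k⁻¹ • e) t := by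
  rw [ofPoint, path_ofPath]
  rfl

@[simp]
lemma hol_ofPoint (k : G) (e : ESpace G) : (ofPoint k e).hol = k := hol_ofPath _ _ _

lemma continuous_ofPoint (k : G) : Continuous (ofPoint k) := by
  rw [continuous_iff_path_apply]
  simp only [path_ofPoint]
  exact continuous_mix.comp (continuous_fst.prodMk
    (((continuous_const_smul k⁻¹).comp continuous_fst).prodMk continuous_snd))

omit [Finite G] in
lemma isOpen_hol_eq (k : G) : IsOpen {w | hol (G := G) w = k} := by
  refine isOpen_sigma_iff.2 fun j => ?_
  by_cases h : j = k
  · convert isOpen_univ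
    ext w
    exact iff_of_true h trivial
  · convert isOpen_empty
    ext w
    exact iff_of_false h id

/-! #### Comparison with the classifying spaces of the centralizers -/

omit [Finite G] in
-- Choose a representative of every coset $Cg$ and write $g$ as an element of $C$ times it; that
-- element is the value of the map.
lemma exists_equivariant_retraction (C : Subgroup G) :
    ∃ f : G → C, ∀ (c : C) (g : G), f (c * g) = c * f g := by
  let q : G → Quotient (QuotientGroup.rightRel C) := Quotient.mk _
  have h : ∀ g : G, g * (q g).out⁻¹ ∈ C := fun g => by
    rw [← QuotientGroup.rightRel_apply]
    exact Quotient.exact (Quotient.out_eq (q g))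
  refine ⟨fun g => ⟨_, h g⟩, fun c g => Subtype.ext ?_⟩
  have : q (c * g) = q g := Quotient.sound (by
    rw [← Quotient.eq_iff_equiv, Quotient.eq, QuotientGroup.rightRel_apply]
    simp)
  simp [this, mul_assoc]

/-- The part of the cover of lifted loops with holonomy `g`. -/
abbrev HolFiber (g : G) : Type u := {w : LiftedLoops G // w.hol = g}

lemma conj_of_loop_eq {w w' : LiftedLoops G} (h : w.loop = w'.loop) :
    ConjClasses.mk w.hol = ConjClasses.mk w'.hol := by
  obtain ⟨k, rfl⟩ := loop_eq_iff.1 h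
  rw [ConjClasses.mk_eq_mk_iff_isConj]
  exact (isConj_iff.2 ⟨k, (hol_smul k w').symm⟩).symm

/-- Deck transformations conjugate the holonomy, so one that keeps it equal to `g` commutes with
`g`. -/
lemma exists_centralizer_smul {g : G} {w w' : LiftedLoops G} (hw : w.hol = g) (hw' : w'.hol = g)
    (h : w.loop = w'.loop) : ∃ k : Subgroup.centralizer ({g} : Set G), w = (k : G) • w' := by
  obtain ⟨k, hk⟩ := loop_eq_iff.1 h
  refine ⟨⟨k, ?_⟩, hk.symm⟩
  rw [← hk] at hw
  change (k • w').hol = g at hw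
  rw [hol_smul, hw', mul_inv_eq_iff_eq_mul] at hw
  exact Subgroup.mem_centralizer_singleton_iff.2 hw

omit [Finite G] in
lemma centralizer_comm {g : G} (k : Subgroup.centralizer ({g} : Set G)) :
    (k : G) * g⁻¹ = g⁻¹ * k := by
  have := Subgroup.mem_centralizer_singleton_iff.1 k.2
  exact Commute.inv_right this

/-- The inclusion of `EC` into `EG`. -/
noncomputable def incl (C : Subgroup G) : C(ESpace C, ESpace G) := vertexMap (fun c : C => (c : G))

omit [Finite G] in
lemma incl_smul (C : Subgroup G) (k : C) (e : ESpace C) : incl C (k • e) = (k : G) • incl C e := by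
  change vertexMap _ (vertexMap _ e) = vertexMap _ (vertexMap _ e)
  rw [vertexMap_comp, vertexMap_comp]
  rfl

/-- An equivariant retraction of `EG` onto `EC`, up to homotopy. -/
noncomputable def retr (C : Subgroup G) : C(ESpace G, ESpace C) :=
  vertexMap (exists_equivariant_retraction C).choose

omit [Finite G] in
lemma retr_smul (C : Subgroup G) (k : C) (e : ESpace G) : retr C ((k : G) • e) = k • retr C e := by
  change vertexMap _ (vertexMap _ e) = vertexMap _ (vertexMap _ e)
  rw [vertexMap_comp, vertexMap_comp]
  congr 2
  funext x
  exact (exists_equivariant_retraction C).choose_spec k x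

/-- Since `k` commutes with `g⁻¹`, it translates both ends of the spliced path, hence the whole
path. -/
lemma ofPoint_smul {g : G} (k : Subgroup.centralizer ({g} : Set G)) (e : ESpace G) :
    ofPoint g ((k : G) • e) = (k : G) • ofPoint g e :=
  ext_path_apply fun t => by
    simp only [path_ofPoint, path_smul, smul_mix, ← mul_smul, centralizer_comm]

/-- The loop with holonomy `g` attached to a point of `EC(g)`. -/
noncomputable def toHolFiber (g : G) :
    C(ESpace (Subgroup.centralizer ({g} : Set G)), HolFiber g) :=
  ⟨fun e => ⟨ofPoint g (incl _ e), hol_ofPoint _ _⟩,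
    ((continuous_ofPoint g).comp (incl _).continuous).subtype_mk _⟩

/-- The point of `EC(g)` attached to a loop with holonomy `g`. -/
noncomputable def ofHolFiber (g : G) :
    C(HolFiber g, ESpace (Subgroup.centralizer ({g} : Set G))) :=
  ⟨fun w => retr _ (w.1.path 0), (retr _).continuous.comp
    ((continuous_path.comp continuous_subtype_val).eval continuous_const)⟩

/-- The homotopy from the composition to the identity of the loops with holonomy `g`. -/
noncomputable def holFiberHomotopy (g : G) : C(HolFiber g × unitInterval, HolFiber g) :=
  ⟨fun z => ⟨mixLoop (toHolFiber g (ofHolFiber g z.1)).1 z.1.1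
      ((toHolFiber g (ofHolFiber g z.1)).2.trans z.1.2.symm) z.2,
      (hol_mixLoop _ _ _ _).trans (toHolFiber g (ofHolFiber g z.1)).2⟩,
    (continuous_mixLoop (continuous_subtype_val.comp ((toHolFiber g).continuous.comp
      ((ofHolFiber g).continuous.comp continuous_fst))) (continuous_subtype_val.comp continuous_fst)
      continuous_snd _).subtype_mk _⟩

lemma path_holFiberHomotopy {g : G} (w : HolFiber g) (s t) :
    (holFiberHomotopy g (w, s)).1.path t =
      mix ((toHolFiber g (ofHolFiber g w)).1.path t) (w.1.path t) s :=
  path_mixLoop (toHolFiber g (ofHolFiber g w)).1 w.1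
    ((toHolFiber g (ofHolFiber g w)).2.trans w.2.symm) s t

/-- The homotopy from the composition to the identity of `EC(g)`. -/
noncomputable def centralizerHomotopy (g : G) :
    C(ESpace (Subgroup.centralizer ({g} : Set G)) × unitInterval,
      ESpace (Subgroup.centralizer ({g} : Set G))) :=
  ⟨fun z => mix (ofHolFiber g (toHolFiber g z.1)) z.1 z.2, continuous_mix.comp
    (((ofHolFiber g).continuous.comp ((toHolFiber g).continuous.comp continuous_fst)).prodMk
      (continuous_fst.prodMk continuous_snd))⟩

lemma loop_toHolFiber_smul {g : G} (k : Subgroup.centralizer ({g} : Set G)) (e) :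
    (toHolFiber g (k • e)).1 = (k : G) • (toHolFiber g e).1 := by
  change ofPoint g (incl _ (k • e)) = _
  rw [incl_smul, ofPoint_smul]
  rfl

omit [Finite G] in
lemma ofHolFiber_smul {g : G} (k : Subgroup.centralizer ({g} : Set G)) {w w' : HolFiber g}
    (h : w.1 = (k : G) • w'.1) : ofHolFiber g w = k • ofHolFiber g w' := by
  change retr _ (w.1.path 0) = _
  rw [h, path_smul, retr_smul]
  rfl

/-- The homotopy is a splicing of two equivariant expressions; this is what lets it descend to the
loops in $BG$. -/
lemma holFiberHomotopy_smul {g : G} (k : Subgroup.centralizer ({g} : Set G)) {w w' : HolFiber g}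
    (h : w.1 = (k : G) • w'.1) (t) :
    (holFiberHomotopy g (w, t)).1 = (k : G) • (holFiberHomotopy g (w', t)).1 := by
  refine ext_path_apply fun s => ?_
  have h₁ : (toHolFiber g (ofHolFiber g w)).1 = (k : G) • (toHolFiber g (ofHolFiber g w')).1 := by
    rw [ofHolFiber_smul k h, loop_toHolFiber_smul]
  simp only [path_holFiberHomotopy, path_smul, smul_mix, h₁, h]

lemma centralizerHomotopy_smul {g : G} (k : Subgroup.centralizer ({g} : Set G)) (e) (t) :
    centralizerHomotopy g (k • e, t) = k • centralizerHomotopy g (e, t) := by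
  simp only [centralizerHomotopy, ContinuousMap.coe_mk, smul_mix]
  rw [ofHolFiber_smul k (loop_toHolFiber_smul k e)]

variable (r : ConjClasses G → G)

/-- The restriction of the cover of lifted loops to the chosen holonomies. -/
noncomputable def restrictedCover : C(Σ c, HolFiber (r c), C(Circle, BSpace G)) :=
  ⟨fun w => w.2.1.loop, continuous_sigma fun _ => continuous_loop.comp continuous_subtype_val⟩

-- Translating a lift conjugates its holonomy to the chosen representative, whence surjectivity. The
-- map is open because the level sets of the holonomy are open in the cover.
include r in
lemma isOpenQuotientMap_restrictedCover (hr : ∀ c, ConjClasses.mk (r c) = c) :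
    IsOpenQuotientMap (restrictedCover r) where
  surjective σ := by
    obtain ⟨w, rfl⟩ := loop_surjective σ
    have h := hr (ConjClasses.mk w.hol)
    rw [ConjClasses.mk_eq_mk_iff_isConj] at h
    obtain ⟨k, hk⟩ := isConj_iff.1 h.symm
    exact ⟨⟨_, k • w, (hol_smul k w).trans hk⟩, loop_smul k w⟩
  continuous := (restrictedCover r).continuous
  isOpenMap := isOpenMap_sigma.2 fun c =>
    isOpenMap_loop.comp (isOpen_hol_eq (r c)).isOpenMap_subtype_val

lemma exists_eq_of_restrictedCover_eq (hr : ∀ c, ConjClasses.mk (r c) = c)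
    {a b : Σ c, HolFiber (r c)} (h : restrictedCover r a = restrictedCover r b) :
    ∃ (c : ConjClasses G) (w w' : HolFiber (r c))
      (k : Subgroup.centralizer ({r c} : Set G)), a = ⟨c, w⟩ ∧ b = ⟨c, w'⟩ ∧
        w.1 = (k : G) • w'.1 := by
  obtain ⟨c, w⟩ := a
  obtain ⟨c', w'⟩ := b
  have hc := conj_of_loop_eq h
  rw [w.2, w'.2, hr, hr] at hc
  subst hc
  obtain ⟨k, hk⟩ := exists_centralizer_smul w.2 w'.2 h
  exact ⟨c, w, w', k, rfl, rfl, hk⟩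

/-- The union of the universal bundles of the centralizers. -/
noncomputable def centralizerBundle :
    C(Σ c, ESpace (Subgroup.centralizer ({r c} : Set G)),
      Σ c, BSpace (Subgroup.centralizer ({r c} : Set G))) :=
  ⟨Sigma.map id fun _ => bundleMap _, Continuous.sigma_map fun _ => (bundleMap _).hom.continuous⟩

lemma isOpenQuotientMap_centralizerBundle : IsOpenQuotientMap (centralizerBundle r) where
  surjective := by
    rintro ⟨c, b⟩
    obtain ⟨e, rfl⟩ := bundleMap_surjective b
    exact ⟨⟨c, e⟩, rfl⟩
  continuous := (centralizerBundle r).continuous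
  isOpenMap := isOpenMap_sigma.2 fun c => isOpenMap_sigmaMk.comp
    (isQuotientCoveringMap_bundleMap
      (G := Subgroup.centralizer ({r c} : Set G))).isCoveringMap.isOpenMap

omit [Finite G] in
lemma exists_eq_of_centralizerBundle_eq {a b : Σ c, ESpace (Subgroup.centralizer ({r c} : Set G))}
    (h : centralizerBundle r a = centralizerBundle r b) :
    ∃ (c : ConjClasses G) (e : ESpace (Subgroup.centralizer ({r c} : Set G)))
      (k : Subgroup.centralizer ({r c} : Set G)), a = ⟨c, k • e⟩ ∧ b = ⟨c, e⟩ := by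
  obtain ⟨c, e⟩ := a
  obtain ⟨c', e'⟩ := b
  obtain rfl : c = c' := congrArg Sigma.fst h
  have h' : bundleMap _ e = bundleMap _ e' := eq_of_heq (Sigma.mk.inj h).2
  obtain ⟨k, rfl⟩ := bundleMap_eq_iff.1 h'
  exact ⟨c, e', k, rfl, rfl⟩

/-- The free loop space of `BG` is the union of the classifying spaces of the centralizers. -/
theorem nonempty_homotopyEquiv (hr : ∀ c, ConjClasses.mk (r c) = c) :
    Nonempty (ContinuousMap.HomotopyEquiv (freeLoopSpace (BSpace G))
      (Σ c : ConjClasses G, BSpace (Subgroup.centralizer ({r c} : Set G)))) := by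
  refine nonempty_homotopyEquiv_of_isOpenQuotientMap (π := restrictedCover r)
    (isOpenQuotientMap_restrictedCover r hr) (isOpenQuotientMap_centralizerBundle r)
    ⟨Sigma.map id fun c => toHolFiber (r c),
      Continuous.sigma_map fun c => (toHolFiber (r c)).continuous⟩
    ⟨Sigma.map id fun c => ofHolFiber (r c),
      Continuous.sigma_map fun c => (ofHolFiber (r c)).continuous⟩ ?_ ?_
    ⟨fun z => ⟨z.1.1, holFiberHomotopy _ (z.1.2, z.2)⟩, continuous_sigma_prod fun c =>
      continuous_sigmaMk.comp (holFiberHomotopy (r c)).continuous⟩ ?_ ?_ ?_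
    ⟨fun z => ⟨z.1.1, centralizerHomotopy _ (z.1.2, z.2)⟩, continuous_sigma_prod fun c =>
      continuous_sigmaMk.comp (centralizerHomotopy (r c)).continuous⟩ ?_ ?_ ?_
  · intro a b h
    obtain ⟨c, e, k, rfl, rfl⟩ := exists_eq_of_centralizerBundle_eq r h
    change (toHolFiber (r c) (k • e)).1.loop = (toHolFiber (r c) e).1.loop
    rw [loop_toHolFiber_smul, loop_smul]
  · intro a b h
    obtain ⟨c, w, w', k, rfl, rfl, hk⟩ := exists_eq_of_restrictedCover_eq r hr h
    refine Sigma.ext rfl (heq_of_eq ?_)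
    change bundleMap _ (ofHolFiber (r c) w) = bundleMap _ (ofHolFiber (r c) w')
    rw [ofHolFiber_smul k hk, bundleMap_smul]
  · rintro ⟨c, w⟩
    refine Sigma.ext rfl (heq_of_eq (Subtype.ext (ext_path_apply fun t => ?_)))
    exact (path_holFiberHomotopy w 0 t).trans (mix_zero _ _)
  · rintro ⟨c, w⟩
    refine Sigma.ext rfl (heq_of_eq (Subtype.ext (ext_path_apply fun t => ?_)))
    exact (path_holFiberHomotopy w 1 t).trans (mix_one _ _)
  · intro a b t h
    obtain ⟨c, w, w', k, rfl, rfl, hk⟩ := exists_eq_of_restrictedCover_eq r hr h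
    change (holFiberHomotopy (r c) (w, t)).1.loop = (holFiberHomotopy (r c) (w', t)).1.loop
    rw [holFiberHomotopy_smul k hk, loop_smul]
  · rintro ⟨c, e⟩
    exact Sigma.ext rfl (heq_of_eq (mix_zero _ _))
  · rintro ⟨c, e⟩
    exact Sigma.ext rfl (heq_of_eq (mix_one _ _))
  · intro a b t h
    obtain ⟨c, e, k, rfl, rfl⟩ := exists_eq_of_centralizerBundle_eq r h
    refine Sigma.ext rfl (heq_of_eq ?_)
    change bundleMap _ (centralizerHomotopy (r c) (k • e, t)) =
      bundleMap _ (centralizerHomotopy (r c) (e, t))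
    rw [centralizerHomotopy_smul, bundleMap_smul]

/-! #### The holonomy is a homotopy equivalence -/

instance : Nonempty (ESpace G) := ⟨point (n := 0) (fun _ => 1) (Classical.arbitrary _)⟩

/-- A section of the holonomy. -/
noncomputable def holonomySection (G : Type u) [Group G] [Finite G] :
    pointLoops G ⟶ TopCat.of (LiftedLoops G) :=
  TopCat.ofHom ⟨fun a => ofPoint a.1 (Classical.arbitrary (ESpace G)),
    continuous_of_discreteTopology⟩

lemma holonomySection_holonomy : holonomySection G ≫ holonomy G = 𝟙 _ := by
  refine TopCat.hom_ext (ContinuousMap.ext fun a => ?_)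
  exact OrbifoldLoops.ext (hol_ofPoint a.1 (Classical.arbitrary (ESpace G)))
    fun _ => Subsingleton.elim _ _

/-- The cover of lifted loops retracts onto the section of the holonomy. -/
noncomputable def holonomyHomotopy :
    TopCat.Homotopy (holonomy G ≫ holonomySection G) (𝟙 (TopCat.of (LiftedLoops G))) where
  toFun z := mixLoop (ofPoint z.2.hol (Classical.arbitrary (ESpace G))) z.2 (hol_ofPoint _ _) z.1
  continuous_toFun := by
    refine continuous_mixLoop (F := fun z : unitInterval × LiftedLoops G =>
      ofPoint z.2.hol (Classical.arbitrary (ESpace G))) ?_ continuous_snd continuous_fst _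
    exact ((holonomySection G).hom.continuous.comp (holonomy G).hom.continuous).comp continuous_snd
  map_zero_left w := ext_path_apply fun t => (path_mixLoop _ _ _ _ _).trans (mix_zero _ _)
  map_one_left w := ext_path_apply fun t => (path_mixLoop _ _ _ _ _).trans (mix_one _ _)

end LiftedLoops

/-! ### The transfer of a quotient covering -/

namespace Transfer

variable {E B : TopCat.{u}} {K : Type*} [Group K] [MulAction K E]
  {p : E ⟶ B}

/-- The action of a group element as a morphism of spaces. -/
def smulHom (E : TopCat.{u}) [MulAction K E] [ContinuousConstSMul K E] (k : K) : E ⟶ E :=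
  TopCat.ofHom ⟨(k • ·), continuous_const_smul k⟩

variable [ContinuousConstSMul K E]

/-- The translate of a lift of a simplex. -/
noncomputable def smulLift (hp : IsQuotientCoveringMap p K) {n : ℕ} (y : (TopCat.toSSet.obj E) _⦋n⦌)
    (k : K) : Lifts p ((TopCat.toSSet.map p).app _ y) :=
  ⟨(TopCat.toSSet.map (smulHom E k)).app _ y, simplex_ext fun _ => hp.map_smul k⟩

/-- A lift is determined by its value at one point of the simplex, and `K` permutes the fibre there
freely and transitively. -/
lemma smulLift_bijective (hp : IsQuotientCoveringMap p K) {n : ℕ}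
    (y : (TopCat.toSSet.obj E) _⦋n⦌) : Function.Bijective (smulLift hp y) := by
  let a : SimplexCategory.toTop.{u}.obj ⦋n⦌ := Classical.arbitrary _
  have := hp.isCancelSMul
  constructor
  · intro k l h
    have h' : k • simplexMap y a = l • simplexMap y a := congrArg (fun z => simplexMap z.1 a) h
    exact IsCancelSMul.right_cancel _ _ _ h'
  · intro z
    have hz : p (simplexMap z.1 a) = p (simplexMap y a) := simplexMap_lift p z a
    obtain ⟨k, hk⟩ := hp.apply_eq_iff_mem_orbit.1 hz
    exact ⟨k, lifts_eq p hp.isCoveringMap _ _ a hk⟩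

omit [ContinuousConstSMul K E] in
lemma exists_lifts (hp : IsQuotientCoveringMap p K) {n : ℕ} (x : (TopCat.toSSet.obj B) _⦋n⦌) :
    ∃ y : (TopCat.toSSet.obj E) _⦋n⦌, (TopCat.toSSet.map p).app _ y = x := by
  let a : SimplexCategory.toTop.{u}.obj ⦋n⦌ := Classical.arbitrary _
  obtain ⟨e, he⟩ := hp.surjective (simplexMap x a)
  obtain ⟨F, ⟨-, hF⟩, -⟩ := hp.isCoveringMap.existsUnique_continuousMap_lifts (simplexMap x) a e
    he
  exact ⟨mkSimplex F, simplex_ext fun t => congrFun hF t⟩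

/-- The map of singular chains induced by a continuous map. -/
noncomputable abbrev chainsMap {X Y : TopCat.{u}} (f : X ⟶ Y) : chains X ⟶ chains Y :=
  SSet.chainComplexMap (TopCat.toSSet.map f) coeffs

/-- The lifts of the image of a simplex `y` are its translates, each occurring once. -/
lemma chainsMap_transferChain [Fintype K] (hp : IsQuotientCoveringMap p K)
    (hf : ∀ b, Finite (p ⁻¹' {b})) :
    chainsMap p ≫ transferChain p hp.isCoveringMap hf = ∑ k : K, chainsMap (smulHom E k) := by
  ext n : 1
  apply SSet.chainComplex_hom_ext
  intro y
  have := @Fintype.ofFinite _ (finite_lifts p hp.isCoveringMap hf ((TopCat.toSSet.map p).app _ y))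
  rw [HomologicalComplex.comp_f, SSet.ι_chainComplexMap_f_assoc]
  refine (ι_transferX p hp.isCoveringMap hf n _).trans ?_
  have hsum : (∑ k : K, chainsMap (smulHom E k)).f n = ∑ k : K, (chainsMap (smulHom E k)).f n :=
    (HomologicalComplex.eval (ModuleCat.{u} ℂ) (ComplexShape.down ℕ) n).map_sum
      (fun k : K => chainsMap (smulHom E k)) _
  rw [hsum, Preadditive.comp_sum]
  refine (Fintype.sum_bijective _ (smulLift_bijective hp y) _ _ fun k => ?_).symm
  rw [SSet.ι_chainComplexMap_f]
  rfl

/-- Every simplex of the base has exactly one lift for each element of `K`, and all of them project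
back to it. -/
lemma transferChain_chainsMap [Finite K] (hp : IsQuotientCoveringMap p K)
    (hf : ∀ b, Finite (p ⁻¹' {b})) :
    transferChain p hp.isCoveringMap hf ≫ chainsMap p = Nat.card K • 𝟙 (chains B) := by
  ext n : 1
  apply SSet.chainComplex_hom_ext
  intro x
  obtain ⟨y, rfl⟩ := exists_lifts hp x
  have hK : Fintype K := Fintype.ofFinite K
  have := @Fintype.ofFinite _ (finite_lifts p hp.isCoveringMap hf ((TopCat.toSSet.map p).app _ y))
  rw [HomologicalComplex.comp_f, ← Category.assoc]
  refine (congrArg (· ≫ (chainsMap p).f n) (ι_transferX p hp.isCoveringMap hf n _)).trans ?_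
  rw [Preadditive.sum_comp, HomologicalComplex.nsmul_f_apply, Preadditive.comp_nsmul,
    HomologicalComplex.id_f, Category.comp_id]
  refine (Fintype.sum_bijective _ (smulLift_bijective hp y) (fun _ =>
    SSet.ιChainComplex (R := coeffs) (TopCat.toSSet.obj B) ((TopCat.toSSet.map p).app _ y)) _
    fun k => ?_).symm.trans ?_
  · rw [SSet.ι_chainComplexMap_f, (smulLift hp y k).2]
  · rw [Finset.sum_const, Finset.card_univ, Nat.card_eq_fintype_card]

/-- The map induced in homology in one degree. -/
noncomputable def HnMap (n : ℕ) {X Y : TopCat.{u}} (f : X ⟶ Y) : Hn n X ⟶ Hn n Y :=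
  ((singularHomologyFunctor (ModuleCat.{u} ℂ) n).obj coeffs).map f

lemma HnMap_transferHn_apply [Finite K] (n : ℕ) (hp : IsQuotientCoveringMap p K)
    (hf : ∀ b, Finite (p ⁻¹' {b}))
    (z : Hn n B) : (HnMap n p).hom (transferHn p hp.isCoveringMap hf n z) = (Nat.card K : ℂ) • z := by
  have h := congrArg (fun f : chains B ⟶ chains B => (HomologicalComplex.homologyMap f n).hom z)
    (transferChain_chainsMap hp hf)
  refine Eq.trans ?_ (h.trans ?_)
  · simp only [HomologicalComplex.homologyMap_comp]
    rfl
  · have h' : HomologicalComplex.homologyMap (Nat.card K • 𝟙 (chains B)) n =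
        Nat.card K • 𝟙 ((chains B).homology n) := by
      have := (HomologicalComplex.homologyFunctor (ModuleCat.{u} ℂ) (ComplexShape.down ℕ) n).map_nsmul
        (f := 𝟙 (chains B)) (n := Nat.card K)
      rw [CategoryTheory.Functor.map_id] at this
      exact this
    have h'' : ∀ w : (chains B).homology n,
        (Nat.card K • 𝟙 ((chains B).homology n)).hom w = (Nat.card K : ℂ) • w := fun w => by
      rw [ModuleCat.hom_nsmul, LinearMap.smul_apply, Nat.cast_smul_eq_nsmul]
      rfl
    exact (congrArg (fun f : (chains B).homology n ⟶ (chains B).homology n => f.hom z) h').trans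
      (h'' z)

lemma transferHn_HnMap_apply [Fintype K] (n : ℕ) (hp : IsQuotientCoveringMap p K)
    (hf : ∀ b, Finite (p ⁻¹' {b})) (z : Hn n E) :
    transferHn p hp.isCoveringMap hf n ((HnMap n p).hom z) =
      ∑ k : K, (HnMap n (smulHom E k)).hom z := by
  have h := congrArg (fun f : chains E ⟶ chains E => (HomologicalComplex.homologyMap f n).hom z)
    (chainsMap_transferChain hp hf)
  refine Eq.trans ?_ (h.trans ?_)
  · simp only [HomologicalComplex.homologyMap_comp]
    rfl
  · have h' : HomologicalComplex.homologyMap (∑ k : K, chainsMap (smulHom E k)) n =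
        ∑ k : K, HomologicalComplex.homologyMap (chainsMap (smulHom E k)) n :=
      (HomologicalComplex.homologyFunctor (ModuleCat.{u} ℂ) (ComplexShape.down ℕ) n).map_sum
        (fun k : K => chainsMap (smulHom E k)) _
    have h'' : ∀ w : (chains E).homology n,
        (∑ k : K, HomologicalComplex.homologyMap (chainsMap (smulHom E k)) n).hom w =
          ∑ k : K, (HomologicalComplex.homologyMap (chainsMap (smulHom E k)) n).hom w := fun w => by
      rw [ModuleCat.hom_sum, LinearMap.sum_apply]
    exact (congrArg (fun f : (chains E).homology n ⟶ (chains E).homology n => f.hom z) h').trans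
      (h'' z)

end Transfer

/-! ### Degree-zero homology of discrete spaces and point coefficients -/

namespace Transfer

section Discrete

variable (P : TopCat.{u}) [TotallyDisconnectedSpace P]

/-- The chains of a totally disconnected space. -/
noncomputable abbrev discreteChainsIso :
    chains P ≅ ChainComplex.alternatingConst.obj (∐ fun _ : P ↦ coeffs.{u}) :=
  singularChainComplexFunctorIsoOfTotallyDisconnectedSpace (ModuleCat.{u} ℂ) coeffs P

lemma toSSetIsoConst_hom_app (x : (TopCat.toSSet.obj P) _⦋0⦌)
    (t : SimplexCategory.toTop.{u}.obj ⦋0⦌) :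
    (TopCat.toSSetIsoConst P).hom.app _ x = simplexMap x t :=
  TotallyDisconnectedSpace.eq_of_continuous _ (simplexMap x).continuous _ _

lemma ι_discreteChainsIso (x : (TopCat.toSSet.obj P) _⦋0⦌)
    (t : SimplexCategory.toTop.{u}.obj ⦋0⦌) :
    SSet.ιChainComplex (R := coeffs) (TopCat.toSSet.obj P) x ≫ (discreteChainsIso P).hom.f 0 =
      Sigma.ι (fun _ : P => coeffs.{u}) (simplexMap x t) := by
  have h : (discreteChainsIso P).hom.f 0 =
      ((sigmaConst.obj coeffs.{u}).map ((TopCat.toSSetIsoConst P).hom.app _) : _ ⟶ _) := by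
    -- The degree-zero component of the composite isomorphism is definitionally this map followed by
    -- two identities.
    refine Eq.trans (b := ((sigmaConst.obj coeffs.{u}).map
      ((TopCat.toSSetIsoConst P).hom.app _) ≫ 𝟙 _) ≫ 𝟙 _) rfl ?_
    rw [Category.comp_id, Category.comp_id]
  rw [h, ← toSSetIsoConst_hom_app]
  exact (Sigma.ι_desc _ _).trans (Category.id_comp _)

/-- On cycles, the identification of $H_0$ is that of 0-chains with the free module on the points;
this allows computing it on simplices. -/
lemma homologyπ_discrete :
    (chains P).homologyπ 0 ≫
      (singularHomologyFunctorZeroOfTotallyDisconnectedSpace (ModuleCat.{u} ℂ) coeffs P).hom =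
    (chains P).iCycles 0 ≫ (discreteChainsIso P).hom.f 0 := by
  have h1 : (singularHomologyFunctorZeroOfTotallyDisconnectedSpace (ModuleCat.{u} ℂ) coeffs P).hom
    = HomologicalComplex.homologyMap (discreteChainsIso P).hom 0 ≫
      (ChainComplex.alternatingConstHomologyZero (∐ fun _ : P ↦ coeffs.{u})).hom := rfl
  have h2 : (ChainComplex.alternatingConst.obj (∐ fun _ : P ↦ coeffs.{u})).homologyπ 0 ≫
     (ChainComplex.alternatingConstHomologyZero (∐ fun _ : P ↦ coeffs.{u})).hom =
     (ChainComplex.alternatingConst.obj (∐ fun _ : P ↦ coeffs.{u})).iCycles 0 := by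
    have := (ChainComplex.alternatingConstHomologyDataZero (∐ fun _ : P ↦ coeffs.{u}) 0 rfl).left.homologyπ_comp_homologyIso_hom
    refine this.trans ?_
    refine Eq.trans ?_ (ChainComplex.alternatingConstHomologyDataZero (∐ fun _ : P ↦ coeffs.{u}) 0 rfl).left.cyclesIso_hom_comp_i
    rfl
  rw [h1]
  refine (HomologicalComplex.homologyπ_naturality_assoc _ _ _).trans ?_
  exact (congrArg (HomologicalComplex.cyclesMap (discreteChainsIso P).hom 0 ≫ ·) h2).trans
    (HomologicalComplex.cyclesMap_i _ _)

/-- The degree zero homology of a totally disconnected space is free on its points. -/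
noncomputable abbrev discreteHnIso : Hn 0 P ≅ ∐ fun _ : P ↦ coeffs.{u} :=
  singularHomologyFunctorZeroOfTotallyDisconnectedSpace (ModuleCat.{u} ℂ) coeffs P

-- Since cycles surject onto homology, it is enough to compare the two maps on 0-simplices, that is,
-- on points.
variable {P} in
lemma discreteHnIso_naturality {Q : TopCat.{u}} [TotallyDisconnectedSpace Q] (f : P ⟶ Q) :
    HnMap 0 f ≫ (discreteHnIso Q).hom =
      (discreteHnIso P).hom ≫ Sigma.desc fun b : P => Sigma.ι (fun _ : Q => coeffs.{u}) (f b) := by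
  refine (cancel_epi ((chains P).homologyπ 0)).1 ?_
  refine (HomologicalComplex.homologyπ_naturality_assoc (chainsMap f) 0 _).trans ?_
  refine (congrArg _ (homologyπ_discrete Q)).trans ?_
  refine (HomologicalComplex.cyclesMap_i_assoc (chainsMap f) 0 _).trans ?_
  refine Eq.trans ?_ (congrArg (· ≫ Sigma.desc _) (homologyπ_discrete P)).symm
  refine Eq.trans ?_ (Category.assoc _ _ _).symm
  refine congrArg _ ?_
  apply SSet.chainComplex_hom_ext
  intro x
  let t : SimplexCategory.toTop.{u}.obj ⦋0⦌ := Classical.arbitrary _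
  refine (SSet.ι_chainComplexMap_f_assoc _ _ _ coeffs x _).trans ?_
  refine (ι_discreteChainsIso Q _ t).trans ?_
  refine Eq.trans ?_ (congrArg (· ≫ Sigma.desc _) (ι_discreteChainsIso P x t)).symm
  exact (Sigma.ι_desc (fun b : P => Sigma.ι (fun _ : Q => coeffs.{u}) (f b)) _).symm

end Discrete

section Coefficients

variable {P : TopCat.{u}} [DiscreteTopology P]

open Classical in
lemma pointCoeff_apply (a : P) (z : TotalHomology P) :
    pointCoeff a z = (((discreteHnIso P).hom ≫
      Sigma.desc fun b : P => if b = a then 𝟙 (coeffs.{u}) else 0).hom (z 0)).down := rfl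

/-- The homology class of a point, times a scalar. -/
noncomputable def pointClass (b : P) (c : ℂ) : TotalHomology P :=
  DirectSum.lof ℂ ℕ (fun n => Hn n P) 0
    ((Sigma.ι (fun _ : P => coeffs.{u}) b ≫ (discreteHnIso P).inv).hom ⟨c⟩)

open Classical in
lemma pointCoeff_pointClass (a b : P) (c : ℂ) :
    pointCoeff a (pointClass b c) = if b = a then c else 0 := by
  rw [pointCoeff_apply, pointClass, DirectSum.lof_apply, ← LinearMap.comp_apply,
    ← ModuleCat.hom_comp]
  simp only [Category.assoc, Iso.inv_hom_id_assoc]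
  rw [Sigma.ι_desc]
  split_ifs <;> rfl

lemma eq_of_pointCoeff [Finite P] {z w : TotalHomology P}
    (h : ∀ a, pointCoeff a z = pointCoeff a w) : z = w := by
  classical
  have := Fintype.ofFinite P
  refine DFinsupp.ext fun n => ?_
  by_cases hn : n = 0
  · subst hn
    -- For finite `P` the coproduct is a biproduct, so the coefficients determine a class in degree
    -- zero.
    have hid : 𝟙 (∐ fun _ : P ↦ coeffs.{u}) = ∑ a : P,
        (Sigma.desc fun b : P => if b = a then 𝟙 (coeffs.{u}) else 0) ≫
          Sigma.ι (fun _ : P => coeffs.{u}) a := by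
      refine Sigma.hom_ext _ _ fun b => ?_
      rw [Category.comp_id, Preadditive.comp_sum, Finset.sum_eq_single b]
      · rw [Sigma.ι_desc_assoc, if_pos rfl, Category.id_comp]
      · intro a _ hab
        rw [Sigma.ι_desc_assoc, if_neg hab.symm, zero_comp]
      · simp
    have hz : ∀ z : Hn 0 P, (discreteHnIso P).hom.hom z = ∑ a : P,
        (Sigma.ι (fun _ : P => coeffs.{u}) a).hom (((discreteHnIso P).hom ≫
      Sigma.desc fun b : P => if b = a then 𝟙 (coeffs.{u}) else 0).hom z) := by
      intro z
      have := congrArg (fun f => f.hom ((discreteHnIso P).hom.hom z)) hid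
      refine this.trans ?_
      simp [ModuleCat.hom_sum]
    have hinj : Function.Injective (discreteHnIso P).hom.hom := by
      intro x y hxy
      have := congrArg (discreteHnIso P).inv.hom hxy
      simpa using this
    apply hinj
    rw [hz, hz]
    refine Finset.sum_congr rfl fun a _ => congrArg _ (ULift.ext _ _ (h a))
  · have := ModuleCat.subsingleton_of_isZero
      (isZero_singularHomologyFunctor_of_totallyDisconnectedSpace (ModuleCat.{u} ℂ) n coeffs P hn)
    exact Subsingleton.elim _ _

/-- By injectivity only the point `b` contributes to the coefficient of its image. -/
lemma pointCoeff_homologyMap {Q : TopCat.{u}} [DiscreteTopology Q] (f : P ⟶ Q)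
    (hf : Function.Injective f) (b : P) (z : TotalHomology P) :
    pointCoeff (f b) (homologyMap f z) = pointCoeff b z := by
  classical
  rw [pointCoeff_apply, pointCoeff_apply]
  have h0 : homologyMap f z 0 = (HnMap 0 f).hom (z 0) := DirectSum.lmap_apply _ _ _
  rw [h0, ← LinearMap.comp_apply, ← ModuleCat.hom_comp, ← Category.assoc,
    discreteHnIso_naturality, Category.assoc]
  have : (Sigma.desc fun b : P => Sigma.ι (fun _ : Q => coeffs.{u}) (f b)) ≫
      (Sigma.desc fun c : Q => if c = f b then 𝟙 (coeffs.{u}) else 0) =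
      Sigma.desc fun c : P => if c = b then 𝟙 (coeffs.{u}) else 0 := by
    refine Sigma.hom_ext _ _ fun c => ?_
    rw [Sigma.ι_desc_assoc, Sigma.ι_desc, Sigma.ι_desc]
    simp only [hf.eq_iff]
  rw [this]

end Coefficients

end Transfer

/-! ### Functoriality of total homology -/

namespace Transfer

lemma HnMap_comp_apply (n : ℕ) {X Y Z : TopCat.{u}} (f : X ⟶ Y) (g : Y ⟶ Z) (z : Hn n X) :
    (HnMap n (f ≫ g)).hom z = (HnMap n g).hom ((HnMap n f).hom z) := by
  rw [HnMap, Functor.map_comp]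
  rfl

lemma HnMap_id_apply (n : ℕ) {X : TopCat.{u}} (z : Hn n X) : (HnMap n (𝟙 X)).hom z = z := by
  rw [HnMap, CategoryTheory.Functor.map_id]
  rfl

lemma HnMap_eq_of_homotopy (n : ℕ) {X Y : TopCat.{u}} {f g : X ⟶ Y} (H : TopCat.Homotopy f g) :
    HnMap n f = HnMap n g :=
  H.congr_homologyMap_singularChainComplexFunctor coeffs n

end Transfer

lemma homologyMap_apply {X Y : TopCat.{u}} (f : X ⟶ Y) (z : TotalHomology X) (n : ℕ) :
    homologyMap f z n = (Transfer.HnMap n f).hom (z n) := DirectSum.lmap_apply _ _ _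

lemma homologyMap_comp_apply {X Y Z : TopCat.{u}} (f : X ⟶ Y) (g : Y ⟶ Z) (z : TotalHomology X) :
    homologyMap (f ≫ g) z = homologyMap g (homologyMap f z) := by
  refine DFinsupp.ext fun n => ?_
  rw [homologyMap_apply, homologyMap_apply, homologyMap_apply, Transfer.HnMap_comp_apply]

lemma homologyMap_id_apply {X : TopCat.{u}} (z : TotalHomology X) : homologyMap (𝟙 X) z = z := by
  refine DFinsupp.ext fun n => ?_
  rw [homologyMap_apply, Transfer.HnMap_id_apply]

lemma homologyMap_eq_of_homotopy {X Y : TopCat.{u}} {f g : X ⟶ Y} (H : TopCat.Homotopy f g) :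
    homologyMap f = homologyMap g := by
  refine LinearMap.ext fun z => DFinsupp.ext fun n => ?_
  rw [homologyMap_apply, homologyMap_apply, Transfer.HnMap_eq_of_homotopy n H]

namespace Transfer

variable {E B : TopCat.{u}} {K : Type*} [Group K] [MulAction K E] [ContinuousConstSMul K E]
  {p : E ⟶ B}

lemma transfer_apply (hp : IsCoveringMap p) (hf : ∀ b, Finite (p ⁻¹' {b})) (z : TotalHomology B)
    (n : ℕ) : transfer p hp hf z n = transferHn p hp hf n (z n) := DirectSum.lmap_apply _ _ _

lemma homologyMap_transfer [Finite K] (hp : IsQuotientCoveringMap p K)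
    (hf : ∀ b, Finite (p ⁻¹' {b})) (z : TotalHomology B) :
    homologyMap p (transfer p hp.isCoveringMap hf z) = (Nat.card K : ℂ) • z := by
  refine DFinsupp.ext fun n => ?_
  rw [homologyMap_apply, transfer_apply]
  exact HnMap_transferHn_apply n hp hf (z n)

lemma transfer_homologyMap [Fintype K] (hp : IsQuotientCoveringMap p K)
    (hf : ∀ b, Finite (p ⁻¹' {b})) (z : TotalHomology E) :
    transfer p hp.isCoveringMap hf (homologyMap p z) =
      ∑ k : K, homologyMap (smulHom E k) z := by
  refine DFinsupp.ext fun n => ?_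
  rw [transfer_apply, homologyMap_apply]
  refine (transferHn_HnMap_apply n hp hf (z n)).trans ?_
  refine Eq.trans ?_ (map_sum (DirectSum.component ℂ ℕ (fun n => Hn n E) n) _ _).symm
  exact Finset.sum_congr rfl fun k _ => (homologyMap_apply _ _ _).symm

end Transfer

/-! ### The homology of the loop space -/

namespace LiftedLoops

variable {G : Type u} [Group G]

lemma homologyMap_holonomy_bijective [Finite G] :
    Function.Bijective (homologyMap (holonomy G)) := by
  refine Function.bijective_iff_has_inverse.2 ⟨homologyMap (holonomySection G), fun z => ?_,
    fun z => ?_⟩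
  · rw [← homologyMap_comp_apply, homologyMap_eq_of_homotopy holonomyHomotopy, homologyMap_id_apply]
  · rw [← homologyMap_comp_apply, holonomySection_holonomy, homologyMap_id_apply]

lemma loopCover_isCoveringMap [Finite G] : IsCoveringMap (loopCover G) :=
  isQuotientCoveringMap_loopCover.isCoveringMap

lemma finite_fiber [Finite G] (σ) : Finite (loopCover G ⁻¹' {σ}) := by
  obtain ⟨w, hw⟩ := isQuotientCoveringMap_loopCover (G := G).surjective σ
  refine Finite.of_surjective (fun k : G => (⟨k • w, ?_⟩ : loopCover G ⁻¹' {σ})) ?_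
  · exact (isQuotientCoveringMap_loopCover.map_smul k).trans hw
  · rintro ⟨v, hv⟩
    obtain ⟨k, hk⟩ := isQuotientCoveringMap_loopCover.apply_eq_iff_mem_orbit.1
      ((show loopCover G v = σ from hv).trans hw.symm)
    exact ⟨k, Subtype.ext hk⟩

/-- Multiplication by $|G|$ factors through the homology of the lifted loops, which vanishes here as
they are homotopy equivalent to a discrete space; $|G|$ is invertible in $\mathbb C$. -/
lemma subsingleton_Hn [Finite G] {n : ℕ} (hn : n ≠ 0) :
    Subsingleton (Hn n (freeLoopSpace (BSpace G))) := by
  refine subsingleton_of_forall_eq 0 fun z => ?_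
  have h := Transfer.HnMap_transferHn_apply n isQuotientCoveringMap_loopCover finite_fiber z
  have hc : (Nat.card G : ℂ) ≠ 0 := Nat.cast_ne_zero.2 Nat.card_pos.ne'
  have hP := ModuleCat.subsingleton_of_isZero
    (isZero_singularHomologyFunctor_of_totallyDisconnectedSpace (ModuleCat.{u} ℂ) n coeffs
      (pointLoops G) hn)
  have hW : ∀ w : Hn n (TopCat.of (LiftedLoops G)), w = 0 := fun w => by
    rw [← Transfer.HnMap_id_apply n w, ← Transfer.HnMap_eq_of_homotopy n holonomyHomotopy,
      Transfer.HnMap_comp_apply, Subsingleton.elim ((Transfer.HnMap n (holonomy G)).hom w) 0,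
      map_zero]
  rw [hW (transferHn _ _ _ _ z), map_zero] at h
  exact (smul_eq_zero.1 h.symm).resolve_left hc

/-- Conjugation on the orbifold loops of the point. -/
def conjHom (k : G) : pointLoops G ⟶ pointLoops G :=
  TopCat.ofHom ⟨fun a => OrbifoldLoops.star (k * a.1 * k⁻¹), continuous_of_discreteTopology⟩

lemma smulHom_holonomy [Finite G] (k : G) :
    Transfer.smulHom (TopCat.of (LiftedLoops G)) k ≫ holonomy G = holonomy G ≫ conjHom k :=
  TopCat.hom_ext (ContinuousMap.ext fun w => congrArg OrbifoldLoops.star (hol_smul k w))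

end LiftedLoops

/-! ### Homology of the orbifold loops of the point and the group algebra -/

namespace PointLoops

variable {G : Type u} [Group G]

lemma star_surjective : Function.Surjective (OrbifoldLoops.star (G := G)) := fun a =>
  ⟨a.1, OrbifoldLoops.ext rfl fun _ => Subsingleton.elim _ _⟩

lemma star_injective : Function.Injective (OrbifoldLoops.star (G := G)) := fun _ _ h =>
  congrArg Sigma.fst h

lemma eq_star (a : OrbifoldLoops G PUnit.{u + 1}) : a = OrbifoldLoops.star a.1 :=
  OrbifoldLoops.ext rfl fun _ => Subsingleton.elim _ _

/-- The coefficient of `⋆_g` in a homology class. -/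
noncomputable abbrev coeff (g : G) : TotalHomology (pointLoops G) →ₗ[ℂ] ℂ :=
  pointCoeff (P := pointLoops G) (OrbifoldLoops.star g)

lemma coeff_homologyMap_concatLeft (g h : G) (z : TotalHomology (pointLoops G)) :
    coeff (g * h) (homologyMap (concatLeft g) z) = coeff h z := by
  have h₁ : (concatLeft g : pointLoops G ⟶ pointLoops G) (OrbifoldLoops.star h) =
      OrbifoldLoops.star (g * h) := OrbifoldLoops.ext rfl fun _ => Subsingleton.elim _ _
  rw [coeff, ← h₁]
  refine Transfer.pointCoeff_homologyMap (P := pointLoops G) (Q := pointLoops G) _ ?_ _ _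
  intro a b hab
  have h₂ : g * a.1 = g * b.1 := congrArg Sigma.fst hab
  rw [eq_star a, eq_star b, mul_left_cancel h₂]

lemma coeff_homologyMap_conjHom (k h : G) (z : TotalHomology (pointLoops G)) :
    coeff (k * h * k⁻¹) (homologyMap (LiftedLoops.conjHom k) z) = coeff h z := by
  have h₁ : (LiftedLoops.conjHom k : pointLoops G ⟶ pointLoops G) (OrbifoldLoops.star h) =
      OrbifoldLoops.star (k * h * k⁻¹) := rfl
  rw [coeff, ← h₁]
  refine Transfer.pointCoeff_homologyMap (P := pointLoops G) (Q := pointLoops G) _ ?_ _ _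
  intro a b hab
  have h₂ : k * a.1 * k⁻¹ = k * b.1 * k⁻¹ := congrArg Sigma.fst hab
  rw [eq_star a, eq_star b, mul_left_cancel (mul_right_cancel h₂)]

instance [Finite G] : Finite (pointLoops G) := Finite.of_surjective _ star_surjective

variable [Fintype G]

/-- The element of the group algebra with the coefficients of a homology class. -/
noncomputable def toAlgebra : TotalHomology (pointLoops G) →ₗ[ℂ] MonoidAlgebra ℂ G :=
  ∑ g : G, MonoidAlgebra.lsingle g ∘ₗ coeff g

lemma toAlgebra_coeff (z : TotalHomology (pointLoops G)) (g : G) :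
    (toAlgebra z).coeff g = coeff g z := by
  classical
  simp [toAlgebra, Finsupp.single_apply]

lemma toAlgebra_injective : Function.Injective (toAlgebra (G := G)) := fun z w h =>
  Transfer.eq_of_pointCoeff fun a => by
    obtain ⟨g, rfl⟩ := star_surjective a
    rw [← toAlgebra_coeff, ← toAlgebra_coeff, h]

lemma toAlgebra_surjective : Function.Surjective (toAlgebra (G := G)) := fun a => by
  classical
  refine ⟨∑ g : G, Transfer.pointClass (P := pointLoops G) (OrbifoldLoops.star g) (a.coeff g), ?_⟩
  ext g
  rw [toAlgebra_coeff, map_sum]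
  simp [Transfer.pointCoeff_pointClass, star_injective.eq_iff]

lemma toAlgebra_concatLeft (g : G) (z : TotalHomology (pointLoops G)) :
    toAlgebra (homologyMap (concatLeft g) z) = MonoidAlgebra.single g 1 * toAlgebra z := by
  ext h
  obtain ⟨h, rfl⟩ : ∃ h', h = g * h' := ⟨g⁻¹ * h, by simp⟩
  rw [toAlgebra_coeff, coeff_homologyMap_concatLeft, MonoidAlgebra.coeff_single_mul_apply,
    toAlgebra_coeff]
  simp

lemma toAlgebra_conjHom (k : G) (z : TotalHomology (pointLoops G)) :
    toAlgebra (homologyMap (LiftedLoops.conjHom k) z) =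
      MonoidAlgebra.single k 1 * toAlgebra z * MonoidAlgebra.single k⁻¹ 1 := by
  ext h
  obtain ⟨h, rfl⟩ : ∃ h', h = k * h' * k⁻¹ := ⟨k⁻¹ * h * k, by simp [mul_assoc]⟩
  rw [toAlgebra_coeff, coeff_homologyMap_conjHom, MonoidAlgebra.coeff_mul_single_apply,
    MonoidAlgebra.coeff_single_mul_apply, toAlgebra_coeff]
  simp [mul_assoc]

lemma toAlgebra_pointProduct (x y : TotalHomology (pointLoops G)) :
    toAlgebra (pointProduct G x y) = toAlgebra x * toAlgebra y := by
  have hx : toAlgebra x = ∑ g : G, coeff g x • MonoidAlgebra.single g (1 : ℂ) := by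
    simp [toAlgebra]
  rw [hx, Finset.sum_mul]
  simp only [pointProduct, LinearMap.sum_apply, LinearMap.smulRight_apply, LinearMap.smul_apply,
    map_sum, map_smul, toAlgebra_concatLeft, smul_mul_assoc]

end PointLoops

/-! ### The string product and the center of the group algebra -/

section Center

variable {G : Type u} [Group G]

lemma mem_center_of_single_mul {a : MonoidAlgebra ℂ G}
    (h : ∀ k : G, MonoidAlgebra.single k 1 * a = a * MonoidAlgebra.single k 1) :
    a ∈ Subalgebra.center ℂ (MonoidAlgebra ℂ G) := by
  rw [Subalgebra.mem_center_iff]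
  intro b
  induction b using MonoidAlgebra.induction_linear with
  | zero => simp
  | add x y hx hy => rw [add_mul, mul_add, hx, hy]
  | single k c =>
    have : (MonoidAlgebra.single k c : MonoidAlgebra ℂ G) = c • MonoidAlgebra.single k 1 := by simp
    rw [this, smul_mul_assoc, mul_smul_comm, h]

lemma single_mul_single_inv (k : G) :
    (MonoidAlgebra.single k 1 * MonoidAlgebra.single k⁻¹ 1 : MonoidAlgebra ℂ G) = 1 := by
  simp [MonoidAlgebra.one_def]

lemma conj_eq_self {a : MonoidAlgebra ℂ G} (h : a ∈ Subalgebra.center ℂ (MonoidAlgebra ℂ G))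
    (k : G) : MonoidAlgebra.single k 1 * a * MonoidAlgebra.single k⁻¹ 1 = a := by
  rw [Subalgebra.mem_center_iff.1 h, mul_assoc, single_mul_single_inv, mul_one]

lemma sum_conj_mem_center [Fintype G] (a : MonoidAlgebra ℂ G) :
    ∑ k : G, MonoidAlgebra.single k 1 * a * MonoidAlgebra.single k⁻¹ 1 ∈
      Subalgebra.center ℂ (MonoidAlgebra ℂ G) := by
  refine mem_center_of_single_mul fun l => ?_
  rw [Finset.mul_sum, Finset.sum_mul]
  -- Replacing `k` by `l k` absorbs the factor on the left and produces the one on the right.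
  refine Fintype.sum_equiv (Equiv.mulLeft l) _ _ fun k => ?_
  simp [← mul_assoc, MonoidAlgebra.single_mul_single]
  simp [mul_assoc, MonoidAlgebra.single_mul_single]

variable [Fintype G]

lemma dwTrace_apply (z : Subalgebra.center ℂ (MonoidAlgebra ℂ G)) :
    dwTrace G z = (z : MonoidAlgebra ℂ G).coeff 1 / (Fintype.card G : ℂ) := rfl

lemma card_ne_zero : (Fintype.card G : ℂ) ≠ 0 := Nat.cast_ne_zero.2 Fintype.card_ne_zero

/-- The adjoint `∑ a_g g ↦ ∑ conj(a_g) g⁻¹`. -/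
noncomputable def adjointElement (a : MonoidAlgebra ℂ G) : MonoidAlgebra ℂ G :=
  ∑ g : G, MonoidAlgebra.single g (star (a.coeff g⁻¹))

lemma coeff_adjointElement (a : MonoidAlgebra ℂ G) (g : G) :
    (adjointElement a).coeff g = star (a.coeff g⁻¹) := by
  classical
  simp [adjointElement, Finsupp.single_apply]

lemma adjointElement_mem_center {a : MonoidAlgebra ℂ G}
    (h : a ∈ Subalgebra.center ℂ (MonoidAlgebra ℂ G)) :
    adjointElement a ∈ Subalgebra.center ℂ (MonoidAlgebra ℂ G) := by
  refine mem_center_of_single_mul fun k => ?_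
  ext g
  -- Commuting with `k⁻¹`, read at `g⁻¹`, says that the coefficients of `a` at `k g⁻¹` and `g⁻¹ k`
  -- agree.
  have := congrArg (fun b => b.coeff g⁻¹)
    (Subalgebra.mem_center_iff.1 h (MonoidAlgebra.single k⁻¹ 1))
  simp only [MonoidAlgebra.coeff_single_mul_apply, MonoidAlgebra.coeff_mul_single_apply, one_mul,
    mul_one, inv_inv] at this
  rw [MonoidAlgebra.coeff_single_mul_apply, MonoidAlgebra.coeff_mul_single_apply,
    coeff_adjointElement, coeff_adjointElement, one_mul, mul_one, mul_inv_rev, mul_inv_rev, inv_inv,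
    ← this]

lemma isCommFrobeniusAlgebra_center :
    IsCommFrobeniusAlgebra (LinearMap.mul ℂ (Subalgebra.center ℂ (MonoidAlgebra ℂ G)))
      (dwTrace G) where
  finiteDimensional := by
    have : FiniteDimensional ℂ (MonoidAlgebra ℂ G) :=
      Module.Finite.equiv (MonoidAlgebra.coeffLinearEquiv ℂ : MonoidAlgebra ℂ G ≃ₗ[ℂ] _).symm
    exact FiniteDimensional.finiteDimensional_submodule
      (Subalgebra.toSubmodule (Subalgebra.center ℂ (MonoidAlgebra ℂ G)))
  assoc x y z := mul_assoc x y z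
  comm x y := mul_comm x y
  exists_one := ⟨1, fun x => one_mul x⟩
  nondegenerate x hx := by
    -- The coefficient at `1` of the product of `x` with its adjoint is the sum of the squared
    -- absolute values of the coefficients of `x`.
    have h := hx ⟨adjointElement x.1, adjointElement_mem_center x.2⟩
    rw [LinearMap.mul_apply', dwTrace_apply, div_eq_zero_iff, or_iff_left card_ne_zero] at h
    have h' : ∑ g : G, ‖x.1.coeff g‖ ^ 2 = 0 := by
      rw [← Complex.ofReal_inj, Complex.ofReal_zero, ← h]
      refine Eq.trans ?_ (MonoidAlgebra.coeff_mul_apply_left x.1 (adjointElement x.1) 1).symm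
      rw [Finsupp.sum_fintype _ _ fun _ => zero_mul _, Complex.ofReal_sum]
      refine Finset.sum_congr rfl fun g _ => ?_
      rw [coeff_adjointElement, mul_one, inv_inv, Complex.ofReal_pow]
      exact (Complex.mul_conj' _).symm
    rw [Finset.sum_eq_zero_iff_of_nonneg fun _ _ => by positivity] at h'
    refine Subtype.ext (MonoidAlgebra.coeff_injective (Finsupp.ext fun g => ?_))
    simpa using h' g (Finset.mem_univ g)

end Center

section StringProduct

variable (G : Type u) [Group G] [Fintype G]

/-- The transfer to the lifted loops, followed by the holonomy. -/
noncomputable def holonomyTransfer :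
    TotalHomology (freeLoopSpace (BSpace G)) →ₗ[ℂ] TotalHomology (pointLoops G) :=
  homologyMap (holonomy G) ∘ₗ
    transfer (loopCover G) LiftedLoops.loopCover_isCoveringMap LiftedLoops.finite_fiber

/-- The inverse of the isomorphism induced by the holonomy, followed by the projection. -/
noncomputable def holonomyProjection :
    TotalHomology (pointLoops G) →ₗ[ℂ] TotalHomology (freeLoopSpace (BSpace G)) :=
  homologyMap (loopCover G) ∘ₗ
    (LinearEquiv.ofBijective (homologyMap (holonomy G))
      LiftedLoops.homologyMap_holonomy_bijective).symm.toLinearMap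

variable {G}

lemma holonomyProjection_holonomyTransfer (x : TotalHomology (freeLoopSpace (BSpace G))) :
    holonomyProjection G (holonomyTransfer G x) = (Fintype.card G : ℂ) • x := by
  rw [holonomyProjection, holonomyTransfer, LinearMap.comp_apply, LinearMap.comp_apply]
  have := LinearEquiv.symm_apply_apply (LinearEquiv.ofBijective (homologyMap (holonomy G))
      LiftedLoops.homologyMap_holonomy_bijective)
      (transfer (loopCover G) LiftedLoops.loopCover_isCoveringMap LiftedLoops.finite_fiber x)
  refine (congrArg _ this).trans ?_
  rw [Transfer.homologyMap_transfer LiftedLoops.isQuotientCoveringMap_loopCover,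
    Nat.card_eq_fintype_card]

/-- Transfer after projection is the sum of the deck transformations, and the holonomy turns each of
them into a conjugation. -/
lemma holonomyTransfer_holonomyProjection (z : TotalHomology (pointLoops G)) :
    holonomyTransfer G (holonomyProjection G z) =
      ∑ k : G, homologyMap (LiftedLoops.conjHom k) z := by
  obtain ⟨w, rfl⟩ := LiftedLoops.homologyMap_holonomy_bijective.2 z
  have h : holonomyProjection G (homologyMap (holonomy G) w) = homologyMap (loopCover G) w :=
    congrArg (homologyMap (loopCover G)) (LinearEquiv.symm_apply_apply (LinearEquiv.ofBijective
      (homologyMap (holonomy G)) LiftedLoops.homologyMap_holonomy_bijective) w)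
  rw [h, holonomyTransfer, LinearMap.comp_apply,
    Transfer.transfer_homologyMap LiftedLoops.isQuotientCoveringMap_loopCover, map_sum]
  refine Finset.sum_congr rfl fun k _ => ?_
  rw [← homologyMap_comp_apply, LiftedLoops.smulHom_holonomy, homologyMap_comp_apply]

lemma toAlgebra_holonomyTransfer_holonomyProjection (z : TotalHomology (pointLoops G)) :
    PointLoops.toAlgebra (holonomyTransfer G (holonomyProjection G z)) =
      ∑ k : G, MonoidAlgebra.single k 1 * PointLoops.toAlgebra z * MonoidAlgebra.single k⁻¹ 1 := by
  rw [holonomyTransfer_holonomyProjection, map_sum]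
  exact Finset.sum_congr rfl fun k _ => PointLoops.toAlgebra_conjHom k z

lemma toAlgebra_holonomyTransfer_holonomyProjection_of_mem_center
    {z : TotalHomology (pointLoops G)}
    (hz : PointLoops.toAlgebra z ∈ Subalgebra.center ℂ (MonoidAlgebra ℂ G)) :
    PointLoops.toAlgebra (holonomyTransfer G (holonomyProjection G z)) =
      (Fintype.card G : ℂ) • PointLoops.toAlgebra z := by
  rw [toAlgebra_holonomyTransfer_holonomyProjection,
    Finset.sum_congr rfl fun k _ => conj_eq_self hz k, Finset.sum_const, Finset.card_univ,
    Nat.cast_smul_eq_nsmul]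

/-- As $|G|$ is invertible, every class comes from the projection, so its transfer is a sum over all
conjugates. -/
lemma toAlgebra_holonomyTransfer_mem_center (x : TotalHomology (freeLoopSpace (BSpace G))) :
    PointLoops.toAlgebra (holonomyTransfer G x) ∈ Subalgebra.center ℂ (MonoidAlgebra ℂ G) := by
  have h : x = holonomyProjection G (holonomyTransfer G ((Fintype.card G : ℂ)⁻¹ • x)) := by
    rw [holonomyProjection_holonomyTransfer, smul_inv_smul₀ card_ne_zero]
  rw [h, toAlgebra_holonomyTransfer_holonomyProjection]
  exact sum_conj_mem_center _

lemma stringProduct_apply (hcov : IsCoveringMap (loopCover G))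
    (hfin : ∀ σ, Finite (loopCover G ⁻¹' {σ}))
    (hhol : Function.Bijective (homologyMap (holonomy G)))
    (x y : TotalHomology (freeLoopSpace (BSpace G))) :
    stringProduct G hcov hfin hhol x y =
      holonomyProjection G (pointProduct G (holonomyTransfer G x) (holonomyTransfer G y)) := rfl

lemma stringTrace_apply (hcov : IsCoveringMap (loopCover G))
    (hfin : ∀ σ, Finite (loopCover G ⁻¹' {σ}))
    (x : TotalHomology (freeLoopSpace (BSpace G))) :
    stringTrace G hcov hfin x = (PointLoops.toAlgebra (holonomyTransfer G x)).coeff 1 := by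
  rw [PointLoops.toAlgebra_coeff]
  rfl

variable (G) in
/-- The isomorphism of the homology of the loop space with the center of the group algebra. -/
noncomputable def toCenter :
    TotalHomology (freeLoopSpace (BSpace G)) →ₗ[ℂ] Subalgebra.center ℂ (MonoidAlgebra ℂ G) :=
  (Fintype.card G : ℂ) • (PointLoops.toAlgebra ∘ₗ holonomyTransfer G).codRestrict
    (Subalgebra.toSubmodule (Subalgebra.center ℂ (MonoidAlgebra ℂ G)))
    toAlgebra_holonomyTransfer_mem_center

lemma coe_toCenter (x : TotalHomology (freeLoopSpace (BSpace G))) :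
    (toCenter G x : MonoidAlgebra ℂ G) =
      (Fintype.card G : ℂ) • PointLoops.toAlgebra (holonomyTransfer G x) := rfl

lemma toCenter_bijective : Function.Bijective (toCenter G) := by
  constructor
  · rw [← LinearMap.ker_eq_bot, LinearMap.ker_eq_bot']
    intro x hx
    have h := congrArg Subtype.val hx
    rw [coe_toCenter] at h
    have h' : holonomyTransfer G x = 0 := PointLoops.toAlgebra_injective <| by
      rw [map_zero]
      exact (smul_eq_zero.1 h).resolve_left card_ne_zero
    have h'' := holonomyProjection_holonomyTransfer x
    rw [h', map_zero] at h''
    exact (smul_eq_zero.1 h''.symm).resolve_left card_ne_zero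
  · intro a
    obtain ⟨z, hz⟩ := PointLoops.toAlgebra_surjective a.1
    -- One factor cancels the scaling in `toCenter`, the other the sum over conjugates of a central
    -- element.
    refine ⟨((Fintype.card G : ℂ)⁻¹ * (Fintype.card G : ℂ)⁻¹) • holonomyProjection G z,
      Subtype.ext ?_⟩
    rw [coe_toCenter, map_smul, map_smul,
      toAlgebra_holonomyTransfer_holonomyProjection_of_mem_center (hz ▸ a.2), hz, smul_smul,
      smul_smul]
    have := card_ne_zero (G := G)
    field_simp
    simp

/-- The transferred factors are central, so projecting their product and transferring again
multiplies it by $|G|$. The scaling in `toCenter` contributes $|G|$ on the left and $|G|^2$ on the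
right, so both sides carry $|G|^2$. -/
lemma toCenter_stringProduct (hcov : IsCoveringMap (loopCover G))
    (hfin : ∀ σ, Finite (loopCover G ⁻¹' {σ}))
    (hhol : Function.Bijective (homologyMap (holonomy G)))
    (x y : TotalHomology (freeLoopSpace (BSpace G))) :
    toCenter G (stringProduct G hcov hfin hhol x y) = toCenter G x * toCenter G y := by
  refine Subtype.ext ?_
  have hmem : PointLoops.toAlgebra (pointProduct G (holonomyTransfer G x) (holonomyTransfer G y)) ∈
      Subalgebra.center ℂ (MonoidAlgebra ℂ G) := by
    rw [PointLoops.toAlgebra_pointProduct]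
    exact mul_mem (toAlgebra_holonomyTransfer_mem_center x)
      (toAlgebra_holonomyTransfer_mem_center y)
  rw [coe_toCenter, stringProduct_apply,
    toAlgebra_holonomyTransfer_holonomyProjection_of_mem_center hmem,
    PointLoops.toAlgebra_pointProduct]
  refine Eq.trans ?_ (congrArg₂ (· * ·) (coe_toCenter x) (coe_toCenter y)).symm
  rw [smul_mul_smul_comm, smul_smul]

lemma stringTrace_eq (hcov : IsCoveringMap (loopCover G))
    (hfin : ∀ σ, Finite (loopCover G ⁻¹' {σ})) (x : TotalHomology (freeLoopSpace (BSpace G))) :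
    stringTrace G hcov hfin x = dwTrace G (toCenter G x) := by
  rw [stringTrace_apply, dwTrace_apply, coe_toCenter, MonoidAlgebra.coeff_smul_apply, smul_eq_mul,
    mul_div_cancel_left₀ _ card_ne_zero]

end StringProduct

lemma IsCommFrobeniusAlgebra.of_linearEquiv {A B : Type*} [AddCommGroup A] [Module ℂ A]
    [AddCommGroup B] [Module ℂ B] {m : A →ₗ[ℂ] A →ₗ[ℂ] A} {tr : A →ₗ[ℂ] ℂ}
    {m' : B →ₗ[ℂ] B →ₗ[ℂ] B} {tr' : B →ₗ[ℂ] ℂ} (h : IsCommFrobeniusAlgebra m' tr')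
    (φ : A ≃ₗ[ℂ] B) (hm : ∀ x y, φ (m x y) = m' (φ x) (φ y)) (htr : ∀ x, tr x = tr' (φ x)) :
    IsCommFrobeniusAlgebra m tr where
  finiteDimensional := by
    have := h.finiteDimensional
    exact φ.symm.finiteDimensional
  assoc x y z := φ.injective (by rw [hm, hm, hm, hm, h.assoc])
  comm x y := φ.injective (by rw [hm, hm, h.comm])
  exists_one := by
    obtain ⟨e, he⟩ := h.exists_one
    exact ⟨φ.symm e, fun x => φ.injective (by rw [hm, φ.apply_symm_apply, he])⟩
  nondegenerate x hx := by
    refine φ.map_eq_zero_iff.1 (h.nondegenerate _ fun y => ?_)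
    obtain ⟨y, rfl⟩ := φ.surjective y
    rw [← hm, ← htr, hx]

/-! ### The equivalences of groupoids -/

namespace CategoryTheory.ActionCategory

variable {M N : Type*} [Monoid M] [Monoid N] {X Y : Type*} [MulAction M X] [MulAction N Y]

/-- The functor of action categories induced by a map that is equivariant along a homomorphism. -/
def mapFunctor (φ : M →* N) (f : X → Y) (h : ∀ m x, f (m • x) = φ m • f x) :
    ActionCategory M X ⥤ ActionCategory N Y where
  obj x := objEquiv N Y (f x.back)
  map {x _} a := ⟨φ a.val, (h a.val x.back).symm.trans (congrArg f a.property)⟩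
  map_id _ := Subtype.ext (map_one φ)
  map_comp a b := Subtype.ext (map_mul φ b.val a.val)

variable {φ : M →* N} {f : X → Y} {h : ∀ m x, f (m • x) = φ m • f x}

lemma mapFunctor_faithful (hφ : Function.Injective φ) : (mapFunctor φ f h).Faithful where
  map_injective hab := Subtype.ext (hφ (congrArg Subtype.val hab))

lemma mapFunctor_full (hφ : ∀ x y n, n • f x = f y → ∃ m : M, m • x = y ∧ φ m = n) :
    (mapFunctor φ f h).Full where
  map_surjective b := by
    obtain ⟨m, hm, hb⟩ := hφ _ _ b.val b.property
    exact ⟨⟨m, hm⟩, Subtype.ext hb⟩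

end CategoryTheory.ActionCategory

section

variable (G : Type u) [Group G]

/-- A right action of a group turned into a left action. -/
def opToConjAct : Gᵐᵒᵖ →* ConjAct G where
  toFun k := ConjAct.toConjAct k.unop⁻¹
  map_one' := by simp
  map_mul' k l := by simp

lemma opToConjAct_bijective : Function.Bijective (opToConjAct G) :=
  (ConjAct.toConjAct.toEquiv.bijective.comp (Equiv.inv G).bijective).comp
    MulOpposite.unop_bijective

lemma opToConjAct_smul (k : Gᵐᵒᵖ) (x : G) : opToConjAct G k • x = k.unop⁻¹ * x * k.unop :=
  congrArg (k.unop⁻¹ * x * ·) (inv_inv k.unop)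

/-- Paths in a point carry no data, so objects are group elements, and inversion turns the right
conjugation action into the left one. -/
lemma nonempty_loopGroupoid_equivalence :
    Nonempty (LoopGroupoid G PUnit.{u + 1} ≌ ActionCategory (ConjAct G) G) := by
  let F : LoopGroupoid G PUnit.{u + 1} ⥤ ActionCategory (ConjAct G) G :=
    ActionCategory.mapFunctor (opToConjAct G) (fun a => a.1) fun k a => by
      rw [opToConjAct_smul]
      rfl
  have : F.Faithful := ActionCategory.mapFunctor_faithful (opToConjAct_bijective G).1
  have : F.Full := ActionCategory.mapFunctor_full fun x y n hn => by
    obtain ⟨k, rfl⟩ := (opToConjAct_bijective G).2 n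
    refine ⟨k, ?_, rfl⟩
    exact OrbifoldLoops.ext ((opToConjAct_smul G k x.1).symm.trans hn)
      fun _ => Subsingleton.elim _ _
  have : F.EssSurj := ⟨fun g => ⟨ActionCategory.objEquiv _ _ (OrbifoldLoops.star g.back),
    ⟨eqToIso (ActionCategory.back_coe g)⟩⟩⟩
  have : F.IsEquivalence := { }
  exact ⟨F.asEquivalence⟩

/-- The action groupoid is the union of its orbits, and each orbit is equivalent to the stabilizer
of its chosen point, here the centralizer. -/
lemma nonempty_conjugation_equivalence (r : ConjClasses G → G)
    (hr : ∀ c, ConjClasses.mk (r c) = c) :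
    Nonempty (ActionCategory (ConjAct G) G ≌
      Σ c : ConjClasses G,
        TranslationGroupoid (Subgroup.centralizer ({r c} : Set G)) PUnit.{u + 1}) := by
  let φ (c : ConjClasses G) : (Subgroup.centralizer ({r c} : Set G))ᵐᵒᵖ →* ConjAct G :=
    (opToConjAct G).comp (MonoidHom.op (Subgroup.subtype _))
  have hmem : ∀ c k, k ∈ Subgroup.centralizer ({r c} : Set G) ↔
      opToConjAct G (MulOpposite.op k) • r c = r c := fun c k => by
    rw [Subgroup.mem_centralizer_singleton_iff]
    rw [opToConjAct_smul, MulOpposite.unop_op, mul_assoc, inv_mul_eq_iff_eq_mul]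
    exact eq_comm
  let f (c : ConjClasses G) :
      TranslationGroupoid (Subgroup.centralizer ({r c} : Set G)) PUnit.{u + 1} ⥤
        ActionCategory (ConjAct G) G :=
    ActionCategory.mapFunctor (φ c) (fun _ => r c) fun k _ => ((hmem c _).1 k.unop.2).symm
  let F := Sigma.desc f
  have hFaithful : ∀ c, (f c).Faithful := fun c => ActionCategory.mapFunctor_faithful
    ((opToConjAct_bijective G).1.comp fun k l hkl => MulOpposite.unop_injective
      (Subtype.ext (MulOpposite.op_injective hkl)))
  have hFull : ∀ c, (f c).Full := fun c => ActionCategory.mapFunctor_full fun x y n hn => by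
    obtain ⟨k, rfl⟩ := (opToConjAct_bijective G).2 n
    exact ⟨MulOpposite.op ⟨k.unop, (hmem c _).2 hn⟩, Subsingleton.elim _ _, rfl⟩
  have : F.Faithful := ⟨by
    rintro ⟨c, x⟩ ⟨_, y⟩ ⟨a⟩ ⟨b⟩ hab
    exact congrArg _ ((f c).map_injective hab)⟩
  have : F.Full := ⟨by
    rintro ⟨c, x⟩ ⟨d, y⟩ b
    -- An arrow between two representatives conjugates one to the other, so there are no arrows
    -- between different summands.
    obtain rfl : c = d := by
      rw [← hr c, ← hr d, ConjClasses.mk_eq_mk_iff_isConj, isConj_iff]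
      exact ⟨ConjAct.ofConjAct b.val, b.property⟩
    obtain ⟨a, ha⟩ := (f c).map_surjective b
    exact ⟨Sigma.SigmaHom.mk a, ha⟩⟩
  have : F.EssSurj := ⟨fun g => by
    obtain ⟨k, hk⟩ := isConj_iff.1 (ConjClasses.mk_eq_mk_iff_isConj.1 (hr (ConjClasses.mk g.back)))
    exact ⟨⟨ConjClasses.mk g.back, ActionCategory.objEquiv _ _ PUnit.unit⟩,
      ⟨Groupoid.isoEquivHom _ _ |>.symm ⟨ConjAct.toConjAct k, hk⟩⟩⟩⟩
  have : F.IsEquivalence := { }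
  exact ⟨F.asEquivalence.symm⟩

end

/-! ### The Frobenius structure on the loop homology and the main theorem -/

lemma isCommFrobeniusAlgebra_stringProduct {G : Type u} [Group G] [Fintype G]
    (hcov : IsCoveringMap (loopCover G)) (hfin : ∀ σ, Finite (loopCover G ⁻¹' {σ}))
    (hhol : Function.Bijective (homologyMap (holonomy G))) :
    IsCommFrobeniusAlgebra (stringProduct G hcov hfin hhol) (stringTrace G hcov hfin) := by
  refine IsCommFrobeniusAlgebra.of_linearEquiv (isCommFrobeniusAlgebra_center (G := G))
    (LinearEquiv.ofBijective (toCenter G) toCenter_bijective) (fun x y => ?_) fun x => ?_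
  · rw [LinearEquiv.ofBijective_apply, LinearEquiv.ofBijective_apply,
      LinearEquiv.ofBijective_apply]
    exact toCenter_stringProduct hcov hfin hhol x y
  · rw [LinearEquiv.ofBijective_apply]
    exact stringTrace_eq hcov hfin x

theorem mainTheorem10 (G : Type u) [Group G] [Fintype G]
    (r : ConjClasses G → G) (hr : ∀ c, ConjClasses.mk (r c) = c) :
    Nonempty (LoopGroupoid G PUnit.{u + 1} ≌ ActionCategory (ConjAct G) G) ∧
    Nonempty (ActionCategory (ConjAct G) G ≌
      Σ c : ConjClasses G,
        TranslationGroupoid (Subgroup.centralizer ({r c} : Set G)) PUnit.{u + 1}) ∧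
    Nonempty (ContinuousMap.HomotopyEquiv (freeLoopSpace (BSpace G))
      (Σ c : ConjClasses G, BSpace (Subgroup.centralizer ({r c} : Set G)))) ∧
    (∀ n : ℕ, n ≠ 0 → Subsingleton (Hn n (freeLoopSpace (BSpace G)))) ∧
    ∃ (hcov : IsCoveringMap (loopCover G)) (hfin : ∀ σ, Finite (loopCover G ⁻¹' {σ}))
      (hhol : Function.Bijective (homologyMap (holonomy G))),
      IsCommFrobeniusAlgebra (stringProduct G hcov hfin hhol) (stringTrace G hcov hfin) ∧
      IsCommFrobeniusAlgebra (LinearMap.mul ℂ (Subalgebra.center ℂ (MonoidAlgebra ℂ G)))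
        (dwTrace G) ∧
      ∃ φ : TotalHomology (freeLoopSpace (BSpace G)) ≃ₗ[ℂ]
          Subalgebra.center ℂ (MonoidAlgebra ℂ G),
        (∀ x y, φ (stringProduct G hcov hfin hhol x y) = φ x * φ y) ∧
        ∀ x, stringTrace G hcov hfin x = dwTrace G (φ x) := by

  refine ⟨nonempty_loopGroupoid_equivalence G, nonempty_conjugation_equivalence G r hr,
    LiftedLoops.nonempty_homotopyEquiv r hr, fun n hn => LiftedLoops.subsingleton_Hn hn,
    LiftedLoops.loopCover_isCoveringMap, LiftedLoops.finite_fiber,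
    LiftedLoops.homologyMap_holonomy_bijective, isCommFrobeniusAlgebra_stringProduct _ _ _,
    isCommFrobeniusAlgebra_center, LinearEquiv.ofBijective (toCenter G) toCenter_bijective,
    fun x y => ?_, fun x => ?_⟩
  · rw [LinearEquiv.ofBijective_apply, LinearEquiv.ofBijective_apply,
      LinearEquiv.ofBijective_apply]
    exact toCenter_stringProduct _ _ _ x y
  · rw [LinearEquiv.ofBijective_apply]
    exact stringTrace_eq _ _ x
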